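/- **Conventions.** A *diagram category* $\mathbf{Dia}$ is a full sub-2-category of the 2-category of small categories that contains $\{0<1\}$, is closed under finite products and coproducts, opposites, subcategories and slices $I/i$ ($i\in I\in\mathbf{Dia}$), and contains $I$ whenever there is a fibration $I\to J$ with $J$ and all fibers in $\mathbf{Dia}$. A *prederivator* of type $\mathbf{Dia}$ is a pseudofunctor $\mathbb{D}$ from $\mathbf{Dia}$, with 1-cells and 2-cells reversed, to categories; write $u^*=\mathbb{D}(u)$ and $\eta^*=\mathbb D(\eta):v^*\to u^*$ for $\eta:u\to v$. It is a *derivator* if (1) it takes coproducts to products; (2) for each $I$ the functors $i^*:\mathbb{D}(I)\to\mathbb{D}(\star)$, $i\in I$, are jointly conservative; (3) every $u^*$ has a left adjoint $u_\#$ and a right adjoint $u_*$; (4) for $u:I\to J$ and $j\in J$, with the projections $t:j\backslash I\to I$, $s:I/j\to I$ from the comma categories and $p$ the functors to $\star$, the Beck–Chevalley maps $p_{\#}t^*\to j^*u_\#$ and $j^*u_*\to p_{*}s^*$ are invertible. A *closed monoidal derivator* is a derivator $\mathbb D$ with a factorization of the pseudofunctor through closed symmetric monoidal categories, strong symmetric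 monoidal functors and monoidal transformations, such that the projection morphisms $p_{I\#}(p_I^*A\otimes B)\to A\otimes p_{I\#}B$ are invertible, where $p_I:I\to\star$. **Notation.** For $I\in\mathbf{Dia}$ let $\mathrm{tw}(I)$ be the twisted arrow category: objects are arrows $i\to j$ of $I$; morphisms from $i\to j$ to $i'\to j'$ are pairs $(i'\to i,\ j\to j')$ with composite $i'\to i\to j\to j'$ equal to the given $i'\to j'$. Let $$p:\mathrm{tw}(I)\times J\to I^\circ\times J,\qquad q:\mathrm{tw}(I)\times J\to I,\qquad r:\mathrm{tw}(I)\times J\to J$$ send $(i\to i',j)$ to $(i,j)$, $i'$ and $j$ respectively. For $A\in\mathbb D(I)$, $B\in\mathbb D(J)$ the *external hom* is $\langle\!\langle A,B\rangle\!\rangle :=p_*[q^*A,r^*B]\in\mathbb D(I^\circ\times J)$. For $u:I'\to I$, $v:J'\to J$, with primes denoting the analogous functors for $I',J'$, let $\Psi:(u^\circ\times v)^*\langle\!\langle A,B\rangle\!\rangle \to\langle\!\langle u^*A,v^*B\rangle\!\rangle $ be the composite of canonical maps $$(u^\circ\times v)^*p_*[q^*A,r^*B]\to p'_*(\mathrm{tw}(u)\times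 v)^*[q^*A,r^*B]\to p'_*[(\mathrm{tw}(u)\times v)^*q^*A,(\mathrm{tw}(u)\times v)^*r^*B]\cong p'_*[q'^*u^*A,r'^*v^*B].$$ Let $q_2:\mathrm{tw}(I)^\circ\to I^\circ\times I$, $(i\to j)\mapsto(j,i)$, and let $(pq)_2:\mathrm{tw}(I)^\circ\to I$, $(i\to j)\mapsto i$. Let $3I$ be the category whose objects are pairs of composable arrows $i_2\to i_1\to i_0$ in $I$ and whose morphisms to $j_2\to j_1\to j_0$ are triples $(i_2\to j_2,\ j_1\to i_1,\ i_0\to j_0)$ such that $i_2\to j_2\to j_1\to i_1$ equals $i_2\to i_1$ and $j_1\to i_1\to i_0\to j_0$ equals $j_1\to j_0$; let $t_2,t_0:3I\to I$ be the projections to $i_2$ and $i_0$, $t_2\to t_0$ the transformation given by composition, and $\pi:3I\to\mathrm{tw}(I)^\circ$, $\kappa:3I\to\mathrm{tw}(I)\times I$ the functors $(i_2\to i_1\to i_0)\mapsto(i_2\to i_1)$ and $(i_2\to i_1\to i_0)\mapsto((i_1\to i_0),i_2)$. **Proposition.** Let $\mathbb D$ be a closed monoidal derivator of type $\mathbf{Dia}$.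 For $I\in\mathbf{Dia}$ and $A,B\in\mathbb D(I)$ consider the zigzag of canonical morphisms $$[A,B]\to[t_{2\#}t_2^*A,B]\to[t_{2\#}t_0^*A,B]\to t_{2*}[t_0^*A,t_2^*B]\cong(pq)_{2*}\pi_*[\kappa^*q^*A,\kappa^*r^*B]\leftarrow(pq)_{2*}\pi_*\kappa^*[q^*A,r^*B]\leftarrow(pq)_{2*}q_2^*p_*[q^*A,r^*B].$$ The two arrows pointing to the left are invertible, and the resulting morphism $$\Theta^I_{A,B}:[A,B]\to(pq)_{2*}q_2^*\langle\!\langle A,B\rangle\!\rangle $$ is invertible and natural in $A$ and $B$. It is compatible with restriction: for every $u:I'\to I$ in $\mathbf{Dia}$, $$\bigl(u^*[A,B]\xrightarrow{u^*\Theta^I}u^*(pq)_{2*}q_2^*\langle\!\langle A,B\rangle\!\rangle \to(pq)'_{2*}(\mathrm{tw}(u)^{\circ})^*q_2^*\langle\!\langle A,B\rangle\!\rangle \cong(pq)'_{2*}q_2'^*(u^\circ\times u)^*\langle\!\langle A,B\rangle\!\rangle \xrightarrow{\Psi}(pq)'_{2*}q_2'^*\langle\!\langle u^*A,u^*B\rangle\!\rangle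 \bigr)$$ equals the composite $u^*[A,B]\to[u^*A,u^*B]\xrightarrow{\Theta^{I'}}(pq)'_{2*}q_2'^*\langle\!\langle u^*A,u^*B\rangle\!\rangle $. Moreover the canonical morphisms $u^*[A,B]\to[u^*A,u^*B]$ and the morphisms $u^*(pq)_{2*}q_2^*\langle\!\langle A,B\rangle\!\rangle \to(pq)'_{2*}q_2'^*\langle\!\langle u^*A,u^*B\rangle\!\rangle $ just described are natural in $A,B$ and compatible with identities and composition in $u$; that is, $\Theta$ is an invertible modification between lax natural transformations from $\mathbb D(\cdot)^\circ\times\mathbb D(\cdot)$ to $\mathbb D(\cdot)$ (on the 1-category underlying $\mathbf{Dia}$). -/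

import Mathlib

open CategoryTheory Opposite MonoidalCategory

universe w v u

noncomputable section

/-! ### Diagram categories -/

/-- A diagram category: a full sub-2-category of the 2-category of small categories, given by the
class `mem` of its objects, containing the ordered set `{0 < 1}` and closed under finite products and
coproducts, opposites, subcategories, slices `I / i`, and (total categories of) fibrations with base
and fibres in the class.  A subcategory of `I` is
presented by a functor `F : J ⥤ I` which is faithful and injective on objects. -/
structure DiagramCategory where
  /-- the small categories belonging to the diagram category -/
  mem : ∀ (I : Type w) [SmallCategory I], Prop
  two : mem (ULift.{w} (Fin 2))
  terminal : mem (Discrete PUnit.{w + 1})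
  prod : ∀ (I J : Type w) [SmallCategory I] [SmallCategory J], mem I → mem J → mem (I × J)
  initial : mem (Discrete PEmpty.{w + 1})
  coprod : ∀ (I J : Type w) [SmallCategory I] [SmallCategory J], mem I → mem J → mem (I ⊕ J)
  op : ∀ (I : Type w) [SmallCategory I], mem I → mem Iᵒᵖ
  subcategory : ∀ (I J : Type w) [SmallCategory I] [SmallCategory J] (F : J ⥤ I) [F.Faithful],
    Function.Injective F.obj → mem I → mem J
  slice : ∀ (I : Type w) [SmallCategory I] (i : I), mem I → mem (Over i)
  fibration : ∀ (I J : Type w) [SmallCategory I] [SmallCategory J] (p : I ⥤ J) [p.IsFibered],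
    (∀ j : J, mem (p.Fiber j)) → mem J → mem I

/-- The small category `I` belongs to the diagram category `Dia`. -/
class InDia (Dia : DiagramCategory.{w}) (I : Type w) [SmallCategory I] : Prop where
  mem : Dia.mem I

/-! ### The twisted arrow category and the category of composable pairs -/

/-- The twisted arrow category `tw I`: objects are the arrows of `I`. -/
structure Tw (I : Type w) [SmallCategory I] : Type w where
  {src : I}
  {tgt : I}
  arr : src ⟶ tgt

namespace Tw

variable {I : Type w} [SmallCategory I]

/-- A morphism of `tw I` from `i ⟶ j` to `i' ⟶ j'` is a pair `i' ⟶ i`, `j ⟶ j'` such that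
`i' ⟶ i ⟶ j ⟶ j'` is the given arrow `i' ⟶ j'`. -/
@[ext]
structure Hom (f g : Tw I) : Type w where
  left : g.src ⟶ f.src
  right : f.tgt ⟶ g.tgt
  w : left ≫ f.arr ≫ right = g.arr

instance : SmallCategory (Tw I) where
  Hom := Hom
  id f := ⟨𝟙 _, 𝟙 _, by simp⟩
  comp φ ψ := ⟨ψ.left ≫ φ.left, φ.right ≫ ψ.right, by
    rw [← ψ.w, ← φ.w]; simp only [Category.assoc]⟩
  id_comp φ := Hom.ext (Category.comp_id _) (Category.id_comp _)
  comp_id φ := Hom.ext (Category.id_comp _) (Category.comp_id _)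
  assoc φ ψ χ := Hom.ext (Category.assoc _ _ _).symm (Category.assoc _ _ _)

@[ext]
theorem hom_ext {f g : Tw I} {φ ψ : f ⟶ g} (h₁ : φ.left = ψ.left) (h₂ : φ.right = ψ.right) :
    φ = ψ :=
  Hom.ext h₁ h₂

@[simp] theorem id_left (f : Tw I) : Hom.left (𝟙 f) = 𝟙 _ := rfl

@[simp] theorem id_right (f : Tw I) : Hom.right (𝟙 f) = 𝟙 _ := rfl

@[simp] theorem comp_left {f g h : Tw I} (φ : f ⟶ g) (ψ : g ⟶ h) :
    (φ ≫ ψ).left = ψ.left ≫ φ.left := rfl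

@[simp] theorem comp_right {f g h : Tw I} (φ : f ⟶ g) (ψ : g ⟶ h) :
    (φ ≫ ψ).right = φ.right ≫ ψ.right := rfl

/-- The source functor `tw I ⥤ Iᵒᵖ`. -/
def source (I : Type w) [SmallCategory I] : Tw I ⥤ Iᵒᵖ where
  obj f := op f.src
  map φ := φ.left.op

/-- The target functor `tw I ⥤ I`. -/
def target (I : Type w) [SmallCategory I] : Tw I ⥤ I where
  obj f := f.tgt
  map φ := φ.right

/-- The functor `q₂ : (tw I)ᵒᵖ ⥤ Iᵒᵖ × I`, sending `i ⟶ j` to `(j, i)`. -/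
def q₂ (I : Type w) [SmallCategory I] : (Tw I)ᵒᵖ ⥤ Iᵒᵖ × I where
  obj f := (op f.unop.tgt, f.unop.src)
  map φ := (φ.unop.right.op, φ.unop.left)

/-- The functor `(pq)₂ : (tw I)ᵒᵖ ⥤ I`, the composite of `q₂` with the projection to `I`;
it sends `i ⟶ j` to `i`. -/
def pq₂ (I : Type w) [SmallCategory I] : (Tw I)ᵒᵖ ⥤ I := q₂ I ⋙ CategoryTheory.Prod.snd _ _

/-- The functor `tw u : tw I' ⥤ tw I` induced by `u : I' ⥤ I`. -/
def map {I' : Type w} [SmallCategory I'] (u : I' ⥤ I) : Tw I' ⥤ Tw I where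
  obj f := ⟨u.map f.arr⟩
  map φ := ⟨u.map φ.left, u.map φ.right, by rw [← φ.w]; simp only [Functor.map_comp]⟩
  map_id f := hom_ext (u.map_id _) (u.map_id _)
  map_comp φ ψ := hom_ext (u.map_comp _ _) (u.map_comp _ _)

end Tw

/-- The category `3I`: objects are pairs of composable arrows `x₂ ⟶ x₁ ⟶ x₀` of `I`. -/
structure Three (I : Type w) [SmallCategory I] : Type w where
  {x₂ : I}
  {x₁ : I}
  {x₀ : I}
  f : x₂ ⟶ x₁
  g : x₁ ⟶ x₀

namespace Three

variable {I : Type w} [SmallCategory I]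

/-- A morphism of `3I` from `x₂ ⟶ x₁ ⟶ x₀` to `y₂ ⟶ y₁ ⟶ y₀` consists of arrows `x₂ ⟶ y₂`,
`y₁ ⟶ x₁`, `x₀ ⟶ y₀` such that `x₂ ⟶ y₂ ⟶ y₁ ⟶ x₁` is the given arrow `x₂ ⟶ x₁` and
`y₁ ⟶ x₁ ⟶ x₀ ⟶ y₀` is the given arrow `y₁ ⟶ y₀`. -/
@[ext]
structure Hom (X Y : Three I) : Type w where
  a₂ : X.x₂ ⟶ Y.x₂
  a₁ : Y.x₁ ⟶ X.x₁
  a₀ : X.x₀ ⟶ Y.x₀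
  wf : a₂ ≫ Y.f ≫ a₁ = X.f
  wg : a₁ ≫ X.g ≫ a₀ = Y.g

instance : SmallCategory (Three I) where
  Hom := Hom
  id X := ⟨𝟙 _, 𝟙 _, 𝟙 _, by simp, by simp⟩
  comp φ ψ := ⟨φ.a₂ ≫ ψ.a₂, ψ.a₁ ≫ φ.a₁, φ.a₀ ≫ ψ.a₀, by
    rw [← φ.wf, ← ψ.wf]; simp only [Category.assoc], by
    rw [← ψ.wg, ← φ.wg]; simp only [Category.assoc]⟩
  id_comp φ := Hom.ext (Category.id_comp _) (Category.comp_id _) (Category.id_comp _)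
  comp_id φ := Hom.ext (Category.comp_id _) (Category.id_comp _) (Category.comp_id _)
  assoc φ ψ χ := Hom.ext (Category.assoc _ _ _) (Category.assoc _ _ _).symm (Category.assoc _ _ _)

@[ext]
theorem hom_ext {X Y : Three I} {φ ψ : X ⟶ Y} (h₂ : φ.a₂ = ψ.a₂) (h₁ : φ.a₁ = ψ.a₁)
    (h₀ : φ.a₀ = ψ.a₀) : φ = ψ :=
  Hom.ext h₂ h₁ h₀

/-- `t₂ : 3I ⥤ I`, `(x₂ ⟶ x₁ ⟶ x₀) ↦ x₂`. -/
def t₂ (I : Type w) [SmallCategory I] : Three I ⥤ I where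
  obj X := X.x₂
  map φ := φ.a₂

/-- `t₀ : 3I ⥤ I`, `(x₂ ⟶ x₁ ⟶ x₀) ↦ x₀`. -/
def t₀ (I : Type w) [SmallCategory I] : Three I ⥤ I where
  obj X := X.x₀
  map φ := φ.a₀

/-- The canonical natural transformation `t₂ ⟶ t₀`, given by the composite arrows. -/
def τ (I : Type w) [SmallCategory I] : t₂ I ⟶ t₀ I where
  app X := X.f ≫ X.g
  naturality X Y φ := by
    have h₁ := φ.wf
    have h₂ := φ.wg
    change φ.a₂ ≫ Y.f ≫ Y.g = (X.f ≫ X.g) ≫ φ.a₀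
    rw [← h₂, ← h₁]
    simp only [Category.assoc]

/-- `3I ⥤ (tw I)ᵒᵖ`, `(x₂ ⟶ x₁ ⟶ x₀) ↦ (x₂ ⟶ x₁)`. -/
def toTwOp (I : Type w) [SmallCategory I] : Three I ⥤ (Tw I)ᵒᵖ where
  obj X := op ⟨X.f⟩
  map φ := Quiver.Hom.op ⟨φ.a₂, φ.a₁, φ.wf⟩

/-- `3I ⥤ tw I × I`, `(x₂ ⟶ x₁ ⟶ x₀) ↦ ((x₁ ⟶ x₀), x₂)`. -/
def toTwProd (I : Type w) [SmallCategory I] : Three I ⥤ Tw I × I where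
  obj X := (⟨X.g⟩, X.x₂)
  map φ := (⟨φ.a₁, φ.a₀, φ.wg⟩, φ.a₂)

end Three

/-! ### The diagram `Π_{I,J}` -/

namespace Ext

variable (I J : Type w) [SmallCategory I] [SmallCategory J]

/-- `p : tw I × J ⥤ Iᵒᵖ × J`, `((i ⟶ i'), j) ↦ (i, j)`. -/
def p : Tw I × J ⥤ Iᵒᵖ × J := (Tw.source I).prod (𝟭 J)

/-- `q : tw I × J ⥤ I`, `((i ⟶ i'), j) ↦ i'`. -/
def q : Tw I × J ⥤ I := CategoryTheory.Prod.fst _ _ ⋙ Tw.target I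

/-- `r : tw I × J ⥤ J`, `((i ⟶ i'), j) ↦ j`. -/
def r : Tw I × J ⥤ J := CategoryTheory.Prod.snd _ _

end Ext

/-! ### Diagram categories contain the categories used below -/

namespace InDia

variable (Dia : DiagramCategory.{w}) (I J : Type w) [SmallCategory I] [SmallCategory J]

instance terminal : InDia Dia (Discrete PUnit.{w + 1}) := ⟨Dia.terminal⟩

instance initial : InDia Dia (Discrete PEmpty.{w + 1}) := ⟨Dia.initial⟩

instance prod [hI : InDia Dia I] [hJ : InDia Dia J] : InDia Dia (I × J) :=
  ⟨Dia.prod I J hI.mem hJ.mem⟩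

instance coprod [hI : InDia Dia I] [hJ : InDia Dia J] : InDia Dia (I ⊕ J) :=
  ⟨Dia.coprod I J hI.mem hJ.mem⟩

instance opposite [hI : InDia Dia I] : InDia Dia Iᵒᵖ := ⟨Dia.op I hI.mem⟩

instance slice [hI : InDia Dia I] (i : I) : InDia Dia (Over i) := ⟨Dia.slice I i hI.mem⟩

variable {Dia I J}

theorem of_subcategory [hI : InDia Dia I] (F : J ⥤ I) [F.Faithful]
    (hF : Function.Injective F.obj) : InDia Dia J :=
  ⟨Dia.subcategory I J F hF hI.mem⟩

instance costructuredArrow [InDia Dia I] [InDia Dia J] (u : I ⥤ J) (j : J) :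
    InDia Dia (CostructuredArrow u j) := by
  let F : CostructuredArrow u j ⥤ I × Over j :=
    (CostructuredArrow.proj u j).prod' (CostructuredArrow.toOver u j)
  have : F.Faithful := ⟨fun h => CostructuredArrow.hom_ext _ _ (congrArg (fun x => x.1) h)⟩
  refine of_subcategory F ?_
  rintro ⟨a, ⟨⟨⟩⟩, f⟩ ⟨b, ⟨⟨⟩⟩, g⟩ h
  obtain ⟨h₁, h₂⟩ := Prod.ext_iff.1 h
  obtain rfl : a = b := h₁
  have h₃ : Over.mk f = Over.mk g := h₂
  obtain rfl : f = g := eq_of_heq (Comma.mk.inj h₃).2.2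
  rfl

instance structuredArrow [InDia Dia I] [InDia Dia J] (u : I ⥤ J) (j : J) :
    InDia Dia (StructuredArrow j u) := by
  let F : StructuredArrow j u ⥤ (CostructuredArrow u.op (op j))ᵒᵖ :=
    { obj := fun X => op (CostructuredArrow.mk (S := u.op) (T := op j) (Y := op X.right) X.hom.op)
      map := fun φ => Quiver.Hom.op (CostructuredArrow.homMk φ.right.op
        (by
          exact congrArg Quiver.Hom.op (StructuredArrow.w φ))) }
  have : F.Faithful := ⟨fun {X Y f g} h => StructuredArrow.hom_ext _ _
    (Quiver.Hom.op_inj (congrArg (fun x => x.unop.left) h))⟩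
  refine of_subcategory F ?_
  rintro ⟨⟨⟨⟩⟩, a, f⟩ ⟨⟨⟨⟩⟩, b, g⟩ h
  have h₁ : CostructuredArrow.mk (S := u.op) (Y := op a) (T := op j) f.op =
      CostructuredArrow.mk (S := u.op) (Y := op b) (T := op j) g.op := congrArg unop h
  obtain ⟨h₂, -, h₃⟩ := Comma.mk.inj h₁
  obtain rfl : a = b := congrArg unop h₂
  obtain rfl : f = g := Quiver.Hom.op_inj (eq_of_heq h₃)
  rfl

theorem assoc₄ {a b c d e : I} (f : a ⟶ b) (g : b ⟶ c) (h : c ⟶ d) (k : d ⟶ e) :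
    f ≫ (g ≫ h) ≫ k = (f ≫ g) ≫ h ≫ k := by simp only [Category.assoc]

/-- The functor `(pq)₂` is a fibration, with fibre over `i` the opposite of `i \ I`. -/
theorem pq₂_isFibered : (Tw.pq₂ I).IsFibered := by
  refine Functor.IsFibered.of_exists_isStronglyCartesian ?_
  intro a R f
  let b : (Tw I)ᵒᵖ := op ⟨f ≫ a.unop.arr⟩
  let φ : b ⟶ a := Quiver.Hom.op ⟨f, 𝟙 _, congrArg (f ≫ ·) (Category.comp_id _)⟩
  have hφ : (Tw.pq₂ I).IsHomLift f φ := inferInstanceAs ((Tw.pq₂ I).IsHomLift ((Tw.pq₂ I).map φ) φ)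
  refine ⟨b, φ, { toIsHomLift := hφ, universal_property' := ?_ }⟩
  intro c g ψ hψ
  have e : ψ.unop.left = g ≫ f := (IsHomLift.eq_of_isHomLift (Tw.pq₂ I) (g ≫ f) ψ).symm
  let χ : c ⟶ b := Quiver.Hom.op ⟨g, ψ.unop.right, by
    have h := ψ.unop.w
    rw [e] at h
    rw [← h]
    exact assoc₄ g f a.unop.arr ψ.unop.right⟩
  refine ⟨χ, ⟨inferInstanceAs ((Tw.pq₂ I).IsHomLift ((Tw.pq₂ I).map χ) χ), ?_⟩, ?_⟩
  · apply Quiver.Hom.unop_inj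
    exact Tw.hom_ext e.symm (Category.id_comp _)
  · rintro χ' ⟨h₁, h₂⟩
    have e' : g = χ'.unop.left := @IsHomLift.eq_of_isHomLift _ _ _ _ (Tw.pq₂ I) c b g χ' h₁
    apply Quiver.Hom.unop_inj
    refine Tw.hom_ext e'.symm ?_
    have h₃ : 𝟙 _ ≫ χ'.unop.right = ψ.unop.right := congrArg (fun x => x.unop.right) h₂
    exact (Category.id_comp _).symm.trans h₃

theorem fiber_aux {i : I} {a b : Tw I} (φ : b ⟶ a) (ha : a.src = i) (hb : b.src = i)
    (h : φ.left = eqToHom (ha.trans hb.symm)) :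
    φ.right.op ≫ b.arr.op ≫ eqToHom (congrArg Opposite.op hb) =
      a.arr.op ≫ eqToHom (congrArg Opposite.op ha) := by
  obtain ⟨x⟩ := a
  obtain ⟨y⟩ := b
  dsimp only at ha hb
  subst ha
  subst hb
  have hw := φ.w
  rw [h, eqToHom_refl, Category.id_comp] at hw
  rw [eqToHom_refl, Category.comp_id, Category.comp_id]
  exact congrArg Quiver.Hom.op hw

/-- The inclusion of the fibre of `(pq)₂` over `i` into the opposite of the category of objects
under `i`. -/
def fiberFunctor (i : I) : (Tw.pq₂ I).Fiber i ⥤ Over (Opposite.op i) where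
  obj a := Over.mk (a.1.unop.arr.op ≫ eqToHom (congrArg Opposite.op a.2))
  map {a b} φ := Over.homMk φ.1.unop.right.op (by
    have h₁ := @IsHomLift.fac' _ _ _ _ (Tw.pq₂ I) _ _ _ _ (𝟙 i) φ.1 φ.2
    rw [Category.id_comp, eqToHom_trans] at h₁
    exact fiber_aux φ.1.unop a.2 b.2 h₁)

instance tw [InDia Dia I] : InDia Dia (Tw I) := by
  have := pq₂_isFibered (I := I)
  have h : InDia Dia (Tw I)ᵒᵖ := by
    refine ⟨Dia.fibration _ I (Tw.pq₂ I) (fun i => ?_) InDia.mem⟩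
    have : (fiberFunctor i).Faithful := ⟨fun {a b φ ψ} h => by
      apply Subtype.ext
      apply Quiver.Hom.unop_inj
      refine Tw.hom_ext ?_ (Quiver.Hom.op_inj (congrArg (fun x => x.left) h))
      have h₁ := @IsHomLift.fac' _ _ _ _ (Tw.pq₂ I) _ _ _ _ (𝟙 i) φ.1 φ.2
      have h₂ := @IsHomLift.fac' _ _ _ _ (Tw.pq₂ I) _ _ _ _ (𝟙 i) ψ.1 ψ.2
      exact h₁.trans h₂.symm⟩
    refine (of_subcategory (Dia := Dia) (fiberFunctor i) ?_).mem
    rintro ⟨⟨@⟨s, t, x⟩⟩, rfl⟩ ⟨⟨@⟨s', t', y⟩⟩, hb⟩ h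
    have hb' : s' = s := hb
    subst hb'
    obtain ⟨h₁, -, h₂⟩ := Comma.mk.inj h
    obtain rfl : t = t' := congrArg Opposite.unop h₁
    have h₃ : x.op ≫ 𝟙 _ = y.op ≫ 𝟙 _ := eq_of_heq h₂
    rw [Category.comp_id, Category.comp_id] at h₃
    obtain rfl : x = y := Quiver.Hom.op_inj h₃
    rfl
  exact of_subcategory (I := ((Tw I)ᵒᵖ)ᵒᵖ) (opOp (Tw I)) (fun a b h => congrArg (fun x => x.unop.unop) h)

instance three [InDia Dia I] : InDia Dia (Three I) := by
  let F : Three I ⥤ (Tw I)ᵒᵖ × Tw I × I := (Three.toTwOp I).prod' (Three.toTwProd I)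
  have : F.Faithful := ⟨fun {X Y f g} h => Three.hom_ext
    (congrArg (fun x => x.2.2) h) (congrArg (fun x => x.2.1.left) h)
    (congrArg (fun x => x.2.1.right) h)⟩
  refine of_subcategory F ?_
  rintro ⟨f, g⟩ ⟨f', g'⟩ h
  obtain ⟨h₁, h₂⟩ := Prod.ext_iff.1 h
  have h₃ : Tw.mk f = Tw.mk f' := congrArg unop h₁
  have h₄ : Tw.mk g = Tw.mk g' := congrArg Prod.fst h₂
  cases h₃
  cases h₄
  rfl

end InDia

/-! ### Prederivators -/

set_option linter.checkUnivs false in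
/-- A prederivator of type `Dia`: a pseudofunctor from `Dia`, with the direction of 1-cells and of
2-cells reversed, to the 2-category of categories.  The last five fields are the coherence axioms
of a pseudofunctor. -/
structure Prederivator (Dia : DiagramCategory.{w}) where
  /-- the category `𝔻(I)` -/
  obj : ∀ (I : Type w) [SmallCategory I] [InDia Dia I], Type u
  [cat : ∀ (I : Type w) [SmallCategory I] [InDia Dia I], Category.{v} (obj I)]
  /-- the functor `u^*` -/
  pull : ∀ {I J : Type w} [SmallCategory I] [SmallCategory J] [InDia Dia I] [InDia Dia J]
    (_ : I ⥤ J), obj J ⥤ obj I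
  /-- the natural transformation `η^* : v^* ⟶ u^*` for `η : u ⟶ v` -/
  pull₂ : ∀ {I J : Type w} [SmallCategory I] [SmallCategory J] [InDia Dia I] [InDia Dia J]
    {u v : I ⥤ J} (_ : u ⟶ v), pull v ⟶ pull u
  /-- the structure isomorphism for identities -/
  pullId : ∀ (I : Type w) [SmallCategory I] [InDia Dia I], pull (𝟭 I) ≅ 𝟭 (obj I)
  /-- the structure isomorphism for composites -/
  pullComp : ∀ {I J K : Type w} [SmallCategory I] [SmallCategory J] [SmallCategory K]
    [InDia Dia I] [InDia Dia J] [InDia Dia K] (u : I ⥤ J) (v : J ⥤ K),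
    pull (u ⋙ v) ≅ pull v ⋙ pull u
  pull₂_id : ∀ {I J : Type w} [SmallCategory I] [SmallCategory J] [InDia Dia I] [InDia Dia J]
    (u : I ⥤ J), pull₂ (𝟙 u) = 𝟙 (pull u)
  pull₂_comp : ∀ {I J : Type w} [SmallCategory I] [SmallCategory J] [InDia Dia I] [InDia Dia J]
    {u v x : I ⥤ J} (η : u ⟶ v) (θ : v ⟶ x), pull₂ (η ≫ θ) = pull₂ θ ≫ pull₂ η
  pull₂_whiskerLeft : ∀ {I J K : Type w} [SmallCategory I] [SmallCategory J] [SmallCategory K]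
    [InDia Dia I] [InDia Dia J] [InDia Dia K] (u : I ⥤ J) {v v' : J ⥤ K} (η : v ⟶ v'),
    pull₂ (Functor.whiskerLeft u η) ≫ (pullComp u v).hom =
      (pullComp u v').hom ≫ Functor.whiskerRight (pull₂ η) (pull u)
  pull₂_whiskerRight : ∀ {I J K : Type w} [SmallCategory I] [SmallCategory J] [SmallCategory K]
    [InDia Dia I] [InDia Dia J] [InDia Dia K] {u u' : I ⥤ J} (η : u ⟶ u') (v : J ⥤ K),
    pull₂ (Functor.whiskerRight η v) ≫ (pullComp u v).hom =
      (pullComp u' v).hom ≫ Functor.whiskerLeft (pull v) (pull₂ η)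
  pullComp_assoc : ∀ {I J K L : Type w} [SmallCategory I] [SmallCategory J] [SmallCategory K]
    [SmallCategory L] [InDia Dia I] [InDia Dia J] [InDia Dia K] [InDia Dia L]
    (u : I ⥤ J) (v : J ⥤ K) (x : K ⥤ L),
    pull₂ (Functor.associator u v x).hom ≫ (pullComp (u ⋙ v) x).hom ≫
        Functor.whiskerLeft (pull x) (pullComp u v).hom =
      (pullComp u (v ⋙ x)).hom ≫ Functor.whiskerRight (pullComp v x).hom (pull u) ≫
        (Functor.associator (pull x) (pull v) (pull u)).hom
  pullId_comp : ∀ {I J : Type w} [SmallCategory I] [SmallCategory J] [InDia Dia I] [InDia Dia J]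
    (u : I ⥤ J), pull₂ (Functor.leftUnitor u).hom ≫ (pullComp (𝟭 I) u).hom ≫
      Functor.whiskerLeft (pull u) (pullId I).hom = (Functor.rightUnitor (pull u)).inv
  pullComp_id : ∀ {I J : Type w} [SmallCategory I] [SmallCategory J] [InDia Dia I] [InDia Dia J]
    (u : I ⥤ J), pull₂ (Functor.rightUnitor u).hom ≫ (pullComp u (𝟭 J)).hom ≫
      Functor.whiskerRight (pullId J).hom (pull u) = (Functor.leftUnitor (pull u)).inv

attribute [instance] Prederivator.cat

namespace Prederivator

variable {Dia : DiagramCategory.{w}} (D : Prederivator.{w, v, u} Dia)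

section

variable {P K L J : Type w} [SmallCategory P] [SmallCategory K] [SmallCategory L]
  [SmallCategory J] [InDia Dia P] [InDia Dia K] [InDia Dia L] [InDia Dia J]

/-- For an isomorphism `α : u ⋙ v ≅ x`, the induced isomorphism `x^* ≅ v^* ⋙ u^*`. -/
def pullCompIso {u : P ⥤ K} {v : K ⥤ J} {x : P ⥤ J} (α : u ⋙ v ≅ x) :
    D.pull x ≅ D.pull v ⋙ D.pull u where
  hom := D.pull₂ α.hom ≫ (D.pullComp u v).hom
  inv := (D.pullComp u v).inv ≫ D.pull₂ α.inv
  hom_inv_id := by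
    rw [Category.assoc, Iso.hom_inv_id_assoc, ← D.pull₂_comp, α.inv_hom_id, D.pull₂_id]
  inv_hom_id := by
    rw [Category.assoc, ← Category.assoc (D.pull₂ α.inv), ← D.pull₂_comp, α.hom_inv_id,
      D.pull₂_id, Category.id_comp, Iso.inv_hom_id]

/-- The transformation `w^* u^* ⟶ v^* x^*` induced by a square with a 2-cell
`α : x ∘ v ⟶ u ∘ w`. -/
def pullSquare {w : P ⥤ K} {v : P ⥤ L} {u : K ⥤ J} {x : L ⥤ J} (α : v ⋙ x ⟶ w ⋙ u) :
    D.pull u ⋙ D.pull w ⟶ D.pull x ⋙ D.pull v :=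
  (D.pullComp w u).inv ≫ D.pull₂ α ≫ (D.pullComp v x).hom

end

/-! ### Derivators -/

/-- All the functors `u^*` have a left and a right adjoint. -/
class HasKanExtensions : Prop where
  isRightAdjoint : ∀ {I J : Type w} [SmallCategory I] [SmallCategory J] [InDia Dia I]
    [InDia Dia J] (u : I ⥤ J), (D.pull u).IsRightAdjoint
  isLeftAdjoint : ∀ {I J : Type w} [SmallCategory I] [SmallCategory J] [InDia Dia I]
    [InDia Dia J] (u : I ⥤ J), (D.pull u).IsLeftAdjoint

attribute [instance] HasKanExtensions.isRightAdjoint HasKanExtensions.isLeftAdjoint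

section Kan

variable [D.HasKanExtensions]
variable {P K L J : Type w} [SmallCategory P] [SmallCategory K] [SmallCategory L]
  [SmallCategory J] [InDia Dia P] [InDia Dia K] [InDia Dia L] [InDia Dia J]

/-- `u_#`, the left adjoint of `u^*`. -/
def sharp (u : K ⥤ J) : D.obj K ⥤ D.obj J := (D.pull u).leftAdjoint

/-- `u_*`, the right adjoint of `u^*`. -/
def star (u : K ⥤ J) : D.obj K ⥤ D.obj J := (D.pull u).rightAdjoint

/-- The adjunction `u_# ⊣ u^*`. -/
def sharpAdj (u : K ⥤ J) : D.sharp u ⊣ D.pull u := Adjunction.ofIsRightAdjoint (D.pull u)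

/-- The adjunction `u^* ⊣ u_*`. -/
def starAdj (u : K ⥤ J) : D.pull u ⊣ D.star u := Adjunction.ofIsLeftAdjoint (D.pull u)

/-- The Beck-Chevalley transformation `v_# w^* ⟶ x^* u_#` of a square with a 2-cell
`α : x ∘ v ⟶ u ∘ w`, the mate of `w^* u^* ⟶ v^* x^*`. -/
def bcSharp {w : P ⥤ K} {v : P ⥤ L} {u : K ⥤ J} {x : L ⥤ J} (α : v ⋙ x ⟶ w ⋙ u) :
    D.pull w ⋙ D.sharp v ⟶ D.sharp u ⋙ D.pull x :=
  ((mateEquiv (D.sharpAdj u) (D.sharpAdj v)).symm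
    (TwoSquare.mk (D.pull u) (D.pull x) (D.pull w) (D.pull v) (D.pullSquare α))).natTrans

/-- The Beck-Chevalley transformation `u^* x_* ⟶ w_* v^*` of a square with a 2-cell
`α : x ∘ v ⟶ u ∘ w`, the mate of `w^* u^* ⟶ v^* x^*`. -/
def bcStar {w : P ⥤ K} {v : P ⥤ L} {u : K ⥤ J} {x : L ⥤ J} (α : v ⋙ x ⟶ w ⋙ u) :
    D.star x ⋙ D.pull u ⟶ D.pull v ⋙ D.star w :=
  ((mateEquiv (D.starAdj x) (D.starAdj w))
    (TwoSquare.mk (D.pull u) (D.pull x) (D.pull w) (D.pull v) (D.pullSquare α))).natTrans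

/-- For an isomorphism `α : u ⋙ v ≅ x`, the induced isomorphism `x_* ≅ u_* ⋙ v_*`. -/
def starCompIso {u : P ⥤ K} {v : K ⥤ J} {x : P ⥤ J} (α : u ⋙ v ≅ x) :
    D.star x ≅ D.star u ⋙ D.star v :=
  conjugateIsoEquiv (D.starAdj x) ((D.starAdj v).comp (D.starAdj u)) (D.pullCompIso α).symm

end Kan

/-- The comma 2-cell `j ∘ p ⟶ u ∘ t` on `j \ I`. -/
def underCell {I J : Type w} [SmallCategory I] [SmallCategory J] (u : I ⥤ J) (j : J) :
    Functor.star.{w, w, w} (StructuredArrow j u) ⋙ Functor.fromPUnit j ⟶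
      StructuredArrow.proj j u ⋙ u where
  app X := X.hom
  naturality _ _ f := 
     (Category.id_comp _).trans (StructuredArrow.w f).symm

/-- The comma 2-cell `u ∘ s ⟶ j ∘ p` on `I / j`. -/
def overCell {I J : Type w} [SmallCategory I] [SmallCategory J] (u : I ⥤ J) (j : J) :
    CostructuredArrow.proj u j ⋙ u ⟶
      Functor.star.{w, w, w} (CostructuredArrow u j) ⋙ Functor.fromPUnit j where
  app X := X.hom
  naturality _ _ f := 
     (CostructuredArrow.w f).trans (Category.comp_id _).symm

/-- A derivator of type `Dia`: a prederivator which takes coproducts to products,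
for which passage to fibres is jointly conservative, for which all the functors `u^*` have both
adjoints, and for which these adjoints are computed pointwise. -/
class IsDerivator : Prop extends HasKanExtensions D where
  /-- the empty coproduct: `𝔻(∅)` is equivalent to the terminal category -/
  initial : (Functor.star.{w} (D.obj (Discrete PEmpty.{w + 1}))).IsEquivalence
  /-- binary coproducts: `𝔻(I ⊕ J)` is equivalent to `𝔻(I) × 𝔻(J)` by restriction -/
  coprod : ∀ (I J : Type w) [SmallCategory I] [SmallCategory J] [InDia Dia I] [InDia Dia J],
    ((D.pull (Sum.inl_ I J)).prod' (D.pull (Sum.inr_ I J))).IsEquivalence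
  /-- the functors `i^*`, for `i` an object of `I`, are jointly conservative -/
  conservative : ∀ {I : Type w} [SmallCategory I] [InDia Dia I] {A B : D.obj I} (f : A ⟶ B),
    (∀ i : I, IsIso ((D.pull (Functor.fromPUnit.{w} i)).map f)) → IsIso f
  /-- pointwise formula for `u_#`: `p_# t^* ⟶ j^* u_#` is invertible, for the comma category
  `j \ I` -/
  isIso_bcSharp : ∀ {I J : Type w} [SmallCategory I] [SmallCategory J] [InDia Dia I]
    [InDia Dia J] (u : I ⥤ J) (j : J), IsIso (D.bcSharp (underCell u j))
  /-- pointwise formula for `u_*`: `j^* u_* ⟶ p_* s^*` is invertible, for the comma category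
  `I / j` -/
  isIso_bcStar : ∀ {I J : Type w} [SmallCategory I] [SmallCategory J] [InDia Dia I]
    [InDia Dia J] (u : I ⥤ J) (j : J), IsIso (D.bcStar (overCell u j))

/-! ### Closed monoidal derivators -/

/-- The structure of a closed monoidal prederivator: a factorization of the pseudofunctor `D`
through the 2-category of closed symmetric monoidal categories, strong symmetric monoidal functors
and monoidal transformations. -/
class ClosedMonoidal where
  [monoidal : ∀ (I : Type w) [SmallCategory I] [InDia Dia I], MonoidalCategory (D.obj I)]
  [symmetric : ∀ (I : Type w) [SmallCategory I] [InDia Dia I], SymmetricCategory (D.obj I)]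
  [closed : ∀ (I : Type w) [SmallCategory I] [InDia Dia I], MonoidalClosed (D.obj I)]
  [pull : ∀ {I J : Type w} [SmallCategory I] [SmallCategory J] [InDia Dia I] [InDia Dia J]
    (u : I ⥤ J), (D.pull u).Braided]
  [pull₂ : ∀ {I J : Type w} [SmallCategory I] [SmallCategory J] [InDia Dia I] [InDia Dia J]
    {u v : I ⥤ J} (η : u ⟶ v), NatTrans.IsMonoidal (D.pull₂ η)]
  [pullId : ∀ (I : Type w) [SmallCategory I] [InDia Dia I],
    NatTrans.IsMonoidal (D.pullId I).hom]
  [pullComp : ∀ {I J K : Type w} [SmallCategory I] [SmallCategory J] [SmallCategory K]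
    [InDia Dia I] [InDia Dia J] [InDia Dia K] (u : I ⥤ J) (v : J ⥤ K),
    NatTrans.IsMonoidal (D.pullComp u v).hom]

attribute [reducible] ClosedMonoidal.monoidal ClosedMonoidal.symmetric ClosedMonoidal.closed
  ClosedMonoidal.pull
attribute [instance] ClosedMonoidal.monoidal ClosedMonoidal.symmetric ClosedMonoidal.closed
  ClosedMonoidal.pull ClosedMonoidal.pull₂ ClosedMonoidal.pullId ClosedMonoidal.pullComp

section Monoidal

variable [D.HasKanExtensions] [D.ClosedMonoidal]
variable {I J : Type w} [SmallCategory I] [SmallCategory J] [InDia Dia I] [InDia Dia J]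

/-- The projection morphism `u_#(u^*A ⊗ B) ⟶ A ⊗ u_# B`, adjoint to
`u^*A ⊗ B ⟶ u^*A ⊗ u^*u_# B ≅ u^*(A ⊗ u_# B)`. -/
def projection (u : I ⥤ J) (A : D.obj J) (B : D.obj I) :
    (D.sharp u).obj ((D.pull u).obj A ⊗ B) ⟶ A ⊗ (D.sharp u).obj B :=
  ((D.sharpAdj u).homEquiv _ _).symm
    (((D.pull u).obj A ◁ (D.sharpAdj u).unit.app B) ≫
      Functor.LaxMonoidal.μ (D.pull u) A ((D.sharp u).obj B))

end Monoidal

/-- A closed monoidal derivator of type `Dia`: a closed monoidal prederivator which is a derivator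
and for which the projection morphisms of the functors `p_I` from `I` to the terminal category are
invertible. -/
class IsClosedMonoidalDerivator [D.ClosedMonoidal] : Prop extends IsDerivator D where
  isIso_projection : ∀ {I : Type w} [SmallCategory I] [InDia Dia I]
    (A : D.obj (Discrete PUnit.{w + 1})) (B : D.obj I),
    IsIso (D.projection (Functor.star.{w} I) A B)

/-! ### Internal hom, external hom and the canonical morphisms -/

section Hom

variable [D.HasKanExtensions] [D.ClosedMonoidal]
variable {I J I' J' : Type w} [SmallCategory I] [SmallCategory J] [SmallCategory I']
  [SmallCategory J'] [InDia Dia I] [InDia Dia J] [InDia Dia I'] [InDia Dia J']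

/-- The canonical morphism `u^*[A, B] ⟶ [u^*A, u^*B]`, adjoint to
`u^*A ⊗ u^*[A, B] ≅ u^*(A ⊗ [A, B]) ⟶ u^*B`. -/
def pullIhom (u : I ⥤ J) (A B : D.obj J) :
    (D.pull u).obj ((ihom A).obj B) ⟶ (ihom ((D.pull u).obj A)).obj ((D.pull u).obj B) :=
  MonoidalClosed.curry
    (Functor.LaxMonoidal.μ (D.pull u) A ((ihom A).obj B) ≫ (D.pull u).map ((ihom.ev A).app B))

/-- The canonical morphism `[u_# A, B] ⟶ u_*[A, u^*B]`, adjoint to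
`u^*[u_# A, B] ⟶ [u^*u_# A, u^*B] ⟶ [A, u^*B]`. -/
def sharpIhom (u : I ⥤ J) (A : D.obj I) (B : D.obj J) :
    (ihom ((D.sharp u).obj A)).obj B ⟶ (D.star u).obj ((ihom A).obj ((D.pull u).obj B)) :=
  (D.starAdj u).homEquiv _ _
    (D.pullIhom u ((D.sharp u).obj A) B ≫
      (MonoidalClosed.pre ((D.sharpAdj u).unit.app A)).app ((D.pull u).obj B))

/-- The functoriality of the internal hom, `[f, g] : [A, B] ⟶ [A', B']` for `f : A' ⟶ A` and
`g : B ⟶ B'`. -/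
def ihomMap {A A' B B' : D.obj I} (f : A' ⟶ A) (g : B ⟶ B') :
    (ihom A).obj B ⟶ (ihom A').obj B' :=
  (MonoidalClosed.pre f).app B ≫ (ihom A').map g

variable (I J) in
/-- The external hom, a bifunctor `𝔻(I)ᵒᵖ × 𝔻(J) ⥤ 𝔻(Iᵒᵖ × J)` (in curried form), given on objects
by `⟦A, B⟧ = p_*[q^*A, r^*B]`. -/
def ehom : (D.obj I)ᵒᵖ ⥤ D.obj J ⥤ D.obj (Iᵒᵖ × J) :=
  (D.pull (Ext.q I J)).op ⋙ MonoidalClosed.internalHom ⋙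
    (Functor.whiskeringLeft _ _ _).obj (D.pull (Ext.r I J)) ⋙
    (Functor.whiskeringRight _ _ _).obj (D.star (Ext.p I J))

/-- The external hom `⟦A, B⟧`. -/
abbrev ehm (A : D.obj I) (B : D.obj J) : D.obj (Iᵒᵖ × J) := ((D.ehom I J).obj (op A)).obj B

/-- `⟦A, B⟧ = p_*[q^*A, r^*B]`. -/
theorem ehm_eq (A : D.obj I) (B : D.obj J) :
    D.ehm A B = (D.star (Ext.p I J)).obj
      ((ihom ((D.pull (Ext.q I J)).obj A)).obj ((D.pull (Ext.r I J)).obj B)) := rfl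

/-- The morphism `Ψ : (uᵒᵖ × v)^*⟦A, B⟧ ⟶ ⟦u^*A, v^*B⟧`, the composite of
`(uᵒᵖ × v)^* p_*[q^*A, r^*B] ⟶ p'_* (tw u × v)^*[q^*A, r^*B]`,
`(tw u × v)^*[q^*A, r^*B] ⟶ [(tw u × v)^* q^*A, (tw u × v)^* r^*B]` and the identification
of the latter with `[q'^* u^*A, r'^* v^*B]`. -/
def Ψ (u : I' ⥤ I) (v : J' ⥤ J) (A : D.obj I) (B : D.obj J) :
    (D.pull (u.op.prod v)).obj (D.ehm A B) ⟶
      D.ehm ((D.pull u).obj A) ((D.pull v).obj B) :=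
  (D.bcStar (w := Ext.p I' J') (v := (Tw.map u).prod v) (u := u.op.prod v) (x := Ext.p I J)
      (𝟙 (((Tw.map u).prod v) ⋙ Ext.p I J))).app _ ≫
    (D.star (Ext.p I' J')).map
      (D.pullIhom ((Tw.map u).prod v) ((D.pull (Ext.q I J)).obj A)
          ((D.pull (Ext.r I J)).obj B) ≫
        D.ihomMap
          ((D.pullSquare (w := Ext.q I' J') (v := (Tw.map u).prod v) (u := u) (x := Ext.q I J)
            (𝟙 (((Tw.map u).prod v) ⋙ Ext.q I J))).app A)
          ((D.pullSquare (w := (Tw.map u).prod v) (v := Ext.r I' J') (u := Ext.r I J) (x := v)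
            (𝟙 (Ext.r I' J' ⋙ v))).app B))

/-! ### The morphism `Θ` -/

/-- The first part of `Θ`: the composite
`[A, B] ⟶ [t₂_# t₂^*A, B] ⟶ [t₂_# t₀^*A, B] ⟶ t₂_*[t₀^*A, t₂^*B]`. -/
def ΘForward (A B : D.obj I) :
    (ihom A).obj B ⟶
      (D.star (Three.t₂ I)).obj
        ((ihom ((D.pull (Three.t₀ I)).obj A)).obj ((D.pull (Three.t₂ I)).obj B)) :=
  (MonoidalClosed.pre ((D.sharpAdj (Three.t₂ I)).counit.app A)).app B ≫
    (MonoidalClosed.pre ((D.sharp (Three.t₂ I)).map ((D.pull₂ (Three.τ I)).app A))).app B ≫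
    D.sharpIhom (Three.t₂ I) ((D.pull (Three.t₀ I)).obj A) B

/-- The arrow `(pq)₂_* q₂^* p_*[q^*A, r^*B] ⟶ (pq)₂_* p'_* q'^*[q^*A, r^*B]`, the Beck-Chevalley
transformation of the pullback square with sides `p' : 3I ⥤ (tw I)ᵒᵖ`, `q' : 3I ⥤ tw I × I`, `q₂`
and `p`. -/
def ΘBaseChange (A B : D.obj I) :
    (D.star (Tw.pq₂ I)).obj ((D.pull (Tw.q₂ I)).obj (D.ehm A B)) ⟶
      (D.star (Tw.pq₂ I)).obj ((D.star (Three.toTwOp I)).obj ((D.pull (Three.toTwProd I)).obj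
        ((ihom ((D.pull (Ext.q I I)).obj A)).obj ((D.pull (Ext.r I I)).obj B)))) :=
  (D.star (Tw.pq₂ I)).map
    ((D.bcStar (w := Three.toTwOp I) (v := Three.toTwProd I) (u := Tw.q₂ I) (x := Ext.p I I)
      (𝟙 (Three.toTwProd I ⋙ Ext.p I I))).app _)

/-- The arrow `(pq)₂_* p'_* q'^*[q^*A, r^*B] ⟶ (pq)₂_* p'_*[q'^* q^*A, q'^* r^*B]`. -/
def ΘComparison (A B : D.obj I) :
    (D.star (Tw.pq₂ I)).obj ((D.star (Three.toTwOp I)).obj ((D.pull (Three.toTwProd I)).obj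
        ((ihom ((D.pull (Ext.q I I)).obj A)).obj ((D.pull (Ext.r I I)).obj B)))) ⟶
      (D.star (Tw.pq₂ I)).obj ((D.star (Three.toTwOp I)).obj
        ((ihom ((D.pull (Three.toTwProd I)).obj ((D.pull (Ext.q I I)).obj A))).obj
          ((D.pull (Three.toTwProd I)).obj ((D.pull (Ext.r I I)).obj B)))) :=
  (D.star (Tw.pq₂ I)).map ((D.star (Three.toTwOp I)).map (D.pullIhom (Three.toTwProd I) _ _))

/-- The identification `(pq)₂_* p'_*[q'^* q^*A, q'^* r^*B] ⟶ t₂_*[t₀^*A, t₂^*B]` coming from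
`(pq)₂ p' = t₂`, `q q' = t₀` and `r q' = t₂`. -/
def ΘIdentification (A B : D.obj I) :
    (D.star (Tw.pq₂ I)).obj ((D.star (Three.toTwOp I)).obj
        ((ihom ((D.pull (Three.toTwProd I)).obj ((D.pull (Ext.q I I)).obj A))).obj
          ((D.pull (Three.toTwProd I)).obj ((D.pull (Ext.r I I)).obj B)))) ⟶
      (D.star (Three.t₂ I)).obj
        ((ihom ((D.pull (Three.t₀ I)).obj A)).obj ((D.pull (Three.t₂ I)).obj B)) :=
  (D.starCompIso (u := Three.toTwOp I) (v := Tw.pq₂ I) (x := Three.t₂ I) (Iso.refl _)).inv.app _ ≫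
    (D.star (Three.t₂ I)).map
      (D.ihomMap
        ((D.pullCompIso (u := Three.toTwProd I) (v := Ext.q I I) (x := Three.t₀ I)
          (Iso.refl _)).hom.app A)
        ((D.pullCompIso (u := Three.toTwProd I) (v := Ext.r I I) (x := Three.t₂ I)
          (Iso.refl _)).inv.app B))

/-- The second part of `Θ`, to be inverted: the composite
`(pq)₂_* q₂^*⟦A, B⟧ ⟶ t₂_*[t₀^*A, t₂^*B]`. -/
def ΘBackward (A B : D.obj I) :
    (D.star (Tw.pq₂ I)).obj ((D.pull (Tw.q₂ I)).obj (D.ehm A B)) ⟶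
      (D.star (Three.t₂ I)).obj
        ((ihom ((D.pull (Three.t₀ I)).obj A)).obj ((D.pull (Three.t₂ I)).obj B)) :=
  D.ΘBaseChange A B ≫ D.ΘComparison A B ≫ D.ΘIdentification A B

/-- The morphism `Θ : [A, B] ⟶ (pq)₂_* q₂^*⟦A, B⟧`; it makes sense once the second part of the
zigzag defining it is known to be invertible. -/
def Θ (A B : D.obj I) [IsIso (D.ΘBackward A B)] :
    (ihom A).obj B ⟶ (D.star (Tw.pq₂ I)).obj ((D.pull (Tw.q₂ I)).obj (D.ehm A B)) :=
  D.ΘForward A B ≫ inv (D.ΘBackward A B)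

/-- The canonical morphism `u^* (pq)₂_* q₂^*⟦A, B⟧ ⟶ (pq)₂_* q₂^*⟦u^*A, u^*B⟧` for `u : I' ⥤ I`,
the composite of `u^* (pq)₂_* q₂^*⟦A, B⟧ ⟶ (pq)₂_* (tw u)ᵒᵖ^* q₂^*⟦A, B⟧`, the identification
of the latter with `(pq)₂_* q₂^* (uᵒᵖ × u)^*⟦A, B⟧`, and `Ψ`. -/
def pullTarget (u : I' ⥤ I) (A B : D.obj I) :
    (D.pull u).obj ((D.star (Tw.pq₂ I)).obj ((D.pull (Tw.q₂ I)).obj (D.ehm A B))) ⟶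
      (D.star (Tw.pq₂ I')).obj ((D.pull (Tw.q₂ I')).obj
        (D.ehm ((D.pull u).obj A) ((D.pull u).obj B))) :=
  (D.bcStar (w := Tw.pq₂ I') (v := (Tw.map u).op) (u := u) (x := Tw.pq₂ I)
      (𝟙 ((Tw.map u).op ⋙ Tw.pq₂ I))).app _ ≫
    (D.star (Tw.pq₂ I')).map
      ((D.pullSquare (w := (Tw.map u).op) (v := Tw.q₂ I') (u := Tw.q₂ I) (x := u.op.prod u)
          (𝟙 (Tw.q₂ I' ⋙ u.op.prod u))).app _ ≫
        (D.pull (Tw.q₂ I')).map (D.Ψ u u A B))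

end Hom

/-! ### Lax natural transformations and modifications -/

/-- The value of a bifunctor, contravariant in the first variable, on a pair of morphisms. -/
def biMap {C : Type u} [Category.{v} C] (F : Cᵒᵖ ⥤ C ⥤ C) {A A' B B' : C} (f : A' ⟶ A)
    (g : B ⟶ B') : (F.obj (op A)).obj B ⟶ (F.obj (op A')).obj B' :=
  (F.map f.op).app B ≫ (F.obj (op A')).map g

/-- A family of bifunctors `F I : 𝔻(I)ᵒᵖ × 𝔻(I) ⥤ 𝔻(I)` and of morphisms
`φ u A B : u^*(F(A, B)) ⟶ F(u^*A, u^*B)` is a lax natural transformation from `𝔻(·)ᵒᵖ × 𝔻(·)` to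
`𝔻(·)`, these being regarded as pseudofunctors on (the opposite of) the 1-category underlying
`Dia`: the `φ u` are natural in `A` and `B`, and compatible with identities and composition. -/
structure IsLaxNatural
    (F : ∀ (I : Type w) [SmallCategory I] [InDia Dia I], (D.obj I)ᵒᵖ ⥤ D.obj I ⥤ D.obj I)
    (φ : ∀ {I' I : Type w} [SmallCategory I'] [SmallCategory I] [InDia Dia I'] [InDia Dia I]
      (u : I' ⥤ I) (A B : D.obj I), (D.pull u).obj (((F I).obj (op A)).obj B) ⟶
        ((F I').obj (op ((D.pull u).obj A))).obj ((D.pull u).obj B)) : Prop where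
  naturality : ∀ {I' I : Type w} [SmallCategory I'] [SmallCategory I] [InDia Dia I']
    [InDia Dia I] (u : I' ⥤ I) {A A' B B' : D.obj I} (f : A' ⟶ A) (g : B ⟶ B'),
    (D.pull u).map (biMap (F I) f g) ≫ φ u A' B' =
      φ u A B ≫ biMap (F I') ((D.pull u).map f) ((D.pull u).map g)
  map_id : ∀ {I : Type w} [SmallCategory I] [InDia Dia I] (A B : D.obj I),
    φ (𝟭 I) A B ≫ biMap (F I) ((D.pullId I).inv.app A) ((D.pullId I).hom.app B) =
      (D.pullId I).hom.app (((F I).obj (op A)).obj B)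
  map_comp : ∀ {I'' I' I : Type w} [SmallCategory I''] [SmallCategory I'] [SmallCategory I]
    [InDia Dia I''] [InDia Dia I'] [InDia Dia I] (v : I'' ⥤ I') (u : I' ⥤ I) (A B : D.obj I),
    φ (v ⋙ u) A B ≫
        biMap (F I'') ((D.pullComp v u).inv.app A) ((D.pullComp v u).hom.app B) =
      (D.pullComp v u).hom.app (((F I).obj (op A)).obj B) ≫
        (D.pull v).map (φ u A B) ≫ φ v ((D.pull u).obj A) ((D.pull u).obj B)

/-- A family of morphisms `θ I A B : F(A, B) ⟶ G(A, B)` is a modification between the lax natural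
transformations `(F, φ)` and `(G, ψ)`: it is natural in `A` and `B`, and compatible with the 2-cells
of the two transformations. -/
structure IsModification
    {F G : ∀ (I : Type w) [SmallCategory I] [InDia Dia I], (D.obj I)ᵒᵖ ⥤ D.obj I ⥤ D.obj I}
    (φ : ∀ {I' I : Type w} [SmallCategory I'] [SmallCategory I] [InDia Dia I'] [InDia Dia I]
      (u : I' ⥤ I) (A B : D.obj I), (D.pull u).obj (((F I).obj (op A)).obj B) ⟶
        ((F I').obj (op ((D.pull u).obj A))).obj ((D.pull u).obj B))
    (ψ : ∀ {I' I : Type w} [SmallCategory I'] [SmallCategory I] [InDia Dia I'] [InDia Dia I]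
      (u : I' ⥤ I) (A B : D.obj I), (D.pull u).obj (((G I).obj (op A)).obj B) ⟶
        ((G I').obj (op ((D.pull u).obj A))).obj ((D.pull u).obj B))
    (θ : ∀ {I : Type w} [SmallCategory I] [InDia Dia I] (A B : D.obj I),
      ((F I).obj (op A)).obj B ⟶ ((G I).obj (op A)).obj B) : Prop where
  naturality : ∀ {I : Type w} [SmallCategory I] [InDia Dia I] {A A' B B' : D.obj I}
    (f : A' ⟶ A) (g : B ⟶ B'), biMap (F I) f g ≫ θ A' B' = θ A B ≫ biMap (G I) f g
  compatibility : ∀ {I' I : Type w} [SmallCategory I'] [SmallCategory I] [InDia Dia I']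
    [InDia Dia I] (u : I' ⥤ I) (A B : D.obj I),
    (D.pull u).map (θ A B) ≫ ψ u A B = φ u A B ≫ θ ((D.pull u).obj A) ((D.pull u).obj B)

/-- The bifunctor `[·, ·]` on `𝔻(I)`. -/
abbrev source [D.ClosedMonoidal] (I : Type w) [SmallCategory I] [InDia Dia I] :
    (D.obj I)ᵒᵖ ⥤ D.obj I ⥤ D.obj I :=
  MonoidalClosed.internalHom

/-- The bifunctor `(pq)₂_* q₂^*⟦·, ·⟧` on `𝔻(I)`. -/
abbrev target [D.HasKanExtensions] [D.ClosedMonoidal] (I : Type w) [SmallCategory I]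
    [InDia Dia I] : (D.obj I)ᵒᵖ ⥤ D.obj I ⥤ D.obj I :=
  D.ehom I I ⋙ (Functor.whiskeringRight _ _ _).obj (D.pull (Tw.q₂ I) ⋙ D.star (Tw.pq₂ I))

end Prederivator

end

/-! Both ends of the zigzag are compared with the middle term `t₂_*[t₀^*A, t₂^*B]` on `3I`, and
every arrow leading there is shown to be invertible by computing Kan extensions on fibres.

On the side of `[A, B]`, the transformation `t₂ ⟶ t₀` gives a map `t₂_# t₀^*A ⟶ A`
(`threeFromSharp`). The fibre of `t₂` over `x` is `tw (x \ I)`, included in `x \ 3I` by a left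
adjoint. The target functor `tw (x \ I) ⥤ x \ I` is again a left adjoint, because `x \ I` has an
initial object, and `p_#` of the restriction of `A` to `x \ I` is `x^*A`. Since 1-cells and 2-cells
are both reversed, `h ⊣ g` gives `h^* ⊣ g^*`, so restriction along a left adjoint does not change
`p_#` (`IsUniversal.pull`). Hence `t₂_# t₀^*A ⟶ A` is invertible at each `x`. The passage from
`[t₂_# t₀^*A, B]` to `t₂_*[t₀^*A, t₂^*B]` is the projection formula for `t₂` in adjoint form.

On the side of the external hom, base change holds for the square defining `3I`, because the
comparison functors between slices are right adjoints (`isIso_bcStar_app`). The functor `3I ⥤ tw I ×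
I` preserves internal homs because it satisfies the projection formula; its fibres are the sets of
arrows `y₂ ⟶ y₁`. Both projection formulas follow from the one for `F ⥤ ⋆`, applied to the fibres
`F` (`isIso_projection_of_fibreMap`).

The compatibilities are formal. A map `w^*B ⟶ A` is regarded as an arrow over `w`, and such arrows
are composed by `overComp`. Transposition turns Beck-Chevalley maps into counits
(`overComp_bcStar`), and canonical maps of internal homs compose to canonical maps
(`overComp_homOver`). Every diagram then reduces to coherence of the pseudofunctor and to the fact
that `u` preserves composites.

Lax naturality is proved directly only for `[·, ·]`. For `(pq)₂_* q₂^*⟦·, ·⟧` it is transported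
along the invertible family `Θ`, which is compatible with both sets of restriction maps. -/

noncomputable section

namespace Prederivator

variable {Dia : DiagramCategory.{w}} (D : Prederivator.{w, v, u} Dia)

/-! ### Maps over functors -/

section

variable {K₀ K₁ K₂ K₃ : Type w} [SmallCategory K₀] [SmallCategory K₁] [SmallCategory K₂]
  [SmallCategory K₃] [InDia Dia K₀] [InDia Dia K₁] [InDia Dia K₂] [InDia Dia K₃]

/-- The isomorphism `x^* ≅ w^* ⋙ z^*` for an equality `x = z ⋙ w`. -/
def compNatIso {z : K₂ ⥤ K₁} {w : K₁ ⥤ K₀} {x : K₂ ⥤ K₀} (h : x = z ⋙ w) :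
    D.pull x ≅ D.pull w ⋙ D.pull z :=
  D.pullCompIso (eqToIso h.symm)

/-- The isomorphism `x^* A ≅ z^* (w^* A)` for an equality `x = z ⋙ w`. -/
def compIso {z : K₂ ⥤ K₁} {w : K₁ ⥤ K₀} {x : K₂ ⥤ K₀} (h : x = z ⋙ w) (A : D.obj K₀) :
    (D.pull x).obj A ≅ (D.pull z).obj ((D.pull w).obj A) :=
  (D.compNatIso h).app A

theorem compNatIso_hom_rfl (z : K₂ ⥤ K₁) (w : K₁ ⥤ K₀) :
    (D.compNatIso (rfl : z ⋙ w = z ⋙ w)).hom = (D.pullComp z w).hom := by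
  change D.pull₂ (𝟙 _) ≫ _ = _
  rw [D.pull₂_id, Category.id_comp]

theorem compIso_hom_rfl (z : K₂ ⥤ K₁) (w : K₁ ⥤ K₀) (A : D.obj K₀) :
    (D.compIso (rfl : z ⋙ w = z ⋙ w) A).hom = (D.pullComp z w).hom.app A :=
  NatTrans.congr_app (D.compNatIso_hom_rfl z w) A

theorem compIso_inv_rfl (z : K₂ ⥤ K₁) (w : K₁ ⥤ K₀) (A : D.obj K₀) :
    (D.compIso (rfl : z ⋙ w = z ⋙ w) A).inv = (D.pullComp z w).inv.app A := by
  change (D.pullComp z w).inv.app A ≫ (D.pull₂ (𝟙 _)).app A = _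
  rw [D.pull₂_id]
  exact Category.comp_id _

theorem compIso_assoc {w₁ : K₁ ⥤ K₀} {w₂ : K₂ ⥤ K₁} {w₃ : K₃ ⥤ K₂} {w₁₂ : K₂ ⥤ K₀}
    {w₂₃ : K₃ ⥤ K₁} {x : K₃ ⥤ K₀} (h₁ : x = w₂₃ ⋙ w₁) (h₂ : w₂₃ = w₃ ⋙ w₂)
    (h₃ : x = w₃ ⋙ w₁₂) (h₄ : w₁₂ = w₂ ⋙ w₁) (A : D.obj K₀) :
    (D.compIso h₁ A).hom ≫ (D.compIso h₂ ((D.pull w₁).obj A)).hom =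
      (D.compIso h₃ A).hom ≫ (D.pull w₃).map (D.compIso h₄ A).hom := by
  subst h₂ h₄ h₃
  have h := NatTrans.congr_app (D.pullComp_assoc w₃ w₂ w₁) A
  have e : D.pull₂ (Functor.associator w₃ w₂ w₁).hom = 𝟙 _ := D.pull₂_id _
  have e' : (D.compIso h₁ A).hom = (D.pullComp (w₃ ⋙ w₂) w₁).hom.app A :=
    D.compIso_hom_rfl (w₃ ⋙ w₂) w₁ A
  rw [e', compIso_hom_rfl, compIso_hom_rfl, compIso_hom_rfl]
  rw [e] at h
  erw [Category.id_comp] at h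
  simpa using h

theorem compIso_hom_comp_map_inv {w₁ : K₁ ⥤ K₀} {w₂ : K₂ ⥤ K₁} {w₃ : K₃ ⥤ K₂} {w₁₂ : K₂ ⥤ K₀}
    {w₂₃ : K₃ ⥤ K₁} {x : K₃ ⥤ K₀} (h₁ : x = w₂₃ ⋙ w₁) (h₂ : w₂₃ = w₃ ⋙ w₂)
    (h₃ : x = w₃ ⋙ w₁₂) (h₄ : w₁₂ = w₂ ⋙ w₁) (A : D.obj K₀) :
    (D.compIso h₂ ((D.pull w₁).obj A)).hom ≫ (D.pull w₃).map (D.compIso h₄ A).inv =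
      (D.compIso h₁ A).inv ≫ (D.compIso h₃ A).hom := by
  rw [← cancel_epi (D.compIso h₁ A).hom, ← Category.assoc, D.compIso_assoc h₁ h₂ h₃ h₄,
    Category.assoc, ← Functor.map_comp, Iso.hom_inv_id, CategoryTheory.Functor.map_id,
    Category.comp_id, Iso.hom_inv_id_assoc]

theorem compIso_hom_comp_map_hom {w₁ : K₁ ⥤ K₀} {w₂ : K₂ ⥤ K₁} {w₃ : K₃ ⥤ K₂} {w₁₂ : K₂ ⥤ K₀}
    {w₂₃ : K₃ ⥤ K₁} {x : K₃ ⥤ K₀} (h₁ : x = w₂₃ ⋙ w₁) (h₂ : w₂₃ = w₃ ⋙ w₂)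
    (h₃ : x = w₃ ⋙ w₁₂) (h₄ : w₁₂ = w₂ ⋙ w₁) (A : D.obj K₀) :
    (D.compIso h₃ A).hom ≫ (D.pull w₃).map (D.compIso h₄ A).hom ≫
      (D.compIso h₂ ((D.pull w₁).obj A)).inv = (D.compIso h₁ A).hom := by
  rw [← Category.assoc, ← D.compIso_assoc h₁ h₂ h₃ h₄, Category.assoc, Iso.hom_inv_id,
    Category.comp_id]

theorem compIso_hom_naturality {z : K₂ ⥤ K₁} {w : K₁ ⥤ K₀} {x : K₂ ⥤ K₀} (h : x = z ⋙ w)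
    {A B : D.obj K₀} (f : A ⟶ B) :
    (D.pull x).map f ≫ (D.compIso h B).hom =
      (D.compIso h A).hom ≫ (D.pull z).map ((D.pull w).map f) :=
  (D.compNatIso h).hom.naturality f

theorem compIso_hom_naturality_assoc {z : K₂ ⥤ K₁} {w : K₁ ⥤ K₀} {x : K₂ ⥤ K₀} (h : x = z ⋙ w)
    {A B : D.obj K₀} (f : A ⟶ B) {C : D.obj K₂} (g : (D.pull z).obj ((D.pull w).obj B) ⟶ C) :
    (D.pull x).map f ≫ (D.compIso h B).hom ≫ g =
      (D.compIso h A).hom ≫ (D.pull z).map ((D.pull w).map f) ≫ g := by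
  rw [← Category.assoc, compIso_hom_naturality, Category.assoc]

theorem compIso_inv_naturality {z : K₂ ⥤ K₁} {w : K₁ ⥤ K₀} {x : K₂ ⥤ K₀} (h : x = z ⋙ w)
    {A B : D.obj K₀} (f : A ⟶ B) :
    (D.pull z).map ((D.pull w).map f) ≫ (D.compIso h B).inv =
      (D.compIso h A).inv ≫ (D.pull x).map f :=
  (D.compNatIso h).inv.naturality f

theorem compIso_inv_naturality_assoc {z : K₂ ⥤ K₁} {w : K₁ ⥤ K₀} {x : K₂ ⥤ K₀} (h : x = z ⋙ w)
    {A B : D.obj K₀} (f : A ⟶ B) {C : D.obj K₂} (g : (D.pull x).obj B ⟶ C) :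
    (D.pull z).map ((D.pull w).map f) ≫ (D.compIso h B).inv ≫ g =
      (D.compIso h A).inv ≫ (D.pull x).map f ≫ g := by
  rw [← Category.assoc, compIso_inv_naturality, Category.assoc]

/-- Any name `y` for the common diagonal splits the 2-cell of a commutative square into two
structure isomorphisms; in coherence arguments these cancel against their neighbours. -/
theorem pullSquare_eqToHom {w : K₃ ⥤ K₁} {v : K₃ ⥤ K₂} {u : K₁ ⥤ K₀} {x : K₂ ⥤ K₀}
    {y : K₃ ⥤ K₀} (h : v ⋙ x = w ⋙ u) (h₁ : y = w ⋙ u) (h₂ : y = v ⋙ x) (A : D.obj K₀) :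
    (D.pullSquare (eqToHom h)).app A = (D.compIso h₁ A).inv ≫ (D.compIso h₂ A).hom := by
  subst h₂
  have e : (D.compIso h₁ A).inv = (D.pullComp w u).inv.app A ≫ (D.pull₂ (eqToHom h)).app A := rfl
  rw [e, compIso_hom_rfl, Category.assoc]
  rfl

/-- The composite of the maps `f : w^*B ⟶ A` over `w` and `g : z^*A ⟶ A'` over `z`, a map over
`y = z ⋙ w`. -/
def overComp {w : K₁ ⥤ K₀} {z : K₂ ⥤ K₁} {y : K₂ ⥤ K₀} (h : y = z ⋙ w) {B : D.obj K₀}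
    {A : D.obj K₁} {A' : D.obj K₂} (f : (D.pull w).obj B ⟶ A) (g : (D.pull z).obj A ⟶ A') :
    (D.pull y).obj B ⟶ A' :=
  (D.compIso h B).hom ≫ (D.pull z).map f ≫ g

/-- Associativity in a Grothendieck construction of `𝔻`. Counits, restrictions and canonical maps of
internal homs are all arrows of this kind, so pasted diagrams can be compared by rebracketing. -/
theorem overComp_assoc {w₁ : K₁ ⥤ K₀} {w₂ : K₂ ⥤ K₁} {w₃ : K₃ ⥤ K₂} {w₁₂ : K₂ ⥤ K₀}
    {w₂₃ : K₃ ⥤ K₁} {x : K₃ ⥤ K₀} (h₁ : x = w₂₃ ⋙ w₁) (h₂ : w₂₃ = w₃ ⋙ w₂)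
    (h₃ : x = w₃ ⋙ w₁₂) (h₄ : w₁₂ = w₂ ⋙ w₁) {A₀ : D.obj K₀} {A₁ : D.obj K₁} {A₂ : D.obj K₂}
    {A₃ : D.obj K₃} (f : (D.pull w₁).obj A₀ ⟶ A₁) (g : (D.pull w₂).obj A₁ ⟶ A₂)
    (k : (D.pull w₃).obj A₂ ⟶ A₃) :
    D.overComp h₁ f (D.overComp h₂ g k) = D.overComp h₃ (D.overComp h₄ f g) k := by
  simp only [overComp, Functor.map_comp, Category.assoc]
  rw [← reassoc_of% (D.compIso_assoc h₁ h₂ h₃ h₄ A₀), ← reassoc_of% (D.compIso_hom_naturality h₂ f)]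

theorem overComp_comp {w : K₁ ⥤ K₀} {z : K₂ ⥤ K₁} {y : K₂ ⥤ K₀} (h : y = z ⋙ w) {B : D.obj K₀}
    {A : D.obj K₁} {A' A'' : D.obj K₂} (f : (D.pull w).obj B ⟶ A) (g : (D.pull z).obj A ⟶ A')
    (k : A' ⟶ A'') : D.overComp h f (g ≫ k) = D.overComp h f g ≫ k := by
  simp only [overComp, Category.assoc]

theorem comp_overComp {w : K₁ ⥤ K₀} {z : K₂ ⥤ K₁} {y : K₂ ⥤ K₀} (h : y = z ⋙ w) {B : D.obj K₀}
    {A A₁ : D.obj K₁} {A' : D.obj K₂} (f : (D.pull w).obj B ⟶ A) (k : A ⟶ A₁)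
    (g : (D.pull z).obj A₁ ⟶ A') :
    D.overComp h (f ≫ k) g = D.overComp h f ((D.pull z).map k ≫ g) := by
  simp only [overComp, Category.assoc, Functor.map_comp]

theorem map_comp_overComp {w : K₁ ⥤ K₀} {z : K₂ ⥤ K₁} {y : K₂ ⥤ K₀} (h : y = z ⋙ w)
    {B B₁ : D.obj K₀} {A : D.obj K₁} {A' : D.obj K₂} (k : B₁ ⟶ B) (f : (D.pull w).obj B ⟶ A)
    (g : (D.pull z).obj A ⟶ A') :
    D.overComp h ((D.pull w).map k ≫ f) g = (D.pull y).map k ≫ D.overComp h f g := by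
  simp only [overComp, Functor.map_comp, Category.assoc]
  rw [reassoc_of% (D.compIso_hom_naturality h k)]

theorem id_overComp {w : K₁ ⥤ K₀} {z : K₂ ⥤ K₁} {y : K₂ ⥤ K₀} (h : y = z ⋙ w) {B : D.obj K₀}
    {A' : D.obj K₂} (g : (D.pull z).obj ((D.pull w).obj B) ⟶ A') :
    D.overComp h (𝟙 _) g = (D.compIso h B).hom ≫ g := by
  rw [overComp, CategoryTheory.Functor.map_id, Category.id_comp]

/-- As `z^*w^*B ≅ y^*B`, a map out of `z^*w^*B` can be tested as a map over `y`, where another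
factorization of `y` becomes available. -/
theorem overComp_id_injective {w : K₁ ⥤ K₀} {z : K₂ ⥤ K₁} {y : K₂ ⥤ K₀} (h : y = z ⋙ w)
    {B : D.obj K₀} {A' : D.obj K₂} {g g' : (D.pull z).obj ((D.pull w).obj B) ⟶ A'}
    (e : D.overComp h (𝟙 _) g = D.overComp h (𝟙 _) g') : g = g' := by
  rw [id_overComp, id_overComp] at e
  exact (cancel_epi _).1 e

variable [D.HasKanExtensions]

/-- The universal map `w^* w_* A ⟶ A` over `w`. -/
def starε (w : K₁ ⥤ K₀) (A : D.obj K₁) : (D.pull w).obj ((D.star w).obj A) ⟶ A :=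
  (D.starAdj w).counit.app A

theorem star_hom_ext {w : K₁ ⥤ K₀} {A : D.obj K₁} {B : D.obj K₀} {f g : B ⟶ (D.star w).obj A}
    (h : (D.pull w).map f ≫ D.starε w A = (D.pull w).map g ≫ D.starε w A) : f = g := by
  apply ((D.starAdj w).homEquiv _ _).symm.injective
  rw [Adjunction.homEquiv_counit, Adjunction.homEquiv_counit]
  exact h

/-- The map into `w_* A` corresponding to a map over `w`. -/
def toStar (w : K₁ ⥤ K₀) {A : D.obj K₁} {B : D.obj K₀} (f : (D.pull w).obj B ⟶ A) :
    B ⟶ (D.star w).obj A :=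
  (D.starAdj w).homEquiv _ _ f

theorem toStar_fac (w : K₁ ⥤ K₀) {A : D.obj K₁} {B : D.obj K₀} (f : (D.pull w).obj B ⟶ A) :
    (D.pull w).map (D.toStar w f) ≫ D.starε w A = f := by
  have := ((D.starAdj w).homEquiv B A).symm_apply_apply f
  rwa [Adjunction.homEquiv_counit] at this

theorem star_map_fac (w : K₁ ⥤ K₀) {A A' : D.obj K₁} (f : A ⟶ A') :
    (D.pull w).map ((D.star w).map f) ≫ D.starε w A' = D.starε w A ≫ f :=
  (D.starAdj w).counit.naturality f

/-- Composition with the universal map is transposition along `w_*`, up to the isomorphism `y^*B ≅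
w^*z^*B`. -/
theorem overComp_starε_injective {w : K₁ ⥤ K₀} {z : K₀ ⥤ K₂} {y : K₁ ⥤ K₂} (h : y = w ⋙ z)
    {A : D.obj K₁} {B : D.obj K₂} {f g : (D.pull z).obj B ⟶ (D.star w).obj A}
    (e : D.overComp h f (D.starε w A) = D.overComp h g (D.starε w A)) : f = g := by
  apply D.star_hom_ext
  exact (cancel_epi _).1 e

/-- The counit form of the definition of a mate: it trades the Beck-Chevalley map for the 2-cell of
the square and the counit of `x`. -/
theorem bcStar_fac {w : K₃ ⥤ K₁} {v : K₃ ⥤ K₂} {u : K₁ ⥤ K₀} {x : K₂ ⥤ K₀}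
    (α : v ⋙ x ⟶ w ⋙ u) (A : D.obj K₂) :
    (D.pull w).map ((D.bcStar α).app A) ≫ D.starε w _ =
      (D.pullSquare α).app _ ≫ (D.pull v).map (D.starε x A) := by
  have := mateEquiv_counit (D.starAdj x) (D.starAdj w)
    (TwoSquare.mk (D.pull u) (D.pull x) (D.pull w) (D.pull v) (D.pullSquare α)) A
  exact this

/-- The Beck-Chevalley map of a commutative square, as a map over functors. -/
theorem overComp_bcStar {w : K₃ ⥤ K₁} {v : K₃ ⥤ K₂} {u : K₁ ⥤ K₀} {x : K₂ ⥤ K₀}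
    {y : K₃ ⥤ K₀} (h : v ⋙ x = w ⋙ u) (h₁ : y = w ⋙ u) (h₂ : y = v ⋙ x) (A : D.obj K₂) :
    D.overComp h₁ ((D.bcStar (eqToHom h)).app A) (D.starε w _) =
      D.overComp h₂ (D.starε x A) (𝟙 _) := by
  rw [overComp, bcStar_fac, D.pullSquare_eqToHom h h₁ h₂, Category.assoc,
    Iso.hom_inv_id_assoc, overComp, Category.comp_id]

end

end Prederivator

namespace Prederivator

variable {Dia : DiagramCategory.{w}} (D : Prederivator.{w, v, u} Dia)

/-! ### Internal homs and restriction -/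

section

open MonoidalClosed Functor.LaxMonoidal

variable [D.ClosedMonoidal]
variable {K₀ K₁ K₂ : Type w} [SmallCategory K₀] [SmallCategory K₁] [SmallCategory K₂]
  [InDia Dia K₀] [InDia Dia K₁] [InDia Dia K₂]

theorem uncurry_comp_ihomMap {A A' B B' X : D.obj K₀} (φ : X ⟶ (ihom A).obj B) (f : A' ⟶ A)
    (g : B ⟶ B') : uncurry (φ ≫ D.ihomMap f g) = f ▷ X ≫ uncurry φ ≫ g := by
  rw [ihomMap, ← Category.assoc, uncurry_natural_right, uncurry_pre_app, Category.assoc]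

theorem ihomMap_comp {A A' A'' B B' B'' : D.obj K₀} (f : A' ⟶ A) (g : B ⟶ B') (f' : A'' ⟶ A')
    (g' : B' ⟶ B'') : D.ihomMap f g ≫ D.ihomMap f' g' = D.ihomMap (f' ≫ f) (g ≫ g') := by
  apply uncurry_injective
  rw [uncurry_comp_ihomMap, ← Category.id_comp (D.ihomMap f g), uncurry_comp_ihomMap,
    ← Category.id_comp (D.ihomMap (f' ≫ f) _), uncurry_comp_ihomMap, comp_whiskerRight]
  simp only [Category.assoc]

theorem ihomMap_id (A B : D.obj K₀) : D.ihomMap (𝟙 A) (𝟙 B) = 𝟙 ((ihom A).obj B) := by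
  apply uncurry_injective
  rw [← Category.id_comp (D.ihomMap _ _), uncurry_comp_ihomMap, id_whiskerRight,
    Category.id_comp, Category.comp_id]

instance isIso_ihomMap {A A' B B' : D.obj K₀} (f : A' ⟶ A) (g : B ⟶ B') [IsIso f] [IsIso g] :
    IsIso (D.ihomMap f g) :=
  ⟨D.ihomMap (inv f) (inv g), by
    rw [ihomMap_comp, IsIso.inv_hom_id, IsIso.hom_inv_id, ihomMap_id], by
    rw [ihomMap_comp, IsIso.inv_hom_id, IsIso.hom_inv_id, ihomMap_id]⟩

theorem ihomMap_id_right {A A' B : D.obj K₀} (f : A' ⟶ A) :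
    D.ihomMap f (𝟙 B) = (pre f).app B := by
  rw [ihomMap, CategoryTheory.Functor.map_id, Category.comp_id]

/-- The comparison map is handled through its transpose: up to the tensor structure of `u^*`, it
acts as `u^*` on uncurried maps. -/
theorem uncurry_map_pullIhom (u : K₁ ⥤ K₀) {A B X : D.obj K₀} (φ : X ⟶ (ihom A).obj B) :
    uncurry ((D.pull u).map φ ≫ D.pullIhom u A B) =
      μ (D.pull u) A X ≫ (D.pull u).map (uncurry φ) := by
  rw [uncurry_natural_left, pullIhom, uncurry_curry, ← Category.assoc, μ_natural_right,
    Category.assoc, ← Functor.map_comp, uncurry_eq]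

/-- The canonical map `u^*[A, B] ⟶ [A', B']` over `u`, for `a : A' ⟶ u^*A` and
`b : u^*B ⟶ B'`. -/
def homOver (u : K₁ ⥤ K₀) {A B : D.obj K₀} {A' B' : D.obj K₁} (a : A' ⟶ (D.pull u).obj A)
    (b : (D.pull u).obj B ⟶ B') : (D.pull u).obj ((ihom A).obj B) ⟶ (ihom A').obj B' :=
  D.pullIhom u A B ≫ D.ihomMap a b

theorem uncurry_map_homOver (u : K₁ ⥤ K₀) {A B X : D.obj K₀} {A' B' : D.obj K₁}
    (φ : X ⟶ (ihom A).obj B) (a : A' ⟶ (D.pull u).obj A) (b : (D.pull u).obj B ⟶ B') :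
    uncurry ((D.pull u).map φ ≫ D.homOver u a b) =
      a ▷ _ ≫ μ (D.pull u) A X ≫ (D.pull u).map (uncurry φ) ≫ b := by
  rw [homOver, ← Category.assoc, uncurry_comp_ihomMap, uncurry_map_pullIhom, Category.assoc]

theorem uncurry_homOver (u : K₁ ⥤ K₀) {A B : D.obj K₀} {A' B' : D.obj K₁}
    (a : A' ⟶ (D.pull u).obj A) (b : (D.pull u).obj B ⟶ B') :
    uncurry (D.homOver u a b) =
      a ▷ _ ≫ μ (D.pull u) A _ ≫ (D.pull u).map (uncurry (𝟙 ((ihom A).obj B))) ≫ b := by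
  rw [← uncurry_map_homOver, CategoryTheory.Functor.map_id, Category.id_comp]

theorem homOver_comp_ihomMap (u : K₁ ⥤ K₀) {A B : D.obj K₀} {A' B' A'' B'' : D.obj K₁}
    (a : A' ⟶ (D.pull u).obj A) (b : (D.pull u).obj B ⟶ B') (f : A'' ⟶ A') (g : B' ⟶ B'') :
    D.homOver u a b ≫ D.ihomMap f g = D.homOver u (f ≫ a) (b ≫ g) := by
  rw [homOver, Category.assoc, ihomMap_comp, homOver]

theorem map_ihomMap_comp_homOver (u : K₁ ⥤ K₀) {A B A₁ B₁ : D.obj K₀} {A' B' : D.obj K₁}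
    (f : A₁ ⟶ A) (g : B ⟶ B₁) (a : A' ⟶ (D.pull u).obj A₁) (b : (D.pull u).obj B₁ ⟶ B') :
    (D.pull u).map (D.ihomMap f g) ≫ D.homOver u a b =
      D.homOver u (a ≫ (D.pull u).map f) ((D.pull u).map g ≫ b) := by
  apply uncurry_injective
  rw [uncurry_map_homOver, uncurry_homOver, ← Category.id_comp (D.ihomMap f g),
    uncurry_comp_ihomMap, comp_whiskerRight]
  simp only [Functor.map_comp, Category.assoc]
  rw [μ_natural_left_assoc]

theorem pullIhom_eq_homOver (u : K₁ ⥤ K₀) (A B : D.obj K₀) :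
    D.pullIhom u A B = D.homOver u (𝟙 _) (𝟙 _) := by
  rw [homOver, ihomMap_id, Category.comp_id]

/-- Naturality of `u^*[A, B] ⟶ [u^*A, u^*B]`. -/
theorem pullIhom_naturality (u : K₁ ⥤ K₀) {A B A₁ B₁ : D.obj K₀} (f : A₁ ⟶ A) (g : B ⟶ B₁) :
    (D.pull u).map (D.ihomMap f g) ≫ D.pullIhom u A₁ B₁ =
      D.pullIhom u A B ≫ D.ihomMap ((D.pull u).map f) ((D.pull u).map g) := by
  rw [pullIhom_eq_homOver, map_ihomMap_comp_homOver, pullIhom_eq_homOver, homOver_comp_ihomMap]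
  simp only [Category.id_comp, Category.comp_id]

/-- Here the monoidality of `pullComp` enters; it is what makes the canonical maps of internal homs
compose in `overComp_homOver`. -/
theorem μ_comp_compIso_hom {z : K₂ ⥤ K₁} {w : K₁ ⥤ K₀} {x : K₂ ⥤ K₀} (h : x = z ⋙ w)
    (A B : D.obj K₀) :
    μ (D.pull x) A B ≫ (D.compIso h (A ⊗ B)).hom =
      ((D.compIso h A).hom ⊗ₘ (D.compIso h B).hom) ≫
        μ (D.pull z) _ _ ≫ (D.pull z).map (μ (D.pull w) A B) := by
  subst h
  rw [compIso_hom_rfl, compIso_hom_rfl, compIso_hom_rfl, NatTrans.IsMonoidal.tensor,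
    Functor.LaxMonoidal.comp_μ]

/-- The composite of two canonical maps between internal homs. -/
theorem overComp_homOver {w : K₁ ⥤ K₀} {z : K₂ ⥤ K₁} {y : K₂ ⥤ K₀} (h : y = z ⋙ w)
    {A B : D.obj K₀} {A' B' : D.obj K₁} {A'' B'' : D.obj K₂} (a : A' ⟶ (D.pull w).obj A)
    (b : (D.pull w).obj B ⟶ B') (a' : A'' ⟶ (D.pull z).obj A') (b' : (D.pull z).obj B' ⟶ B'') :
    D.overComp h (D.homOver w a b) (D.homOver z a' b') =
      D.homOver y (a' ≫ (D.pull z).map a ≫ (D.compIso h A).inv) (D.overComp h b b') := by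
  apply uncurry_injective
  rw [overComp, uncurry_natural_left, uncurry_map_homOver, uncurry_homOver, uncurry_homOver,
    overComp]
  simp only [Functor.map_comp, Category.assoc, comp_whiskerRight]
  rw [compIso_hom_naturality_assoc, ← Category.assoc (μ (D.pull y) _ _), μ_comp_compIso_hom,
    MonoidalCategory.tensorHom_def]
  simp only [Category.assoc]
  -- The inverse identification of `A` from the contravariant slot cancels the one produced by the
  -- tensor structure.
  rw [whisker_exchange_assoc, ← comp_whiskerRight_assoc (D.compIso h A).inv, Iso.inv_hom_id, id_whiskerRight,
    Category.id_comp, ← whisker_exchange_assoc ((D.pull z).map a), μ_natural_left_assoc]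

/-- Monoidality of `pullId` splits the tensor structure of `𝟭^*` into two factors, and the inverse
inserted in the contravariant slot cancels the one belonging to `A`. -/
theorem homOver_id_comp_ihomMap (A B : D.obj K₀) :
    D.homOver (𝟭 K₀) ((D.pullId K₀).inv.app A) ((D.pullId K₀).hom.app B) =
      (D.pullId K₀).hom.app ((ihom A).obj B) := by
  apply uncurry_injective
  have h := (D.pullId K₀).hom.naturality (uncurry (𝟙 ((ihom A).obj B)))
  rw [uncurry_homOver, h, ← Category.assoc (μ (D.pull (𝟭 K₀)) A _), NatTrans.IsMonoidal.tensor]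
  rw [Functor.LaxMonoidal.id_μ, MonoidalCategory.tensorHom_def]
  simp only [Category.assoc, Functor.id_map, Functor.id_obj]
  rw [← comp_whiskerRight_assoc, Iso.inv_hom_id_app]
  simp [uncurry_eq]

/-- The internal homs form a lax natural transformation. -/
theorem isLaxNatural_pullIhom : D.IsLaxNatural D.source D.pullIhom where
  naturality u _ _ _ _ f g := D.pullIhom_naturality u f g
  map_id {I} _ _ A B := D.homOver_id_comp_ihomMap A B
  map_comp v u A B := by
    -- The composition law is the case of `overComp_homOver` in which all four comparison maps are
    -- identities.
    have h := D.overComp_homOver (rfl : v ⋙ u = v ⋙ u) (𝟙 ((D.pull u).obj A))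
      (𝟙 ((D.pull u).obj B)) (𝟙 _) (𝟙 _)
    rw [← pullIhom_eq_homOver, ← pullIhom_eq_homOver, overComp, compIso_hom_rfl, overComp,
      CategoryTheory.Functor.map_id, Category.id_comp, Category.id_comp,
      CategoryTheory.Functor.map_id, Category.id_comp, Category.comp_id, compIso_hom_rfl,
      compIso_inv_rfl] at h
    exact h.symm

end

end Prederivator

/-- The functor `3u : 3I' ⥤ 3I` induced by `u : I' ⥤ I`. -/
def Three.map {I I' : Type w} [SmallCategory I] [SmallCategory I'] (u : I' ⥤ I) :
    Three I' ⥤ Three I where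
  obj X := ⟨u.map X.f, u.map X.g⟩
  map φ := ⟨u.map φ.a₂, u.map φ.a₁, u.map φ.a₀, by
    rw [← φ.wf]; simp only [Functor.map_comp], by rw [← φ.wg]; simp only [Functor.map_comp]⟩
  map_id X := Three.hom_ext (u.map_id _) (u.map_id _) (u.map_id _)
  map_comp φ ψ := Three.hom_ext (u.map_comp _ _) (u.map_comp _ _) (u.map_comp _ _)

/-! ### Commutative triangles and squares of functors around `3I`. -/

section Equalities

variable {I I' J J' : Type w} [SmallCategory I] [SmallCategory I'] [SmallCategory J]
  [SmallCategory J'] (u : I' ⥤ I) (v : J' ⥤ J)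

theorem Three.t₂_eq_toTwOp_comp (I : Type w) [SmallCategory I] :
    Three.t₂ I = Three.toTwOp I ⋙ Tw.pq₂ I := rfl

theorem Three.t₂_eq_toTwProd_comp (I : Type w) [SmallCategory I] :
    Three.t₂ I = Three.toTwProd I ⋙ Ext.r I I := rfl

theorem Three.t₀_eq_toTwProd_comp (I : Type w) [SmallCategory I] :
    Three.t₀ I = Three.toTwProd I ⋙ Ext.q I I := rfl

theorem Three.toTwProd_comp_p (I : Type w) [SmallCategory I] :
    Three.toTwProd I ⋙ Ext.p I I = Three.toTwOp I ⋙ Tw.q₂ I := rfl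

theorem Three.map_comp_t₂ : Three.map u ⋙ Three.t₂ I = Three.t₂ I' ⋙ u := rfl

theorem Three.map_comp_t₀ : Three.map u ⋙ Three.t₀ I = Three.t₀ I' ⋙ u := rfl

theorem Three.map_comp_toTwOp :
    Three.map u ⋙ Three.toTwOp I = Three.toTwOp I' ⋙ (Tw.map u).op := rfl

theorem Three.map_comp_toTwProd :
    Three.map u ⋙ Three.toTwProd I = Three.toTwProd I' ⋙ (Tw.map u).prod u := rfl

theorem Tw.map_op_comp_pq₂ : (Tw.map u).op ⋙ Tw.pq₂ I = Tw.pq₂ I' ⋙ u := rfl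

theorem Tw.map_op_comp_q₂ : (Tw.map u).op ⋙ Tw.q₂ I = Tw.q₂ I' ⋙ u.op.prod u := rfl

theorem Ext.map_comp_p :
    (Tw.map u).prod v ⋙ Ext.p I J = Ext.p I' J' ⋙ u.op.prod v := rfl

theorem Ext.map_comp_q : (Tw.map u).prod v ⋙ Ext.q I J = Ext.q I' J' ⋙ u := rfl

theorem Ext.map_comp_r : (Tw.map u).prod v ⋙ Ext.r I J = Ext.r I' J' ⋙ v := rfl

end Equalities

namespace Prederivator

variable {Dia : DiagramCategory.{w}} (D : Prederivator.{w, v, u} Dia)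

section

variable {K₀ K₁ K₂ K₃ : Type w} [SmallCategory K₀] [SmallCategory K₁] [SmallCategory K₂]
  [SmallCategory K₃] [InDia Dia K₀] [InDia Dia K₁] [InDia Dia K₂] [InDia Dia K₃]

/-- The `eqToHom` factors allow `θ` to be any presentation of the whiskered 2-cell, with source and
target named differently from the literal composites. -/
theorem pull₂_app_comp_compIso_of_whiskerRight {z z' : K₂ ⥤ K₁} {w : K₁ ⥤ K₀} {x x' : K₂ ⥤ K₀}
    (h : x = z ⋙ w) (h' : x' = z' ⋙ w) (η : z ⟶ z') (θ : x ⟶ x')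
    (hθ : θ = eqToHom h ≫ Functor.whiskerRight η w ≫ eqToHom h'.symm) (A : D.obj K₀) :
    (D.pull₂ θ).app A ≫ (D.compIso h A).hom =
      (D.compIso h' A).hom ≫ (D.pull₂ η).app ((D.pull w).obj A) := by
  subst h h'
  rw [eqToHom_refl, eqToHom_refl, Category.id_comp, Category.comp_id] at hθ
  rw [hθ, compIso_hom_rfl, compIso_hom_rfl]
  exact NatTrans.congr_app (D.pull₂_whiskerRight η w) A

theorem pull₂_app_comp_compIso_of_whiskerLeft {z : K₂ ⥤ K₁} {w w' : K₁ ⥤ K₀} {x x' : K₂ ⥤ K₀}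
    (h : x = z ⋙ w) (h' : x' = z ⋙ w') (η : w ⟶ w') (θ : x ⟶ x')
    (hθ : θ = eqToHom h ≫ Functor.whiskerLeft z η ≫ eqToHom h'.symm) (A : D.obj K₀) :
    (D.pull₂ θ).app A ≫ (D.compIso h A).hom =
      (D.compIso h' A).hom ≫ (D.pull z).map ((D.pull₂ η).app A) := by
  subst h h'
  rw [eqToHom_refl, eqToHom_refl, Category.id_comp, Category.comp_id] at hθ
  rw [hθ, compIso_hom_rfl, compIso_hom_rfl]
  exact NatTrans.congr_app (D.pull₂_whiskerLeft z η) A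

variable [D.HasKanExtensions]

theorem starCompIso_inv_fac {z : K₂ ⥤ K₁} {w : K₁ ⥤ K₀} {x : K₂ ⥤ K₀} (h : x = z ⋙ w)
    (A : D.obj K₂) :
    (D.pull x).map ((D.starCompIso (eqToIso h.symm)).inv.app A) ≫ D.starε x A =
      D.overComp h (D.starε w _) (D.starε z A) := by
  have := conjugateEquiv_counit ((D.starAdj w).comp (D.starAdj z)) (D.starAdj x)
    (D.pullCompIso (eqToIso h.symm)).hom A
  refine this.trans ?_
  rw [Adjunction.comp_counit_app]
  rfl

/-- The Beck-Chevalley map of a commutative square, followed by `w_* f`, as a map over functors. -/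
theorem overComp_bcStar_comp {w : K₃ ⥤ K₁} {v : K₃ ⥤ K₂} {u : K₁ ⥤ K₀} {x : K₂ ⥤ K₀}
    {y : K₃ ⥤ K₀} (α : v ⋙ x ⟶ w ⋙ u) (h : v ⋙ x = w ⋙ u) (hα : α = eqToHom h)
    (h₁ : y = w ⋙ u) (h₂ : y = v ⋙ x) {A : D.obj K₂} {A' : D.obj K₃}
    (f : (D.pull v).obj A ⟶ A') :
    D.overComp h₁ ((D.bcStar α).app A ≫ (D.star w).map f) (D.starε w _) =
      D.overComp h₂ (D.starε x A) f := by
  subst hα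
  rw [comp_overComp, star_map_fac, overComp_comp, D.overComp_bcStar h h₁ h₂, ← overComp_comp,
    Category.id_comp]

end

/-! ### The two halves of the zigzag, transposed along `t₂`. -/

section

variable [D.HasKanExtensions]
variable {I I' : Type w} [SmallCategory I] [SmallCategory I'] [InDia Dia I] [InDia Dia I']

/-- The map `q₂^* p_* X ⟶ p'_* q'^* X` of the pullback square defining `3I`. -/
def threeBaseChange (X : D.obj (Tw I × I)) :
    (D.pull (Tw.q₂ I)).obj ((D.star (Ext.p I I)).obj X) ⟶
      (D.star (Three.toTwOp I)).obj ((D.pull (Three.toTwProd I)).obj X) :=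
  (D.bcStar (eqToHom (Three.toTwProd_comp_p I))).app X

/-- The map `p'^* q₂^* p_* X ⟶ q'^* X` of the pullback square defining `3I`. -/
def threeCounit (X : D.obj (Tw I × I)) :
    (D.pull (Three.toTwOp I)).obj ((D.pull (Tw.q₂ I)).obj ((D.star (Ext.p I I)).obj X)) ⟶
      (D.pull (Three.toTwProd I)).obj X :=
  (D.pull (Three.toTwOp I)).map (D.threeBaseChange X) ≫ D.starε (Three.toTwOp I) _

/-- Up to commutativity of the square, `threeCounit` is the counit of `p` restricted to `3I`; in
this form base change enters the compatibility with restriction. -/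
theorem overComp_threeCounit (X : D.obj (Tw I × I)) :
    D.overComp (Three.toTwProd_comp_p I) (𝟙 _) (D.threeCounit X) =
      D.overComp rfl (D.starε (Ext.p I I) X) (𝟙 _) := by
  rw [id_overComp]
  exact D.overComp_bcStar (Three.toTwProd_comp_p I) (Three.toTwProd_comp_p I) rfl X

theorem threeCounit_naturality {X Y : D.obj (Tw I × I)} (f : X ⟶ Y) :
    (D.pull (Three.toTwOp I)).map ((D.pull (Tw.q₂ I)).map ((D.star (Ext.p I I)).map f)) ≫
        D.threeCounit Y = D.threeCounit X ≫ (D.pull (Three.toTwProd I)).map f := by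
  apply D.overComp_id_injective (Three.toTwProd_comp_p I)
  rw [← comp_overComp, Category.id_comp]
  have h := D.map_comp_overComp (Three.toTwProd_comp_p I)
    ((D.star (Ext.p I I)).map f) (𝟙 _) (D.threeCounit Y)
  rw [Category.comp_id] at h
  rw [h, overComp_threeCounit, overComp_comp, overComp_threeCounit, ← map_comp_overComp,
    star_map_fac, comp_overComp, ← overComp_comp, Category.id_comp, Category.comp_id]

/-- The map `t₂^* (pq)₂_* q₂^* p_* X ⟶ q'^* X`. -/
def threeMap (X : D.obj (Tw I × I)) :
    (D.pull (Three.t₂ I)).obj ((D.star (Tw.pq₂ I)).obj ((D.pull (Tw.q₂ I)).obj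
      ((D.star (Ext.p I I)).obj X))) ⟶ (D.pull (Three.toTwProd I)).obj X :=
  D.overComp (Three.t₂_eq_toTwOp_comp I) (D.starε (Tw.pq₂ I) _)
    (D.threeCounit X)

theorem threeMap_naturality {X Y : D.obj (Tw I × I)} (f : X ⟶ Y) :
    (D.pull (Three.t₂ I)).map ((D.star (Tw.pq₂ I)).map ((D.pull (Tw.q₂ I)).map
      ((D.star (Ext.p I I)).map f))) ≫ D.threeMap Y =
        D.threeMap X ≫ (D.pull (Three.toTwProd I)).map f := by
  rw [threeMap, ← map_comp_overComp, star_map_fac, comp_overComp, threeCounit_naturality,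
    overComp_comp, threeMap]

/-- The composite `(pq)₂_* q₂^* p_* X ⟶ (pq)₂_* p'_* q'^* X ⟶ (pq)₂_* p'_* Y ≅ t₂_* Y ⟶ t₂_* Z`
for `q'^* X ⟶ Y ⟶ Z`. -/
def threeBackward (X : D.obj (Tw I × I)) {Y Z : D.obj (Three I)}
    (φ : (D.pull (Three.toTwProd I)).obj X ⟶ Y) (ψ : Y ⟶ Z) :
    (D.star (Tw.pq₂ I)).obj ((D.pull (Tw.q₂ I)).obj ((D.star (Ext.p I I)).obj X)) ⟶
      (D.star (Three.t₂ I)).obj Z :=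
  (D.star (Tw.pq₂ I)).map (D.threeBaseChange X) ≫
    (D.star (Tw.pq₂ I)).map ((D.star (Three.toTwOp I)).map φ) ≫
      (D.starCompIso (eqToIso (Three.t₂_eq_toTwOp_comp I).symm)).inv.app Y ≫
        (D.star (Three.t₂ I)).map ψ

/-- Transposition removes the pushforwards one at a time: the identification of `t₂_*` with an
iterated pushforward becomes a composite of counits, and naturality of the counits moves `φ` and `ψ`
to the end. -/
theorem threeBackward_fac (X : D.obj (Tw I × I)) {Y Z : D.obj (Three I)}
    (φ : (D.pull (Three.toTwProd I)).obj X ⟶ Y) (ψ : Y ⟶ Z) :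
    (D.pull (Three.t₂ I)).map (D.threeBackward X φ ψ) ≫ D.starε (Three.t₂ I) _ =
      D.threeMap X ≫ φ ≫ ψ := by
  have h := D.starCompIso_inv_fac (Three.t₂_eq_toTwOp_comp I) Y
  rw [threeBackward]
  simp only [Functor.map_comp, Category.assoc]
  rw [star_map_fac, reassoc_of% h]
  rw [← overComp_comp, ← map_comp_overComp, ← map_comp_overComp, star_map_fac, ← Category.assoc,
    star_map_fac, threeMap, ← overComp_comp, Category.assoc, comp_overComp, Functor.map_comp,
    Category.assoc, ← Category.assoc ((D.pull (Three.toTwOp I)).map ((D.star _).map _)),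
    star_map_fac, threeCounit]
  simp only [Category.assoc]

variable [D.ClosedMonoidal]

theorem sharpIhom_fac {J : Type w} [SmallCategory J] [InDia Dia J] (u : I ⥤ J) (A : D.obj I)
    (B : D.obj J) :
    (D.pull u).map (D.sharpIhom u A B) ≫ D.starε u _ =
      D.homOver u ((D.sharpAdj u).unit.app A) (𝟙 _) := by
  rw [homOver, ihomMap_id_right]
  exact D.toStar_fac u _

/-- The transpose of the first part of `Θ`. -/
theorem ΘForward_fac (A B : D.obj I) :
    (D.pull (Three.t₂ I)).map (D.ΘForward A B) ≫ D.starε (Three.t₂ I) _ =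
      D.homOver (Three.t₂ I) ((D.pull₂ (Three.τ I)).app A) (𝟙 _) := by
  rw [ΘForward]
  simp only [Functor.map_comp, Category.assoc]
  rw [sharpIhom_fac, ← ihomMap_id_right, ← ihomMap_id_right, map_ihomMap_comp_homOver,
    map_ihomMap_comp_homOver]
  congr 1
  -- Naturality of the unit and a triangle identity leave only the transformation `τ` in the
  -- contravariant slot.
  · have h₁ := (D.sharpAdj (Three.t₂ I)).unit.naturality ((D.pull₂ (Three.τ I)).app A)
    have h₂ := (D.sharpAdj (Three.t₂ I)).right_triangle_components A
    simp only [Functor.id_map, Functor.comp_map, Category.assoc] at h₁ ⊢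
    rw [← reassoc_of% h₁]
    refine (congrArg _ h₂).trans (Category.comp_id _)
  · simp

/-- The canonical map `q'^*[q^*A, r^*B] ⟶ [t₀^*A, t₂^*B]`. -/
def threeHom (A B : D.obj I) :
    (D.pull (Three.toTwProd I)).obj
        ((ihom ((D.pull (Ext.q I I)).obj A)).obj ((D.pull (Ext.r I I)).obj B)) ⟶
      (ihom ((D.pull (Three.t₀ I)).obj A)).obj ((D.pull (Three.t₂ I)).obj B) :=
  D.homOver (Three.toTwProd I)
    (D.compIso (Three.t₀_eq_toTwProd_comp I) A).hom
    (D.compIso (Three.t₂_eq_toTwProd_comp I) B).inv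

/-- The second part of `Θ`, with the external hom unfolded. -/
def backward (A B : D.obj I) :
    (D.star (Tw.pq₂ I)).obj ((D.pull (Tw.q₂ I)).obj ((D.star (Ext.p I I)).obj
      ((ihom ((D.pull (Ext.q I I)).obj A)).obj ((D.pull (Ext.r I I)).obj B)))) ⟶
      (D.star (Three.t₂ I)).obj
        ((ihom ((D.pull (Three.t₀ I)).obj A)).obj ((D.pull (Three.t₂ I)).obj B)) :=
  D.ΘBackward A B

/-- The transpose of the second part of `Θ`. -/
theorem backward_fac (A B : D.obj I) :
    (D.pull (Three.t₂ I)).map (D.backward A B) ≫ D.starε (Three.t₂ I) _ =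
      D.threeMap _ ≫ D.threeHom A B :=
  -- `ΘBackward` is `threeBackward` for these two maps by definition, because the relevant triangles
  -- and squares of functors commute definitionally.
  D.threeBackward_fac
    ((ihom ((D.pull (Ext.q I I)).obj A)).obj ((D.pull (Ext.r I I)).obj B))
    (D.pullIhom (Three.toTwProd I) _ _)
    (D.ihomMap (D.compIso (Three.t₀_eq_toTwProd_comp I) A).hom
      (D.compIso (Three.t₂_eq_toTwProd_comp I) B).inv)

end

end Prederivator

namespace Prederivator

variable {Dia : DiagramCategory.{w}} (D : Prederivator.{w, v, u} Dia)

/-! ### Compatibility of `Θ` with restriction -/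

section

variable {I I' : Type w} [SmallCategory I] [SmallCategory I'] [InDia Dia I] [InDia Dia I']

/-- The map `(3u)^* q'^* X ⟶ q'^* X'` induced by `F : (tw u × u)^* X ⟶ X'`. -/
def threeRestrict (u : I' ⥤ I) {X : D.obj (Tw I × I)} {X' : D.obj (Tw I' × I')}
    (F : (D.pull ((Tw.map u).prod u)).obj X ⟶ X') :
    (D.pull (Three.map u)).obj ((D.pull (Three.toTwProd I)).obj X) ⟶
      (D.pull (Three.toTwProd I')).obj X' :=
  (D.compIso (Three.map_comp_toTwProd u).symm X).inv ≫ D.overComp rfl F (𝟙 _)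

theorem overComp_threeRestrict (u : I' ⥤ I) {X : D.obj (Tw I × I)} {X' : D.obj (Tw I' × I')}
    (F : (D.pull ((Tw.map u).prod u)).obj X ⟶ X') :
    D.overComp (Three.map_comp_toTwProd u).symm (𝟙 _) (D.threeRestrict u F) =
      D.overComp rfl F (𝟙 _) := by
  rw [id_overComp, threeRestrict, Iso.hom_inv_id_assoc]

section

variable [D.ClosedMonoidal]

/-- The map `(tw u × u)^*[q^*A, r^*B] ⟶ [q^*u^*A, r^*u^*B]`. -/
def extHom (u : I' ⥤ I) (A B : D.obj I) :
    (D.pull ((Tw.map u).prod u)).obj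
        ((ihom ((D.pull (Ext.q I I)).obj A)).obj ((D.pull (Ext.r I I)).obj B)) ⟶
      (ihom ((D.pull (Ext.q I' I')).obj ((D.pull u).obj A))).obj
        ((D.pull (Ext.r I' I')).obj ((D.pull u).obj B)) :=
  D.homOver _ ((D.pullSquare (eqToHom (Ext.map_comp_q u u))).app A)
    ((D.pullSquare (eqToHom (Ext.map_comp_r u u).symm)).app B)

/-- The map `(3u)^*[t₀^*A, t₂^*B] ⟶ [t₀^*u^*A, t₂^*u^*B]`. -/
def threeIhom (u : I' ⥤ I) (A B : D.obj I) :
    (D.pull (Three.map u)).obj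
        ((ihom ((D.pull (Three.t₀ I)).obj A)).obj ((D.pull (Three.t₂ I)).obj B)) ⟶
      (ihom ((D.pull (Three.t₀ I')).obj ((D.pull u).obj A))).obj
        ((D.pull (Three.t₂ I')).obj ((D.pull u).obj B)) :=
  D.homOver _ ((D.pullSquare (eqToHom (Three.map_comp_t₀ u))).app A)
    ((D.pullSquare (eqToHom (Three.map_comp_t₂ u).symm)).app B)

/-- Both sides are canonical maps of internal homs over the same functor, so only the
identifications in the two slots have to be compared. -/
theorem threeRestrict_comp_threeHom (u : I' ⥤ I) (A B : D.obj I) :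
    D.threeRestrict u (D.extHom u A B) ≫ D.threeHom ((D.pull u).obj A) ((D.pull u).obj B) =
      (D.pull (Three.map u)).map (D.threeHom A B) ≫ D.threeIhom u A B := by
  apply D.overComp_id_injective (Three.map_comp_toTwProd u).symm
  rw [overComp_comp, overComp_threeRestrict, ← overComp_comp, ← comp_overComp, Category.id_comp,
    Category.id_comp, extHom, threeHom, threeHom, threeIhom, overComp_homOver, overComp_homOver]
  congr 1
  -- Factorizations of the single functor sending `x₂ ⟶ x₁ ⟶ x₀` to `u(x₀)`; the identifications of
  -- `A` are routed through them until both sides coincide. The second slot is treated in the same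
  -- way with `u(x₂)`.
  · have h₁ : (Three.toTwProd I' ⋙ (Tw.map u).prod u) ⋙ Ext.q I I = Three.t₀ I' ⋙ u := rfl
    have h₂ : (Three.toTwProd I' ⋙ (Tw.map u).prod u) ⋙ Ext.q I I =
      Three.toTwProd I' ⋙ Ext.q I' I' ⋙ u := rfl
    have h₃ : (Three.toTwProd I' ⋙ (Tw.map u).prod u) ⋙ Ext.q I I =
      Three.map u ⋙ Three.t₀ I := rfl
    rw [D.pullSquare_eqToHom _ rfl (Ext.map_comp_q u u).symm, D.pullSquare_eqToHom _ h₁ h₃,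
      Functor.map_comp, Category.assoc, Category.assoc,
      D.compIso_hom_comp_map_hom rfl (Three.map_comp_toTwProd u).symm h₃
        (Three.t₀_eq_toTwProd_comp I),
      ← Category.assoc, D.compIso_hom_comp_map_inv h₁ (Three.t₀_eq_toTwProd_comp I') h₂ rfl,
      Category.assoc, D.compIso_hom_comp_map_hom rfl rfl h₂ (Ext.map_comp_q u u).symm]
  · have h₁ : (Three.toTwProd I' ⋙ (Tw.map u).prod u) ⋙ Ext.r I I = Three.t₂ I' ⋙ u := rfl
    have h₂ : (Three.toTwProd I' ⋙ (Tw.map u).prod u) ⋙ Ext.r I I =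
      Three.toTwProd I' ⋙ Ext.r I' I' ⋙ u := rfl
    have h₃ : (Three.toTwProd I' ⋙ (Tw.map u).prod u) ⋙ Ext.r I I =
      Three.map u ⋙ Three.t₂ I := rfl
    rw [overComp, overComp, D.pullSquare_eqToHom _ (Ext.map_comp_r u u).symm rfl,
      D.pullSquare_eqToHom _ h₃ h₁, Functor.map_comp, Category.assoc,
      reassoc_of% (D.compIso_hom_comp_map_inv rfl (Three.map_comp_toTwProd u).symm h₃
        (Three.t₂_eq_toTwProd_comp I) B), Iso.hom_inv_id_assoc,
      reassoc_of% (D.compIso_hom_comp_map_inv rfl rfl h₂ (Ext.map_comp_r u u).symm B),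
      D.compIso_hom_comp_map_hom h₁ (Three.t₂_eq_toTwProd_comp I') h₂ rfl]

end

variable [D.HasKanExtensions]

/-- The map `u^* (pq)₂_* q₂^* p_* X ⟶ (pq)₂_* q₂^* p_* X'` induced by
`F : (tw u × u)^* X ⟶ X'`. -/
def targetRestrict (u : I' ⥤ I) {X : D.obj (Tw I × I)} {X' : D.obj (Tw I' × I')}
    (F : (D.pull ((Tw.map u).prod u)).obj X ⟶ X') :
    (D.pull u).obj ((D.star (Tw.pq₂ I)).obj ((D.pull (Tw.q₂ I)).obj
      ((D.star (Ext.p I I)).obj X))) ⟶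
      (D.star (Tw.pq₂ I')).obj ((D.pull (Tw.q₂ I')).obj ((D.star (Ext.p I' I')).obj X')) :=
  (D.bcStar (eqToHom (Tw.map_op_comp_pq₂ u))).app _ ≫ (D.star (Tw.pq₂ I')).map
    ((D.pullSquare (eqToHom (Tw.map_op_comp_q₂ u).symm)).app _ ≫ (D.pull (Tw.q₂ I')).map
      ((D.bcStar (eqToHom (Ext.map_comp_p u u))).app X ≫ (D.star (Ext.p I' I')).map F))

/-- Each Beck-Chevalley map in `targetRestrict` turns into a counit once it is composed with the
next universal map. Both sides are then the counits of `(pq)₂` and `p` followed by `F`, all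
restricted to `3I'`. -/
theorem overComp_targetRestrict_threeMap (u : I' ⥤ I) {X : D.obj (Tw I × I)}
    {X' : D.obj (Tw I' × I')} (F : (D.pull ((Tw.map u).prod u)).obj X ⟶ X') :
    D.overComp rfl (D.targetRestrict u F) (D.threeMap X') =
      D.overComp (Three.map_comp_t₂ u).symm (D.threeMap X) (D.threeRestrict u F) := by
  have h₁ : Three.t₂ I' ⋙ u = Three.toTwOp I' ⋙ Tw.pq₂ I' ⋙ u := rfl
  have h₂ : Three.t₂ I' ⋙ u = (Three.toTwOp I' ⋙ (Tw.map u).op) ⋙ Tw.pq₂ I := rfl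
  have h₃ : (Three.toTwProd I' ⋙ (Tw.map u).prod u) ⋙ Ext.p I I =
    (Three.toTwOp I' ⋙ (Tw.map u).op) ⋙ Tw.q₂ I := rfl
  have h₄ : (Three.toTwProd I' ⋙ (Tw.map u).prod u) ⋙ Ext.p I I =
    Three.toTwOp I' ⋙ Tw.q₂ I' ⋙ u.op.prod u := rfl
  have h₅ : (Three.toTwProd I' ⋙ (Tw.map u).prod u) ⋙ Ext.p I I =
    (Three.toTwProd I' ⋙ Ext.p I' I') ⋙ u.op.prod u := rfl
  have h₆ : (Three.toTwProd I' ⋙ (Tw.map u).prod u) ⋙ Ext.p I I =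
    Three.toTwProd I' ⋙ Ext.p I' I' ⋙ u.op.prod u := rfl
  have h₇ : (Three.toTwProd I' ⋙ (Tw.map u).prod u) ⋙ Ext.p I I =
    Three.map u ⋙ Three.toTwProd I ⋙ Ext.p I I := rfl
  rw [threeMap, threeMap, D.overComp_assoc rfl (Three.t₂_eq_toTwOp_comp I') h₁ rfl,
    targetRestrict, D.overComp_bcStar_comp _ (Tw.map_op_comp_pq₂ u) rfl rfl
      (Tw.map_op_comp_pq₂ u).symm, ← D.overComp_assoc h₂ rfl,
    ← D.overComp_assoc h₂ (Three.map_comp_toTwOp u).symm]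
  congr 1
  -- The counit of `(pq)₂` is now split off. What remains starts from a pullback of `q₂^*p_*X` to
  -- `3I'`; read over the diagonal to `Iᵒᵖ × I`, it can be refactored through the squares involving
  -- `p`.
  apply D.overComp_id_injective h₃
  rw [D.overComp_assoc h₃ rfl h₄ (Tw.map_op_comp_q₂ u).symm, id_overComp,
    D.pullSquare_eqToHom _ (Tw.map_op_comp_q₂ u).symm rfl, Category.assoc,
    Iso.hom_inv_id_assoc]
  -- The Beck-Chevalley maps of the squares involving `p` become counits, so that both sides reduce
  -- to the counit of `p` followed by `F`.
  have e := D.overComp_bcStar_comp _ (Ext.map_comp_p u u) rfl rfl (Ext.map_comp_p u u).symm F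
  have e' := D.overComp_assoc h₅ (Three.toTwProd_comp_p I') h₄ rfl
    ((D.bcStar (eqToHom (Ext.map_comp_p u u))).app X ≫ (D.star (Ext.p I' I')).map F) (𝟙 _)
    (D.threeCounit X')
  rw [overComp_threeCounit, D.overComp_assoc h₅ rfl h₆ rfl, e, ← D.overComp_assoc rfl rfl] at e'
  refine Eq.trans ?_ (e'.symm.trans ?_)
  · simp only [overComp, Category.comp_id]
  · rw [D.overComp_assoc h₃ (Three.map_comp_toTwOp u).symm h₇ (Three.toTwProd_comp_p I),
      overComp_threeCounit, ← D.overComp_assoc rfl (Three.map_comp_toTwProd u).symm,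
      overComp_threeRestrict]

variable [D.ClosedMonoidal]

/-- The canonical map `u^* t₂_*[t₀^*A, t₂^*B] ⟶ t₂_*[t₀^*u^*A, t₂^*u^*B]`. -/
def pullMiddle (u : I' ⥤ I) (A B : D.obj I) :
    (D.pull u).obj ((D.star (Three.t₂ I)).obj
        ((ihom ((D.pull (Three.t₀ I)).obj A)).obj ((D.pull (Three.t₂ I)).obj B))) ⟶
      (D.star (Three.t₂ I')).obj ((ihom ((D.pull (Three.t₀ I')).obj ((D.pull u).obj A))).obj
        ((D.pull (Three.t₂ I')).obj ((D.pull u).obj B))) :=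
  (D.bcStar (eqToHom (Three.map_comp_t₂ u))).app _ ≫ (D.star (Three.t₂ I')).map (D.threeIhom u A B)

/-- Transposed along `t₂`, this separates into the compatibility of `threeMap` with restriction,
valid for every `F`, and that of `threeHom`, which concerns internal homs only. -/
theorem pullTarget_comp_ΘBackward (u : I' ⥤ I) (A B : D.obj I) :
    D.pullTarget u A B ≫ D.ΘBackward ((D.pull u).obj A) ((D.pull u).obj B) =
      (D.pull u).map (D.ΘBackward A B) ≫ D.pullMiddle u A B := by
  have h₁ := D.overComp_targetRestrict_threeMap u (D.extHom u A B)
  have h₂ := D.overComp_bcStar_comp _ (Three.map_comp_t₂ u) rfl rfl (Three.map_comp_t₂ u).symm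
    (D.threeIhom u A B)
  apply D.overComp_starε_injective (rfl : Three.t₂ I' ⋙ u = _)
  -- `pullTarget` is definitionally `targetRestrict` for the comparison `extHom` of internal homs.
  change D.overComp _ (D.targetRestrict u (D.extHom u A B) ≫ D.backward _ _) _ =
    D.overComp _ ((D.pull u).map (D.backward A B) ≫ _) _
  rw [comp_overComp, backward_fac, overComp_comp, h₁, ← overComp_comp,
    threeRestrict_comp_threeHom, ← comp_overComp, ← backward_fac, map_comp_overComp,
    map_comp_overComp, pullMiddle, h₂]

/-- After transposition both sides are canonical maps of internal homs over `t₂ ⋙ u`; the content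
lies in the contravariant slot, where `u` has to match the two transformations `τ`. -/
theorem pullIhom_comp_ΘForward (u : I' ⥤ I) (A B : D.obj I) :
    D.pullIhom u A B ≫ D.ΘForward ((D.pull u).obj A) ((D.pull u).obj B) =
      (D.pull u).map (D.ΘForward A B) ≫ D.pullMiddle u A B := by
  have h₂ := D.overComp_bcStar_comp _ (Three.map_comp_t₂ u) rfl rfl (Three.map_comp_t₂ u).symm
    (D.threeIhom u A B)
  apply D.overComp_starε_injective (rfl : Three.t₂ I' ⋙ u = _)
  rw [comp_overComp, ΘForward_fac, map_comp_overComp, pullMiddle, h₂, ← map_comp_overComp,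
    ΘForward_fac, pullIhom_eq_homOver, threeIhom, overComp_homOver, overComp_homOver]
  congr 1
  -- One 2-cell in two presentations: `τ` of `3I'` followed by `u`, and `τ` of `3I` restricted along
  -- `3u`. They agree because `u` preserves composites.
  · let θ : Three.t₂ I' ⋙ u ⟶ Three.t₀ I' ⋙ u := Functor.whiskerRight (Three.τ I') u
    have h₃ := D.pull₂_app_comp_compIso_of_whiskerRight rfl rfl (Three.τ I') θ
      (by simp [θ]) A
    have h₄ := D.pull₂_app_comp_compIso_of_whiskerLeft (Three.map_comp_t₂ u).symm
      (Three.map_comp_t₀ u).symm (Three.τ I) θ (by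
        ext X
        change u.map (X.f ≫ X.g) = 𝟙 _ ≫ (u.map X.f ≫ u.map X.g) ≫ 𝟙 _
        rw [Category.id_comp, Category.comp_id, Functor.map_comp]) A
    rw [D.pullSquare_eqToHom _ rfl (Three.map_comp_t₀ u).symm, Category.assoc,
      ← reassoc_of% h₄, Iso.hom_inv_id, Category.comp_id, CategoryTheory.Functor.map_id,
      Category.id_comp, ← cancel_epi (D.compIso (rfl : Three.t₀ I' ⋙ u = _) A).hom, ← reassoc_of% h₃, Iso.hom_inv_id,
      Category.comp_id, Iso.hom_inv_id_assoc]
  · simp only [overComp]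
    rw [D.pullSquare_eqToHom _ (Three.map_comp_t₂ u).symm rfl]
    simp

end

end Prederivator

namespace Prederivator

variable {Dia : DiagramCategory.{w}} (D : Prederivator.{w, v, u} Dia)

/-! ### Naturality of `Θ` -/

section

variable [D.ClosedMonoidal]
variable {I : Type w} [SmallCategory I] [InDia Dia I]

theorem threeHom_naturality {A A' B B' : D.obj I} (f : A' ⟶ A) (g : B ⟶ B') :
    (D.pull (Three.toTwProd I)).map
        (D.ihomMap ((D.pull (Ext.q I I)).map f) ((D.pull (Ext.r I I)).map g)) ≫ D.threeHom A' B' =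
      D.threeHom A B ≫ D.ihomMap ((D.pull (Three.t₀ I)).map f) ((D.pull (Three.t₂ I)).map g) := by
  rw [threeHom, map_ihomMap_comp_homOver, threeHom, homOver_comp_ihomMap,
    compIso_hom_naturality, compIso_inv_naturality]

variable [D.HasKanExtensions]

theorem ΘForward_naturality {A A' B B' : D.obj I} (f : A' ⟶ A) (g : B ⟶ B') :
    D.ihomMap f g ≫ D.ΘForward A' B' = D.ΘForward A B ≫ (D.star (Three.t₂ I)).map
      (D.ihomMap ((D.pull (Three.t₀ I)).map f) ((D.pull (Three.t₂ I)).map g)) := by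
  apply D.star_hom_ext
  rw [Functor.map_comp, Category.assoc, ΘForward_fac, map_ihomMap_comp_homOver, Functor.map_comp,
    Category.assoc, star_map_fac, ← Category.assoc, ΘForward_fac, homOver_comp_ihomMap,
    Category.comp_id, Category.id_comp, NatTrans.naturality]

theorem backward_naturality {A A' B B' : D.obj I} (f : A' ⟶ A) (g : B ⟶ B') :
    (D.star (Tw.pq₂ I)).map ((D.pull (Tw.q₂ I)).map ((D.star (Ext.p I I)).map
      (D.ihomMap ((D.pull (Ext.q I I)).map f) ((D.pull (Ext.r I I)).map g)))) ≫
        D.backward A' B' = D.backward A B ≫ (D.star (Three.t₂ I)).map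
      (D.ihomMap ((D.pull (Three.t₀ I)).map f) ((D.pull (Three.t₂ I)).map g)) := by
  apply D.star_hom_ext
  rw [Functor.map_comp, Category.assoc, backward_fac, ← Category.assoc, threeMap_naturality,
    Category.assoc, threeHom_naturality, Functor.map_comp, Category.assoc, star_map_fac,
    ← Category.assoc, ← Category.assoc, backward_fac]

theorem biMap_target {A A' B B' : D.obj I} (f : A' ⟶ A) (g : B ⟶ B') :
    biMap (D.target I) f g =
      (D.star (Tw.pq₂ I)).map ((D.pull (Tw.q₂ I)).map ((D.star (Ext.p I I)).map
        (D.ihomMap ((D.pull (Ext.q I I)).map f) ((D.pull (Ext.r I I)).map g)))) := by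
  rw [ihomMap, Functor.map_comp, Functor.map_comp, Functor.map_comp]
  rfl

theorem biMap_target_comp_ΘBackward {A A' B B' : D.obj I} (f : A' ⟶ A) (g : B ⟶ B') :
    biMap (D.target I) f g ≫ D.ΘBackward A' B' = D.ΘBackward A B ≫ (D.star (Three.t₂ I)).map
      (D.ihomMap ((D.pull (Three.t₀ I)).map f) ((D.pull (Three.t₂ I)).map g)) := by
  rw [biMap_target]
  exact D.backward_naturality f g

theorem Θ_comp_ΘBackward (A B : D.obj I) [IsIso (D.ΘBackward A B)] :
    D.Θ A B ≫ D.ΘBackward A B = D.ΘForward A B := by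
  rw [Θ, Category.assoc, IsIso.inv_hom_id, Category.comp_id]

end

/-! ### `Θ` as a modification, and transport of lax naturality. -/

section

variable [D.HasKanExtensions] [D.ClosedMonoidal]

/-- Both laws are checked after composing with the invertible `ΘBackward`, which removes the inverse
from `Θ`. What remains are the corresponding laws for the two halves of the zigzag, both ending in
`t₂_*[t₀^*A, t₂^*B]`. -/
theorem isModification_Θ
    (h : ∀ {I : Type w} [SmallCategory I] [InDia Dia I] (A B : D.obj I), IsIso (D.ΘBackward A B)) :
    D.IsModification (F := D.source) (G := D.target) D.pullIhom D.pullTarget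
      (fun A B => D.Θ A B) where
  naturality {I} _ _ A A' B B' f g := by
    have e : D.ihomMap f g ≫ D.Θ A' B' = D.Θ A B ≫ biMap (D.target I) f g := by
      rw [← cancel_mono (D.ΘBackward A' B'), Category.assoc, Θ_comp_ΘBackward, Category.assoc,
        biMap_target_comp_ΘBackward, ← Category.assoc, Θ_comp_ΘBackward, ΘForward_naturality]
    exact e
  compatibility {I' I} _ _ _ _ u A B := by
    have e : (D.pull u).map (D.Θ A B) ≫ D.pullTarget u A B =
        D.pullIhom u A B ≫ D.Θ ((D.pull u).obj A) ((D.pull u).obj B) := by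
      rw [← cancel_mono (D.ΘBackward ((D.pull u).obj A) ((D.pull u).obj B)), Category.assoc,
        pullTarget_comp_ΘBackward, Category.assoc, Θ_comp_ΘBackward, pullIhom_comp_ΘForward,
        ← Category.assoc, ← Functor.map_comp, Θ_comp_ΘBackward]
    exact e

end

/-- Lax naturality is transported along an invertible modification. -/
theorem IsModification.isLaxNatural
    {F G : ∀ (I : Type w) [SmallCategory I] [InDia Dia I], (D.obj I)ᵒᵖ ⥤ D.obj I ⥤ D.obj I}
    {φ : ∀ {I' I : Type w} [SmallCategory I'] [SmallCategory I] [InDia Dia I'] [InDia Dia I]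
      (u : I' ⥤ I) (A B : D.obj I), (D.pull u).obj (((F I).obj (op A)).obj B) ⟶
        ((F I').obj (op ((D.pull u).obj A))).obj ((D.pull u).obj B)}
    {ψ : ∀ {I' I : Type w} [SmallCategory I'] [SmallCategory I] [InDia Dia I'] [InDia Dia I]
      (u : I' ⥤ I) (A B : D.obj I), (D.pull u).obj (((G I).obj (op A)).obj B) ⟶
        ((G I').obj (op ((D.pull u).obj A))).obj ((D.pull u).obj B)}
    {θ : ∀ {I : Type w} [SmallCategory I] [InDia Dia I] (A B : D.obj I),
      ((F I).obj (op A)).obj B ⟶ ((G I).obj (op A)).obj B}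
    (hθ : D.IsModification φ ψ θ)
    (h : ∀ {I : Type w} [SmallCategory I] [InDia Dia I] (A B : D.obj I), IsIso (θ A B))
    (hφ : D.IsLaxNatural F φ) : D.IsLaxNatural G ψ where
  naturality {I' I} _ _ _ _ u A A' B B' f g := by
    -- Precomposition with the invertible `u^*θ` converts each law for `ψ` into the law for `φ`; the
    -- other two fields use the same device.
    rw [← cancel_epi ((D.pull u).map (θ A B)), ← Category.assoc, ← Functor.map_comp,
      ← hθ.naturality, Functor.map_comp, Category.assoc, hθ.compatibility, ← Category.assoc,
      hφ.naturality, Category.assoc, hθ.naturality, ← Category.assoc, ← hθ.compatibility,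
      Category.assoc]
  map_id {I} _ _ A B := by
    rw [← cancel_epi ((D.pull (𝟭 I)).map (θ A B)), ← Category.assoc, hθ.compatibility,
      Category.assoc, ← hθ.naturality, ← Category.assoc, hφ.map_id]
    exact ((D.pullId I).hom.naturality (θ A B)).symm
  map_comp {I'' I' I} _ _ _ _ _ _ v u A B := by
    have e : (D.pull (v ⋙ u)).map (θ A B) ≫ (D.pullComp v u).hom.app _ =
        (D.pullComp v u).hom.app _ ≫ (D.pull v).map ((D.pull u).map (θ A B)) :=
      (D.pullComp v u).hom.naturality (θ A B)
    rw [← cancel_epi ((D.pull (v ⋙ u)).map (θ A B)), ← Category.assoc, hθ.compatibility,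
      Category.assoc, ← hθ.naturality, ← Category.assoc, hφ.map_comp, reassoc_of% e,
      ← Functor.map_comp_assoc, hθ.compatibility, Functor.map_comp, Category.assoc,
      Category.assoc, Category.assoc, hθ.compatibility]
    rfl

end Prederivator

namespace Prederivator

variable {Dia : DiagramCategory.{w}} (D : Prederivator.{w, v, u} Dia)

/-! ### Restriction along adjoint functors -/

section

variable {K L J : Type w} [SmallCategory K] [SmallCategory L] [SmallCategory J]
  [InDia Dia K] [InDia Dia L] [InDia Dia J]

theorem compIso_hom_of_id_comp {z : K ⥤ L} (h : z = 𝟭 K ⋙ z) (A : D.obj L) :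
    (D.compIso h A).hom = (D.pullId K).inv.app ((D.pull z).obj A) := by
  have e : (D.compIso h A).hom = (D.pullComp (𝟭 K) z).hom.app A := D.compIso_hom_rfl (𝟭 K) z A
  have e₁ : D.pull₂ (Functor.leftUnitor z).hom = 𝟙 _ := D.pull₂_id _
  have e₂ := NatTrans.congr_app (D.pullId_comp z) A
  rw [e₁] at e₂
  erw [Category.id_comp] at e₂
  rw [e, ← cancel_mono ((D.pullId K).hom.app ((D.pull z).obj A)), Iso.inv_hom_id_app]
  exact e₂

theorem compIso_hom_of_comp_id {z : K ⥤ L} (h : z = z ⋙ 𝟭 L) (A : D.obj L) :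
    (D.compIso h A).hom = (D.pull z).map ((D.pullId L).inv.app A) := by
  have e : (D.compIso h A).hom = (D.pullComp z (𝟭 L)).hom.app A := D.compIso_hom_rfl z (𝟭 L) A
  have e₁ : D.pull₂ (Functor.rightUnitor z).hom = 𝟙 _ := D.pull₂_id _
  have e₂ := NatTrans.congr_app (D.pullComp_id z) A
  rw [e₁] at e₂
  erw [Category.id_comp] at e₂
  rw [e, ← cancel_mono ((D.pull z).map ((D.pullId L).hom.app A)), ← Functor.map_comp,
    Iso.inv_hom_id_app]
  exact e₂.trans (CategoryTheory.Functor.map_id _ _).symm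

/-- The unit of `h^* ⊣ g^*` for `h ⊣ g`. -/
def pullUnit {h : K ⥤ L} {g : L ⥤ K} (adj : h ⊣ g) (A : D.obj L) :
    A ⟶ (D.pull g).obj ((D.pull h).obj A) :=
  (D.pullId L).inv.app A ≫ (D.pull₂ adj.counit).app A ≫ (D.compIso rfl A).hom

/-- The counit of `h^* ⊣ g^*` for `h ⊣ g`. -/
def pullCounit {h : K ⥤ L} {g : L ⥤ K} (adj : h ⊣ g) (A : D.obj K) :
    (D.pull h).obj ((D.pull g).obj A) ⟶ A :=
  (D.compIso rfl A).inv ≫ (D.pull₂ adj.unit).app A ≫ (D.pullId K).hom.app A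

/-- This is the image under `𝔻` of the left triangle identity of `h ⊣ g`. Reversing 1-cells and
2-cells exchanges the two adjoints twice, so left adjoints remain left adjoints. -/
theorem pull_map_pullUnit_comp_pullCounit {h : K ⥤ L} {g : L ⥤ K} (adj : h ⊣ g) (A : D.obj L) :
    (D.pull h).map (D.pullUnit adj A) ≫ D.pullCounit adj ((D.pull h).obj A) = 𝟙 _ := by
  have e₁ : h = h ⋙ 𝟭 L := rfl
  have e₂ : h = 𝟭 K ⋙ h := rfl
  let θ₁ : h ⋙ g ⋙ h ⟶ h := Functor.whiskerLeft h adj.counit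
  let θ₂ : h ⟶ h ⋙ g ⋙ h := Functor.whiskerRight adj.unit h
  have h₁ := D.pull₂_app_comp_compIso_of_whiskerLeft rfl e₁ adj.counit θ₁
    (by ext X; exact ((Category.id_comp _).trans (Category.comp_id _)).symm) A
  have e₃ : h ⋙ g ⋙ h = (h ⋙ g) ⋙ h := rfl
  have h₂ := D.pull₂_app_comp_compIso_of_whiskerRight e₂ e₃ adj.unit θ₂
    (by ext X; exact ((Category.id_comp _).trans (Category.comp_id _)).symm) A
  have h₃ : θ₂ ≫ θ₁ = 𝟙 h := by ext X; exact adj.left_triangle_components X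
  rw [pullUnit, pullCounit, Functor.map_comp, ← D.compIso_hom_of_comp_id e₁, Functor.map_comp,
    Category.assoc, Category.assoc, ← reassoc_of% h₁,
    ← reassoc_of% (D.compIso_assoc e₃ rfl rfl rfl A), Iso.hom_inv_id_assoc, ← reassoc_of% h₂,
    D.compIso_hom_of_id_comp e₂, Iso.inv_hom_id_app]
  have h₄ := NatTrans.congr_app (D.pull₂_comp θ₂ θ₁) A
  rw [h₃, D.pull₂_id] at h₄
  exact (congrArg (_ ≫ ·) (Category.comp_id _)).trans h₄.symm

theorem pullUnit_comp_pull_map_pullCounit {h : K ⥤ L} {g : L ⥤ K} (adj : h ⊣ g) (A : D.obj K) :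
    D.pullUnit adj ((D.pull g).obj A) ≫ (D.pull g).map (D.pullCounit adj A) = 𝟙 _ := by
  have e₁ : g = g ⋙ 𝟭 K := rfl
  have e₂ : g = 𝟭 L ⋙ g := rfl
  have e₃ : g ⋙ h ⋙ g = (g ⋙ h) ⋙ g := rfl
  let θ₁ : (g ⋙ h) ⋙ g ⟶ g := Functor.whiskerRight adj.counit g
  let θ₂ : g ⟶ (g ⋙ h) ⋙ g := Functor.whiskerLeft g adj.unit
  have h₁ := D.pull₂_app_comp_compIso_of_whiskerLeft e₁ e₃.symm adj.unit θ₂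
    (by ext X; exact ((Category.id_comp _).trans (Category.comp_id _)).symm) A
  have h₂ := D.pull₂_app_comp_compIso_of_whiskerRight rfl e₂ adj.counit θ₁
    (by ext X; exact ((Category.id_comp _).trans (Category.comp_id _)).symm) A
  have h₃ : θ₂ ≫ θ₁ = 𝟙 g := by ext X; exact adj.right_triangle_components X
  have h₄ := NatTrans.congr_app (D.pull₂_comp θ₂ θ₁) A
  rw [h₃, D.pull₂_id] at h₄
  have h₅ : (D.pull g).map ((D.pullId K).hom.app A) = (D.compIso e₁ A).inv := by
    rw [← cancel_epi (D.compIso e₁ A).hom, Iso.hom_inv_id, D.compIso_hom_of_comp_id e₁,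
      ← Functor.map_comp, Iso.inv_hom_id_app, CategoryTheory.Functor.map_id]
    rfl
  rw [pullUnit, pullCounit, ← D.compIso_hom_of_id_comp e₂, Functor.map_comp, Functor.map_comp,
    Category.assoc, Category.assoc, ← reassoc_of% h₂,
    reassoc_of% (D.compIso_hom_comp_map_inv rfl rfl e₃.symm rfl A), Iso.hom_inv_id_assoc, h₅,
    ← reassoc_of% h₁, Iso.hom_inv_id, Category.comp_id]
  exact h₄.symm

/-- An adjunction `h ⊣ g` induces an adjunction `h^* ⊣ g^*`. -/
def pullAdj {h : K ⥤ L} {g : L ⥤ K} (adj : h ⊣ g) : D.pull h ⊣ D.pull g :=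
  Adjunction.mkOfUnitCounit
    { unit :=
        { app A := D.pullUnit adj A
          naturality A B f := by
            have h₁ := (D.pullId L).inv.naturality f
            have h₂ := (D.pull₂ adj.counit).naturality f
            dsimp only [Functor.id_obj, Functor.id_map, Functor.comp_obj, Functor.comp_map] at h₁ h₂ ⊢
            rw [pullUnit, reassoc_of% h₁, reassoc_of% h₂, compIso_hom_naturality, pullUnit]
            simp only [Category.assoc] }
      counit :=
        { app A := D.pullCounit adj A
          naturality A B f := by
            have h₁ := (D.pullId K).hom.naturality f
            have h₂ := (D.pull₂ adj.unit).naturality f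
            dsimp only [Functor.id_obj, Functor.id_map, Functor.comp_obj, Functor.comp_map] at h₁ h₂ ⊢
            rw [pullCounit, compIso_inv_naturality_assoc, reassoc_of% h₂, h₁, pullCounit]
            simp only [Category.assoc] }
      left_triangle := by
        ext A
        simpa using D.pull_map_pullUnit_comp_pullCounit adj A
      right_triangle := by
        ext A
        simpa using D.pullUnit_comp_pull_map_pullCounit adj A }

end

end Prederivator

/-- The functor from `K` to the terminal category. -/
abbrev toPoint (K : Type w) [SmallCategory K] : K ⥤ Discrete PUnit.{w + 1} :=
  Functor.star.{w, w, w} K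

theorem toPoint_hom_ext {K : Type w} [SmallCategory K] {F G : K ⥤ Discrete PUnit.{w + 1}}
    (α β : F ⟶ G) : α = β := by
  ext X
  exact Subsingleton.elim _ _

theorem fromPUnit_comp {K J : Type w} [SmallCategory K] [SmallCategory J] (u : K ⥤ J) (k : K) :
    Functor.fromPUnit.{w} (u.obj k) = Functor.fromPUnit.{w} k ⋙ u := by
  refine CategoryTheory.Functor.ext (fun _ => rfl) ?_
  intro X Y f
  simp

namespace Prederivator

variable {Dia : DiagramCategory.{w}} (D : Prederivator.{w, v, u} Dia)

/-! ### Universal arrows -/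

section

variable [D.HasKanExtensions]
variable {K L J : Type w} [SmallCategory K] [SmallCategory L] [SmallCategory J]
  [InDia Dia K] [InDia Dia L] [InDia Dia J]

/-- The universal map `A ⟶ w^* w_# A`. -/
def sharpη (w : K ⥤ L) (A : D.obj K) : A ⟶ (D.pull w).obj ((D.sharp w).obj A) :=
  (D.sharpAdj w).unit.app A

/-- The map out of `w_# A` corresponding to a map `A ⟶ w^*B`. -/
def fromSharp (w : K ⥤ L) {A : D.obj K} {B : D.obj L} (f : A ⟶ (D.pull w).obj B) :
    (D.sharp w).obj A ⟶ B :=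
  ((D.sharpAdj w).homEquiv _ _).symm f

theorem fromSharp_fac (w : K ⥤ L) {A : D.obj K} {B : D.obj L} (f : A ⟶ (D.pull w).obj B) :
    D.sharpη w A ≫ (D.pull w).map (D.fromSharp w f) = f := by
  have := ((D.sharpAdj w).homEquiv A B).apply_symm_apply f
  rwa [Adjunction.homEquiv_unit] at this

theorem sharp_hom_ext {w : K ⥤ L} {A : D.obj K} {B : D.obj L} {f g : (D.sharp w).obj A ⟶ B}
    (h : D.sharpη w A ≫ (D.pull w).map f = D.sharpη w A ≫ (D.pull w).map g) : f = g := by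
  apply ((D.sharpAdj w).homEquiv _ _).injective
  rw [Adjunction.homEquiv_unit, Adjunction.homEquiv_unit]
  exact h

theorem sharpη_naturality (w : K ⥤ L) {A A' : D.obj K} (f : A ⟶ A') :
    f ≫ D.sharpη w A' = D.sharpη w A ≫ (D.pull w).map ((D.sharp w).map f) :=
  (D.sharpAdj w).unit.naturality f

/-- The arrow `η : A ⟶ w^*B` exhibits `B` as `w_# A`. -/
def IsUniversal (w : K ⥤ L) {A : D.obj K} {B : D.obj L} (η : A ⟶ (D.pull w).obj B) : Prop :=
  IsIso (D.fromSharp w η)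

variable {D}

theorem isUniversal_sharpη (w : K ⥤ L) (A : D.obj K) : D.IsUniversal w (D.sharpη w A) := by
  have : D.fromSharp w (D.sharpη w A) = 𝟙 _ := by
    apply D.sharp_hom_ext
    rw [fromSharp_fac, CategoryTheory.Functor.map_id, Category.comp_id]
  rw [IsUniversal, this]
  infer_instance

/-- This turns invertibility questions into universality questions: a map is invertible as soon as
it carries one universal arrow to another. -/
theorem isUniversal_comp_map_iff {w : K ⥤ L} {A : D.obj K} {B B' : D.obj L}
    {η : A ⟶ (D.pull w).obj B} (hη : D.IsUniversal w η) (f : B ⟶ B') :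
    D.IsUniversal w (η ≫ (D.pull w).map f) ↔ IsIso f := by
  have : D.fromSharp w (η ≫ (D.pull w).map f) = D.fromSharp w η ≫ f := by
    apply D.sharp_hom_ext
    rw [fromSharp_fac, Functor.map_comp, ← Category.assoc, fromSharp_fac]
  have : IsIso (D.fromSharp w η) := hη
  rw [IsUniversal, ‹D.fromSharp w (η ≫ _) = _›, isIso_comp_left_iff]

theorem isUniversal_iso_comp_iff {w : K ⥤ L} {A A' : D.obj K} {B : D.obj L}
    (η : A ⟶ (D.pull w).obj B) (f : A' ⟶ A) [IsIso f] :
    D.IsUniversal w (f ≫ η) ↔ D.IsUniversal w η := by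
  have : D.fromSharp w (f ≫ η) = (D.sharp w).map f ≫ D.fromSharp w η := by
    apply D.sharp_hom_ext
    rw [fromSharp_fac, Functor.map_comp, ← Category.assoc, ← sharpη_naturality, Category.assoc,
      fromSharp_fac]
  rw [IsUniversal, this, isIso_comp_left_iff, IsUniversal]

/-- The Yoneda form, free of `w_#`; it allows universality for different functors to be compared
through adjunction bijections. -/
theorem isUniversal_iff_bijective {w : K ⥤ L} {A : D.obj K} {B : D.obj L}
    (η : A ⟶ (D.pull w).obj B) : D.IsUniversal w η ↔
      ∀ C : D.obj L, Function.Bijective (fun f : B ⟶ C => η ≫ (D.pull w).map f) := by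
  have e (C : D.obj L) : (fun f : B ⟶ C => η ≫ (D.pull w).map f) =
      (D.sharpAdj w).homEquiv A C ∘ (fun f : B ⟶ C => D.fromSharp w η ≫ f) := by
    funext f
    dsimp only [Function.comp_apply]
    rw [Adjunction.homEquiv_unit, Functor.map_comp, ← Category.assoc]
    exact congrArg (· ≫ _) (D.fromSharp_fac w η).symm
  constructor
  · intro h C
    have : IsIso (D.fromSharp w η) := h
    rw [e]
    refine (Equiv.bijective _).comp ⟨fun a b h => (cancel_epi _).1 h, fun b =>
      ⟨inv (D.fromSharp w η) ≫ b, ?_⟩⟩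
    dsimp only
    rw [IsIso.hom_inv_id_assoc]
  · intro h
    apply isIso_of_coyoneda_map_bijective
    intro C
    have := h C
    rw [e] at this
    exact (Equiv.comp_bijective _ _).1 this

/-- The arrow `ε : w^*B ⟶ A` exhibits `B` as `w_* A`. -/
def IsCouniversal (D : Prederivator.{w, v, u} Dia) [D.HasKanExtensions] (w : K ⥤ L) {A : D.obj K}
    {B : D.obj L} (ε : (D.pull w).obj B ⟶ A) : Prop :=
  IsIso (D.toStar w ε)

theorem isCouniversal_map_comp_iff {w : K ⥤ L} {A : D.obj K} {B B' : D.obj L}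
    {ε : (D.pull w).obj B ⟶ A} (hε : D.IsCouniversal w ε) (f : B' ⟶ B) :
    D.IsCouniversal w ((D.pull w).map f ≫ ε) ↔ IsIso f := by
  have : D.toStar w ((D.pull w).map f ≫ ε) = f ≫ D.toStar w ε := by
    apply D.star_hom_ext
    rw [toStar_fac, Functor.map_comp, Category.assoc, toStar_fac]
  have : IsIso (D.toStar w ε) := hε
  rw [IsCouniversal, ‹D.toStar w (_ ≫ ε) = _›, isIso_comp_right_iff]

theorem isCouniversal_comp_iso_iff {w : K ⥤ L} {A A' : D.obj K} {B : D.obj L}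
    (ε : (D.pull w).obj B ⟶ A) (f : A ⟶ A') [IsIso f] :
    D.IsCouniversal w (ε ≫ f) ↔ D.IsCouniversal w ε := by
  have : D.toStar w (ε ≫ f) = D.toStar w ε ≫ (D.star w).map f := by
    apply D.star_hom_ext
    rw [toStar_fac, Functor.map_comp, Category.assoc, star_map_fac, ← Category.assoc, toStar_fac]
  rw [IsCouniversal, this, isIso_comp_right_iff, IsCouniversal]

theorem isCouniversal_iff_bijective {w : K ⥤ L} {A : D.obj K} {B : D.obj L}
    (ε : (D.pull w).obj B ⟶ A) : D.IsCouniversal w ε ↔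
      ∀ C : D.obj L, Function.Bijective (fun f : C ⟶ B => (D.pull w).map f ≫ ε) := by
  have e (C : D.obj L) : (fun f : C ⟶ B => (D.pull w).map f ≫ ε) =
      ((D.starAdj w).homEquiv C A).symm ∘ (fun f : C ⟶ B => f ≫ D.toStar w ε) := by
    funext f
    dsimp only [Function.comp_apply]
    rw [Adjunction.homEquiv_counit, Functor.map_comp, Category.assoc]
    exact congrArg (_ ≫ ·) (D.toStar_fac w ε).symm
  constructor
  · intro h C
    have : IsIso (D.toStar w ε) := h
    rw [e]
    refine (Equiv.bijective _).comp ⟨fun a b h => (cancel_mono _).1 h, fun b =>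
      ⟨b ≫ inv (D.toStar w ε), ?_⟩⟩
    dsimp only
    rw [Category.assoc, IsIso.inv_hom_id, Category.comp_id]
  · intro h
    apply isIso_of_yoneda_map_bijective
    intro C
    have := h C
    rw [e] at this
    exact (Equiv.comp_bijective _ _).1 this

/-- Universal arrows over the point are preserved by restriction along left adjoints. -/
theorem IsUniversal.pull {h : K ⥤ L} [h.IsLeftAdjoint] {A : D.obj L}
    {B : D.obj (Discrete PUnit.{w + 1})} {η : A ⟶ (D.pull (toPoint L)).obj B}
    (hη : D.IsUniversal (toPoint L) η) (e : toPoint K = h ⋙ toPoint L) :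
    D.IsUniversal (toPoint K) ((D.pull h).map η ≫ (D.compIso e B).inv) := by
  let g := h.rightAdjoint
  let adj : h ⊣ g := Adjunction.ofIsLeftAdjoint h
  rw [isUniversal_iff_bijective] at hη ⊢
  intro C
  have e₁ : toPoint L = (g ⋙ h) ⋙ toPoint L := rfl
  have e₂ : toPoint L = g ⋙ toPoint K := rfl
  have e₃ : toPoint L = 𝟭 L ⋙ toPoint L := rfl
  -- On objects pulled back from the point, the unit of `h^* ⊣ g^*` is the canonical identification:
  -- the whiskered counit is a 2-cell between functors to the point, hence an identity.
  have key : D.pullUnit adj ((D.pull (toPoint L)).obj C) =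
      (D.compIso e₂ C).hom ≫ (D.pull g).map (D.compIso e C).hom := by
    have h₁ := D.pull₂_app_comp_compIso_of_whiskerRight e₁ e₃ adj.counit (𝟙 _)
      (toPoint_hom_ext _ _) C
    rw [D.pull₂_id] at h₁
    have h₂ : (D.compIso e₁ C).hom =
      (D.compIso e₃ C).hom ≫ (D.pull₂ adj.counit).app ((D.pull (toPoint L)).obj C) :=
        (Category.id_comp _).symm.trans h₁
    rw [pullUnit, ← D.compIso_hom_of_id_comp e₃, ← D.compIso_assoc e₁ rfl e₂ e, h₂,
      Category.assoc]
  -- Therefore `h^*` is bijective on maps into such objects: followed by the adjunction bijection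
  -- and the identification, it gives back `f`.
  have hb : Function.Bijective (fun f : A ⟶ (D.pull (toPoint L)).obj C =>
      (D.pull h).map f ≫ (D.compIso e C).inv) := by
    have : (fun f : A ⟶ (D.pull (toPoint L)).obj C => f) =
        (fun f => f ≫ (D.compIso e₂ C).inv) ∘ (D.pullAdj adj).homEquiv _ _ ∘
          (fun f : A ⟶ (D.pull (toPoint L)).obj C => (D.pull h).map f ≫ (D.compIso e C).inv) := by
      funext f
      have h₁ : f ≫ D.pullUnit adj _ = D.pullUnit adj _ ≫ _ := (D.pullAdj adj).unit.naturality f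
      have h₂ : ((D.pullAdj adj).homEquiv _ _) ((D.pull h).map f ≫ (D.compIso e C).inv) =
          D.pullUnit adj A ≫ (D.pull g).map ((D.pull h).map f ≫ (D.compIso e C).inv) :=
        Adjunction.homEquiv_unit _ _ _ _
      dsimp only [Function.comp_apply]
      rw [h₂, Functor.map_comp, Category.assoc, Category.assoc]
      refine Eq.trans ?_ ((congrArg (· ≫ _) h₁).trans (Category.assoc _ _ _))
      rw [key]
      simp only [Category.assoc]
      rw [← Functor.map_comp_assoc, Iso.hom_inv_id, CategoryTheory.Functor.map_id,
        Category.id_comp, Iso.hom_inv_id, Category.comp_id]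
    have hb : Function.Bijective ((fun f => f ≫ (D.compIso e₂ C).inv) ∘
        (D.pullAdj adj).homEquiv A _) :=
      (show Function.Bijective (fun f : A ⟶ _ => f ≫ (D.compIso e₂ C).inv) from
        (Iso.homToEquiv (D.compIso e₂ C).symm).bijective).comp (Equiv.bijective _)
    rw [← Function.comp_assoc] at this
    exact (Function.Bijective.of_comp_iff' hb _).1 (this ▸ Function.bijective_id)
  refine (Eq.subst ?_ (hb.comp (hη C)))
  funext f
  dsimp only [Function.comp_apply]
  rw [Functor.map_comp, Category.assoc, Category.assoc, compIso_inv_naturality]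

/-- Couniversal arrows over the point are preserved by restriction along right adjoints. -/
theorem IsCouniversal.pull {h : K ⥤ L} [h.IsRightAdjoint] {A : D.obj L}
    {B : D.obj (Discrete PUnit.{w + 1})} {ε : (D.pull (toPoint L)).obj B ⟶ A}
    (hε : D.IsCouniversal (toPoint L) ε) (e : toPoint K = h ⋙ toPoint L) :
    D.IsCouniversal (toPoint K) ((D.compIso e B).hom ≫ (D.pull h).map ε) := by
  let g := h.leftAdjoint
  let adj : g ⊣ h := Adjunction.ofIsRightAdjoint h
  rw [isCouniversal_iff_bijective] at hε ⊢
  intro C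
  have e₁ : toPoint L = (g ⋙ h) ⋙ toPoint L := rfl
  have e₂ : toPoint L = g ⋙ toPoint K := rfl
  have e₃ : toPoint L = 𝟭 L ⋙ toPoint L := rfl
  -- Dually, the counit of `g^* ⊣ h^*` is the canonical identification on objects pulled back from
  -- the point.
  have key : (D.compIso e₂ C).hom ≫ (D.pull g).map (D.compIso e C).hom ≫
      D.pullCounit adj ((D.pull (toPoint L)).obj C) = 𝟙 _ := by
    have h₁ := D.pull₂_app_comp_compIso_of_whiskerRight e₃ e₁ adj.unit (𝟙 _)
      (toPoint_hom_ext _ _) C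
    rw [D.pull₂_id] at h₁
    have h₂ : (D.compIso e₃ C).hom =
      (D.compIso e₁ C).hom ≫ (D.pull₂ adj.unit).app ((D.pull (toPoint L)).obj C) :=
        (Category.id_comp _).symm.trans h₁
    rw [pullCounit, ← Category.assoc, ← D.compIso_assoc e₁ rfl e₂ e, Category.assoc,
      Iso.hom_inv_id_assoc, ← Category.assoc, ← h₂, D.compIso_hom_of_id_comp e₃]
    exact Iso.inv_hom_id_app _ _
  have hb : Function.Bijective (fun f : (D.pull (toPoint L)).obj C ⟶ A =>
      (D.compIso e C).hom ≫ (D.pull h).map f) := by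
    have : (fun f : (D.pull (toPoint L)).obj C ⟶ A => f) =
        (fun f => (D.compIso e₂ C).hom ≫ f) ∘ ((D.pullAdj adj).homEquiv _ _).symm ∘
          (fun f : (D.pull (toPoint L)).obj C ⟶ A =>
            (D.compIso e C).hom ≫ (D.pull h).map f) := by
      funext f
      have h₁ : _ ≫ D.pullCounit adj _ = D.pullCounit adj _ ≫ f :=
        (D.pullAdj adj).counit.naturality f
      have h₂ : ((D.pullAdj adj).homEquiv _ _).symm ((D.compIso e C).hom ≫ (D.pull h).map f) =
          (D.pull g).map ((D.compIso e C).hom ≫ (D.pull h).map f) ≫ D.pullCounit adj A :=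
        Adjunction.homEquiv_counit _ _ _ _
      dsimp only [Function.comp_apply]
      rw [h₂, Functor.map_comp, Category.assoc]
      refine Eq.trans ?_ (congrArg (fun k => _ ≫ _ ≫ k) h₁.symm)
      rw [reassoc_of% key]
    have hb : Function.Bijective ((fun f => (D.compIso e₂ C).hom ≫ f) ∘
        ((D.pullAdj adj).homEquiv _ A).symm) :=
      (show Function.Bijective (fun f : _ ⟶ A => (D.compIso e₂ C).hom ≫ f) from
        (Iso.homFromEquiv (D.compIso e₂ C).symm).bijective).comp (Equiv.bijective _)
    rw [← Function.comp_assoc] at this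
    exact (Function.Bijective.of_comp_iff' hb _).1 (this ▸ Function.bijective_id)
  refine (Eq.subst ?_ (hb.comp (hε C)))
  funext f
  dsimp only [Function.comp_apply]
  rw [Functor.map_comp, compIso_hom_naturality_assoc]

end

end Prederivator

namespace Prederivator

variable {Dia : DiagramCategory.{w}} (D : Prederivator.{w, v, u} Dia)

/-! ### Pointwise Kan extensions -/

section

variable {P Q K L J : Type w} [SmallCategory P] [SmallCategory Q] [SmallCategory K]
  [SmallCategory L] [SmallCategory J] [InDia Dia P] [InDia Dia Q] [InDia Dia K] [InDia Dia L]
  [InDia Dia J]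

theorem pullSquare_app {w : P ⥤ K} {v : P ⥤ L} {u : K ⥤ J} {x : L ⥤ J} (α : v ⋙ x ⟶ w ⋙ u)
    (A : D.obj J) :
    (D.pullSquare α).app A =
      (D.compIso rfl A).inv ≫ (D.pull₂ α).app A ≫ (D.compIso rfl A).hom := by
  rw [compIso_hom_rfl, compIso_inv_rfl]
  rfl

theorem pullSquare_naturality {w : P ⥤ K} {v : P ⥤ L} {u : K ⥤ J} {x : L ⥤ J}
    (α : v ⋙ x ⟶ w ⋙ u) {A B : D.obj J} (f : A ⟶ B) :
    (D.pull w).map ((D.pull u).map f) ≫ (D.pullSquare α).app B =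
      (D.pullSquare α).app A ≫ (D.pull v).map ((D.pull x).map f) :=
  (D.pullSquare α).naturality f

/-- Restriction of a square along a functor. -/
theorem compIso_comp_map_pullSquare {w : P ⥤ K} {v : P ⥤ L} {u : K ⥤ J} {x : L ⥤ J}
    (α : v ⋙ x ⟶ w ⋙ u) (h : Q ⥤ P) {w' : Q ⥤ K} {v' : Q ⥤ L} (ew : w' = h ⋙ w)
    (ev : v' = h ⋙ v) (α' : v' ⋙ x ⟶ w' ⋙ u)
    (hα : α' = eqToHom (by rw [ev]; rfl) ≫ Functor.whiskerLeft h α ≫ eqToHom (by rw [ew]; rfl))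
    (A : D.obj J) :
    (D.compIso ew ((D.pull u).obj A)).hom ≫ (D.pull h).map ((D.pullSquare α).app A) =
      (D.pullSquare α').app A ≫ (D.compIso ev ((D.pull x).obj A)).hom := by
  have e₁ : w' ⋙ u = h ⋙ w ⋙ u := by rw [ew]; rfl
  have e₂ : v' ⋙ x = h ⋙ v ⋙ x := by rw [ev]; rfl
  have h₁ := D.pull₂_app_comp_compIso_of_whiskerLeft e₂ e₁ α α' hα A
  rw [pullSquare_app, pullSquare_app, Functor.map_comp, Functor.map_comp,
    reassoc_of% (D.compIso_hom_comp_map_inv rfl ew e₁ rfl A), ← reassoc_of% h₁,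
    ← D.compIso_assoc rfl ev e₂ rfl]
  simp only [Category.assoc]

/-- Pasting of squares. -/
theorem pullSquare_comp_map_pullSquare {w : P ⥤ K} {v : P ⥤ L} {u : K ⥤ J} {x : L ⥤ J}
    (α : v ⋙ x ⟶ w ⋙ u) {R M : Type w} [SmallCategory R] [SmallCategory M] [InDia Dia R]
    [InDia Dia M] {s : R ⥤ P} {p : R ⥤ M} {k : M ⥤ K} (β : s ⋙ w ⟶ p ⋙ k) {k' : M ⥤ J}
    (ek : k' = k ⋙ u) {y : R ⥤ L} (ey : y = s ⋙ v) (θ : y ⋙ x ⟶ p ⋙ k')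
    (hθ : θ = eqToHom (by rw [ey]; rfl) ≫ Functor.whiskerLeft s α ≫
      Functor.whiskerRight β u ≫ eqToHom (by rw [ek]; rfl)) (A : D.obj J) :
    (D.pull p).map (D.compIso ek A).hom ≫ (D.pullSquare β).app ((D.pull u).obj A) ≫
        (D.pull s).map ((D.pullSquare α).app A) =
      (D.pullSquare θ).app A ≫ (D.compIso ey ((D.pull x).obj A)).hom := by
  have e₁ : p ⋙ k' = (p ⋙ k) ⋙ u := by rw [ek]; rfl
  have e₂ : y ⋙ x = s ⋙ v ⋙ x := by rw [ey]; rfl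
  have e₃ : (s ⋙ w) ⋙ u = s ⋙ w ⋙ u := rfl
  have h₁ := D.pull₂_app_comp_compIso_of_whiskerRight rfl e₁ β
    (Functor.whiskerRight β u ≫ eqToHom e₁.symm) (by rw [eqToHom_refl, Category.id_comp]) A
  have h₂ := D.pull₂_app_comp_compIso_of_whiskerLeft e₂ e₃ α
    (eqToHom e₂ ≫ Functor.whiskerLeft s α) (by rw [eqToHom_refl, Category.comp_id]) A
  have h₃ := NatTrans.congr_app (D.pull₂_comp (eqToHom e₂ ≫ Functor.whiskerLeft s α)
    (Functor.whiskerRight β u ≫ eqToHom e₁.symm)) A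
  have h₄ : (eqToHom e₂ ≫ Functor.whiskerLeft s α) ≫
    (Functor.whiskerRight β u ≫ eqToHom e₁.symm) = θ := by rw [hθ, Category.assoc]
  rw [h₄] at h₃
  have h₅ : (D.pull p).map (D.compIso ek A).hom ≫ (D.compIso rfl ((D.pull u).obj A)).inv =
      (D.compIso (rfl : p ⋙ k' = _) A).inv ≫ (D.compIso e₁ A).hom := by
    rw [← cancel_epi (D.compIso (rfl : p ⋙ k' = _) A).hom, Iso.hom_inv_id_assoc,
      D.compIso_hom_comp_map_hom e₁ rfl rfl ek]
  rw [pullSquare_app, pullSquare_app, pullSquare_app]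
  simp only [Functor.map_comp, Category.assoc]
  rw [reassoc_of% h₅, ← reassoc_of% h₁,
    reassoc_of% (D.compIso_hom_comp_map_inv rfl rfl e₃ rfl A)]
  rw [Iso.hom_inv_id_assoc, ← reassoc_of% h₂, ← D.compIso_assoc rfl ey e₂ rfl, h₃]
  simp only [NatTrans.comp_app, Category.assoc]

variable [D.HasKanExtensions]

theorem sharpη_comp_bcSharp {w : P ⥤ K} {v : P ⥤ L} {u : K ⥤ J} {x : L ⥤ J}
    (α : v ⋙ x ⟶ w ⋙ u) (A : D.obj K) :
    D.sharpη v ((D.pull w).obj A) ≫ (D.pull v).map ((D.bcSharp α).app A) =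
      (D.pull w).map (D.sharpη u A) ≫ (D.pullSquare α).app _ :=
  (unit_mateEquiv_symm (D.sharpAdj u) (D.sharpAdj v)
    (TwoSquare.mk (D.pull u) (D.pull x) (D.pull w) (D.pull v) (D.pullSquare α)) A).symm

end

section

variable {K L J F : Type w} [SmallCategory K] [SmallCategory L] [SmallCategory J]
  [SmallCategory F] [InDia Dia K] [InDia Dia L] [InDia Dia J] [InDia Dia F]

section

variable [D.HasKanExtensions]

/-- The map `t^*A ⟶ p^* j^* u_# A` for the comma category `j \ K`. -/
def underMap (u : K ⥤ J) (j : J) (A : D.obj K) :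
    (D.pull (StructuredArrow.proj j u)).obj A ⟶ (D.pull (toPoint (StructuredArrow j u))).obj
      ((D.pull (Functor.fromPUnit.{w} j)).obj ((D.sharp u).obj A)) :=
  (D.pull (StructuredArrow.proj j u)).map (D.sharpη u A) ≫ (D.pullSquare (underCell u j)).app _

/-- The map `p^* j^* u_* A ⟶ s^*A` for the comma category `K / j`. -/
def overMap (u : K ⥤ J) (j : J) (A : D.obj K) :
    (D.pull (toPoint (CostructuredArrow u j))).obj
      ((D.pull (Functor.fromPUnit.{w} j)).obj ((D.star u).obj A)) ⟶
      (D.pull (CostructuredArrow.proj u j)).obj A :=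
  (D.pullSquare (overCell u j)).app _ ≫ (D.pull (CostructuredArrow.proj u j)).map (D.starε u A)

/-- The map `ι^*A ⟶ p^* j^* u_# A` for a functor `ι : F ⥤ K` which `u` maps to `j`. -/
def fibreMap {u : K ⥤ J} {j : J} {ι : F ⥤ K} (h : toPoint F ⋙ Functor.fromPUnit.{w} j = ι ⋙ u)
    (A : D.obj K) : (D.pull ι).obj A ⟶ (D.pull (toPoint F)).obj
      ((D.pull (Functor.fromPUnit.{w} j)).obj ((D.sharp u).obj A)) :=
  (D.pull ι).map (D.sharpη u A) ≫ (D.pullSquare (eqToHom h)).app _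

theorem fibreMap_comp {u : K ⥤ J} {j : J} {ι : F ⥤ K}
    (h : toPoint F ⋙ Functor.fromPUnit.{w} j = ι ⋙ u) {A : D.obj K} {B : D.obj J}
    (f : (D.sharp u).obj A ⟶ B) :
    D.fibreMap h A ≫ (D.pull (toPoint F)).map ((D.pull (Functor.fromPUnit.{w} j)).map f) =
      (D.pull ι).map (D.sharpη u A ≫ (D.pull u).map f) ≫
        (D.pullSquare (eqToHom h)).app B := by
  rw [fibreMap, Category.assoc, ← pullSquare_naturality, ← Category.assoc, ← Functor.map_comp]

end

variable [D.IsDerivator]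

/-- The pointwise axiom for `u_#`, restated: the map out of `p_#` that `underMap` induces is the
Beck-Chevalley map. -/
theorem isUniversal_underMap (u : K ⥤ J) (j : J) (A : D.obj K) :
    D.IsUniversal _ (D.underMap u j A) := by
  have : D.fromSharp _ (D.underMap u j A) = (D.bcSharp (underCell u j)).app A := by
    apply D.sharp_hom_ext
    rw [fromSharp_fac]
    exact (D.sharpη_comp_bcSharp (underCell u j) A).symm
  have := IsDerivator.isIso_bcSharp (D := D) u j
  rw [IsUniversal, ‹D.fromSharp _ _ = _›]
  infer_instance

theorem isCouniversal_overMap (u : K ⥤ J) (j : J) (A : D.obj K) :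
    D.IsCouniversal _ (D.overMap u j A) := by
  have : D.toStar _ (D.overMap u j A) = (D.bcStar (overCell u j)).app A := by
    apply D.star_hom_ext
    rw [toStar_fac]
    exact (D.bcStar_fac (overCell u j) A).symm
  have := IsDerivator.isIso_bcStar (D := D) u j
  rw [IsCouniversal, ‹D.toStar _ _ = _›]
  infer_instance

/-- The fibre map is universal if the fibre is included in `j \ K` by a left adjoint functor. -/
theorem isUniversal_fibreMap {u : K ⥤ J} {j : J} {ι : F ⥤ K}
    (h : toPoint F ⋙ Functor.fromPUnit.{w} j = ι ⋙ u) (i : F ⥤ StructuredArrow j u)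
    [i.IsLeftAdjoint] (e : ι = i ⋙ StructuredArrow.proj j u)
    (hi : eqToHom h = eqToHom rfl ≫ Functor.whiskerLeft i (underCell u j) ≫
      eqToHom (by rw [e]; rfl)) (A : D.obj K) :
    D.IsUniversal _ (D.fibreMap h A) := by
  have ep : toPoint F = i ⋙ toPoint (StructuredArrow j u) := rfl
  have h₁ := D.compIso_comp_map_pullSquare (underCell u j) i e ep
    (eqToHom h) hi ((D.sharp u).obj A)
  -- Up to identifications `fibreMap` is `underMap` restricted along `i`, and restriction along a
  -- left adjoint preserves universality over the point.
  have h₂ : D.fibreMap h A = (D.compIso e A).hom ≫ (D.pull i).map (D.underMap u j A) ≫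
      (D.compIso ep _).inv := by
    rw [underMap, Functor.map_comp, Category.assoc, ← compIso_hom_naturality_assoc,
      reassoc_of% h₁, Iso.hom_inv_id, Category.comp_id, fibreMap]
  rw [h₂, isUniversal_iso_comp_iff]
  exact (D.isUniversal_underMap u j A).pull ep

end

end Prederivator

namespace Prederivator

open Functor.LaxMonoidal MonoidalClosed

variable {Dia : DiagramCategory.{w}} (D : Prederivator.{w, v, u} Dia)

/-! ### The projection formula -/

section

variable [D.ClosedMonoidal]
variable {P K L J : Type w} [SmallCategory P] [SmallCategory K] [SmallCategory L]
  [SmallCategory J] [InDia Dia P] [InDia Dia K] [InDia Dia L] [InDia Dia J]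

/-- The transformation induced by a square is monoidal. -/
theorem μ_comp_pullSquare {w : P ⥤ K} {v : P ⥤ L} {u : K ⥤ J} {x : L ⥤ J} (α : v ⋙ x ⟶ w ⋙ u)
    (A B : D.obj J) :
    μ (D.pull w) _ _ ≫ (D.pull w).map (μ (D.pull u) A B) ≫ (D.pullSquare α).app (A ⊗ B) =
      ((D.pullSquare α).app A ⊗ₘ (D.pullSquare α).app B) ≫
        μ (D.pull v) _ _ ≫ (D.pull v).map (μ (D.pull x) A B) := by
  have h₁ := D.μ_comp_compIso_hom (rfl : w ⋙ u = _) A B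
  have h₂ := D.μ_comp_compIso_hom (rfl : v ⋙ x = _) A B
  have h₃ : μ (D.pull (w ⋙ u)) A B ≫ (D.pull₂ α).app (A ⊗ B) = _ :=
    NatTrans.IsMonoidal.tensor A B
  have h₄ : μ (D.pull w) _ _ ≫ (D.pull w).map (μ (D.pull u) A B) ≫
      (D.compIso (rfl : w ⋙ u = _) (A ⊗ B)).inv =
      ((D.compIso (rfl : w ⋙ u = _) A).inv ⊗ₘ (D.compIso (rfl : w ⋙ u = _) B).inv) ≫
        μ (D.pull (w ⋙ u)) A B := by
    rw [← Category.assoc, Iso.comp_inv_eq, Category.assoc, h₁, ← Category.assoc,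
      MonoidalCategory.tensorHom_comp_tensorHom, Iso.inv_hom_id, Iso.inv_hom_id,
      MonoidalCategory.id_tensorHom_id, Category.id_comp]
  rw [pullSquare_app, pullSquare_app, pullSquare_app, reassoc_of% h₄, reassoc_of% h₃, h₂]
  simp only [← MonoidalCategory.tensorHom_comp_tensorHom, Category.assoc]

instance isIso_pullSquare_eqToHom {w : P ⥤ K} {v : P ⥤ L} {u : K ⥤ J} {x : L ⥤ J}
    (h : v ⋙ x = w ⋙ u) (A : D.obj J) : IsIso ((D.pullSquare (eqToHom h)).app A) := by
  rw [D.pullSquare_eqToHom h h rfl]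
  infer_instance

end

section

variable [D.ClosedMonoidal]
variable {K J : Type w} [SmallCategory K] [SmallCategory J] [InDia Dia K] [InDia Dia J]

/-- The map `u^*A ⊗ B ⟶ u^*(A ⊗ C)` induced by `B ⟶ u^*C`. -/
def tensorOver (u : K ⥤ J) (A : D.obj J) {B : D.obj K} {C : D.obj J} (η : B ⟶ (D.pull u).obj C) :
    (D.pull u).obj A ⊗ B ⟶ (D.pull u).obj (A ⊗ C) :=
  ((D.pull u).obj A ◁ η) ≫ μ (D.pull u) A C

theorem tensorOver_comp_map (u : K ⥤ J) (A : D.obj J) {B : D.obj K} {C C' : D.obj J}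
    (η : B ⟶ (D.pull u).obj C) (f : C ⟶ C') :
    D.tensorOver u A (η ≫ (D.pull u).map f) = D.tensorOver u A η ≫ (D.pull u).map (A ◁ f) := by
  rw [tensorOver, tensorOver, MonoidalCategory.whiskerLeft_comp, Category.assoc, Category.assoc,
    μ_natural_right]

variable [D.HasKanExtensions]

/-- If the projection formula holds, then tensoring preserves universal arrows. -/
theorem isUniversal_tensorOver (u : K ⥤ J) (A : D.obj J) {B : D.obj K} {C : D.obj J}
    {η : B ⟶ (D.pull u).obj C} (hη : D.IsUniversal u η) [IsIso (D.projection u A B)] :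
    D.IsUniversal u (D.tensorOver u A η) := by
  have h₁ : D.IsUniversal u (D.tensorOver u A (D.sharpη u B)) := ‹IsIso (D.projection u A B)›
  have h₂ : D.tensorOver u A η = D.tensorOver u A (D.sharpη u B) ≫
      (D.pull u).map (A ◁ D.fromSharp u η) := by
    rw [← tensorOver_comp_map, fromSharp_fac]
  have : IsIso (D.fromSharp u η) := hη
  rw [h₂, isUniversal_comp_map_iff h₁]
  infer_instance

/-- If the projection formula holds, then `u^*` preserves internal homs. -/
theorem isIso_pullIhom (u : K ⥤ J) (A B : D.obj J) (h : ∀ X, IsIso (D.projection u A X)) :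
    IsIso (D.pullIhom u A B) := by
  apply isIso_of_yoneda_map_bijective
  intro X
  have h₁ := (isUniversal_iff_bijective _).1 (D.isUniversal_tensorOver u A
    (isUniversal_sharpη u X)) B
  let E := ((ihom.adjunction A).homEquiv ((D.sharp u).obj X) B).trans
    ((D.sharpAdj u).homEquiv X ((ihom A).obj B))
  let E' := (ihom.adjunction ((D.pull u).obj A)).homEquiv X ((D.pull u).obj B)
  -- The universal property of `u^*A ⊗ X ⟶ u^*(A ⊗ u_# X)`, transported through the adjunctions `E`
  -- and `E'`, says that composition with `pullIhom` is bijective on maps out of `X`.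
  have h₂ : (fun f : A ⊗ (D.sharp u).obj X ⟶ B =>
      D.tensorOver u A (D.sharpη u X) ≫ (D.pull u).map f) =
      E'.symm ∘ (fun x => x ≫ D.pullIhom u A B) ∘ E := by
    funext f
    have h₃ : E f = D.sharpη u X ≫ (D.pull u).map (curry f) := Adjunction.homEquiv_unit _ _ _ _
    have h₄ : (E'.symm ∘ (fun x => x ≫ D.pullIhom u A B) ∘ E) f =
      uncurry (E f ≫ D.pullIhom u A B) := rfl
    rw [h₄, h₃, Category.assoc, uncurry_natural_left, uncurry_map_pullIhom, uncurry_curry,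
      tensorOver, Category.assoc]
  rw [h₂] at h₁
  exact (Equiv.bijective_comp _ _).1 ((Equiv.comp_bijective _ _).1 h₁)

/-- If the projection formula holds, then `[u_# A, B]` is `u_*[A, u^*B]`. -/
theorem isIso_sharpIhom (u : K ⥤ J) (A : D.obj K) (B : D.obj J)
    (h : ∀ X, IsIso (D.projection u X A)) : IsIso (D.sharpIhom u A B) := by
  apply isIso_of_yoneda_map_bijective
  intro X
  -- The projection formula tensors on the left with objects `u^*X`; the symmetry moves `A` to the
  -- side required for currying.
  have h₀ : D.IsUniversal u ((D.sharpη u A ▷ (D.pull u).obj X) ≫ μ (D.pull u) _ X) := by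
    have h₁ : (D.sharpη u A ▷ (D.pull u).obj X) ≫ μ (D.pull u) _ X =
        (β_ _ _).hom ≫ D.tensorOver u X (D.sharpη u A) ≫ (D.pull u).map (β_ _ _).hom := by
      rw [tensorOver, Category.assoc, Functor.LaxBraided.braided,
        ← BraidedCategory.braiding_naturality_left_assoc, SymmetricCategory.symmetry_assoc]
    rw [h₁, isUniversal_iso_comp_iff, isUniversal_comp_map_iff
      (D.isUniversal_tensorOver u X (isUniversal_sharpη u A))]
    infer_instance
  have h₁ := (isUniversal_iff_bijective _).1 h₀ B
  let E := (ihom.adjunction ((D.sharp u).obj A)).homEquiv X B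
  let E' := ((ihom.adjunction A).homEquiv ((D.pull u).obj X) ((D.pull u).obj B)).trans
    ((D.starAdj u).homEquiv X ((ihom A).obj ((D.pull u).obj B)))
  have h₂ : (fun f : (D.sharp u).obj A ⊗ X ⟶ B =>
      (D.sharpη u A ▷ (D.pull u).obj X ≫ μ (D.pull u) _ X) ≫ (D.pull u).map f) =
      E'.symm ∘ (fun x => x ≫ D.sharpIhom u A B) ∘ E := by
    funext f
    have h₃ : (E'.symm ∘ (fun x => x ≫ D.sharpIhom u A B) ∘ E) f =
        uncurry (((D.starAdj u).homEquiv _ _).symm (curry f ≫ D.sharpIhom u A B)) := rfl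
    have h₄ : ((D.starAdj u).homEquiv _ _).symm (curry f ≫ D.sharpIhom u A B) =
        (D.pull u).map (curry f ≫ D.sharpIhom u A B) ≫ D.starε u _ :=
      Adjunction.homEquiv_counit _ _ _ _
    rw [h₃, h₄, Functor.map_comp, Category.assoc ((D.pull u).map (curry f)), sharpIhom_fac,
      uncurry_map_homOver,
      uncurry_curry, Category.comp_id, Category.assoc]
    rfl
  rw [h₂] at h₁
  exact (Equiv.bijective_comp _ _).1 ((Equiv.comp_bijective _ _).1 h₁)

end

/-! ### A fibrewise criterion for the projection formula. -/

section

variable [D.ClosedMonoidal] [D.IsClosedMonoidalDerivator]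
variable {K J F : Type w} [SmallCategory K] [SmallCategory J] [SmallCategory F] [InDia Dia K]
  [InDia Dia J] [InDia Dia F]

/-- If universal arrows for `u` restrict to universal arrows on suitable fibres, then `u` satisfies
the projection formula. -/
theorem isIso_projection_of_fibreMap {u : K ⥤ J} (A : D.obj J) (B : D.obj K)
    (H : ∀ j : J, ∃ (F : Type w) (_ : SmallCategory F) (_ : InDia Dia F) (ι : F ⥤ K)
      (h : toPoint F ⋙ Functor.fromPUnit.{w} j = ι ⋙ u), ∀ X, D.IsUniversal _ (D.fibreMap h X)) :
    IsIso (D.projection u A B) := by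
  apply IsDerivator.conservative
  intro j
  obtain ⟨F, _, _, ι, h, hF⟩ := H j
  have h₁ : D.sharpη u ((D.pull u).obj A ⊗ B) ≫ (D.pull u).map (D.projection u A B) =
    D.tensorOver u A (D.sharpη u B) := D.fromSharp_fac _ _
  have h₂ := D.μ_comp_pullSquare (eqToHom h) A ((D.sharp u).obj B)
  have := IsClosedMonoidalDerivator.isIso_projection (D := D)
    ((D.pull (Functor.fromPUnit.{w} j)).obj A) ((D.pull ι).obj B)
  have h₃ := D.isUniversal_tensorOver (toPoint F) ((D.pull (Functor.fromPUnit.{w} j)).obj A) (hF B)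
  -- On the fibre, the value of the projection morphism at `j` fits between the fibre map of `u^*A ⊗
  -- B` and that of `B` tensored with `j^*A`. The second is universal by the projection formula over
  -- the point.
  have h₄ : μ (D.pull ι) ((D.pull u).obj A) B ≫ D.fibreMap h ((D.pull u).obj A ⊗ B) ≫
      (D.pull (toPoint F)).map ((D.pull (Functor.fromPUnit.{w} j)).map (D.projection u A B)) =
      ((D.pullSquare (eqToHom h)).app A ▷ _) ≫
        D.tensorOver (toPoint F) ((D.pull (Functor.fromPUnit.{w} j)).obj A) (D.fibreMap h B) ≫
          (D.pull (toPoint F)).map (μ (D.pull (Functor.fromPUnit.{w} j)) A _) := by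
    rw [fibreMap_comp, h₁, tensorOver, Functor.map_comp, Category.assoc,
      ← μ_natural_right_assoc, h₂, MonoidalCategory.tensorHom_def, tensorOver, fibreMap,
      MonoidalCategory.whiskerLeft_comp]
    simp only [Category.assoc]
    exact whisker_exchange_assoc _ _ _
  refine (isUniversal_comp_map_iff (hF _) _).1 ?_
  rw [← isUniversal_iso_comp_iff _ (μ (D.pull ι) ((D.pull u).obj A) B), h₄,
    isUniversal_iso_comp_iff, isUniversal_comp_map_iff h₃]
  infer_instance

end

end Prederivator

namespace Prederivator

variable {Dia : DiagramCategory.{w}} (D : Prederivator.{w, v, u} Dia)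

/-! ### Base change -/

section

variable [D.IsDerivator]
variable {P K L J : Type w} [SmallCategory P] [SmallCategory K] [SmallCategory L]
  [SmallCategory J] [InDia Dia P] [InDia Dia K] [InDia Dia L] [InDia Dia J]

/-- A Beck-Chevalley transformation is invertible if the comparison functors between slices are
right adjoints. -/
theorem isIso_bcStar_app {w : P ⥤ K} {v : P ⥤ L} {u : K ⥤ J} {x : L ⥤ J}
    (α : v ⋙ x ⟶ w ⋙ u) (h : ∀ k : K, CostructuredArrow w k ⥤ CostructuredArrow x (u.obj k))
    [∀ k, (h k).IsRightAdjoint]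
    (e : ∀ k, CostructuredArrow.proj w k ⋙ v = h k ⋙ CostructuredArrow.proj x (u.obj k))
    (hα : ∀ k, Functor.whiskerLeft (CostructuredArrow.proj w k) α ≫
      Functor.whiskerRight (overCell w k) u ≫
        eqToHom (congrArg (toPoint (CostructuredArrow w k) ⋙ ·) (fromPUnit_comp u k).symm) =
      eqToHom (congrArg (· ⋙ x) (e k)) ≫ Functor.whiskerLeft (h k) (overCell x (u.obj k)))
    (X : D.obj L) : IsIso ((D.bcStar α).app X) := by
  apply IsDerivator.conservative
  intro k
  let y := CostructuredArrow.proj w k ⋙ v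
  have ey : y = CostructuredArrow.proj w k ⋙ v := rfl
  have ep : toPoint (CostructuredArrow w k) =
    h k ⋙ toPoint (CostructuredArrow x (u.obj k)) := rfl
  -- The 2-cell `θ` is the pasting of the square with the comma cell of `w`; by `hα` it is also the
  -- comma cell of `x` restricted along `h k`.
  let θ : y ⋙ x ⟶ toPoint (CostructuredArrow w k) ⋙ Functor.fromPUnit.{w} (u.obj k) :=
    Functor.whiskerLeft (CostructuredArrow.proj w k) α ≫
      Functor.whiskerRight (overCell w k) u ≫
        eqToHom (congrArg (toPoint (CostructuredArrow w k) ⋙ ·) (fromPUnit_comp u k).symm)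
  have h₁ := D.pullSquare_comp_map_pullSquare α (overCell w k) (fromPUnit_comp u k) ey θ
    (by rw [eqToHom_refl]; exact (Category.id_comp _).symm) ((D.star x).obj X)
  have h₂ := D.compIso_comp_map_pullSquare (overCell x (u.obj k)) (h k) ep (e k) θ
    (by rw [eqToHom_refl]; exact (hα k).trans (congrArg (_ ≫ ·) (Category.comp_id _).symm))
    ((D.star x).obj X)
  have h₃ := ((D.isCouniversal_overMap x (u.obj k) X).pull ep)
  have h₄ : (D.compIso ep _).hom ≫ (D.pull (h k)).map (D.overMap x (u.obj k) X) =
      (D.pullSquare θ).app ((D.star x).obj X) ≫ (D.pull y).map (D.starε x X) ≫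
        (D.compIso (e k) X).hom := by
    rw [overMap, Functor.map_comp, reassoc_of% h₂, compIso_hom_naturality]
  have h₅ : (D.pull (toPoint (CostructuredArrow w k))).map
        ((D.pull (Functor.fromPUnit.{w} k)).map ((D.bcStar α).app X)) ≫
          D.overMap w k ((D.pull v).obj X) =
      (D.pullSquare (overCell w k)).app ((D.pull u).obj ((D.star x).obj X)) ≫
        (D.pull (CostructuredArrow.proj w k)).map
          ((D.pullSquare α).app ((D.star x).obj X) ≫ (D.pull v).map (D.starε x X)) := by
    rw [← bcStar_fac, Functor.map_comp, overMap]
    exact ((D.pullSquare (overCell w k)).naturality_assoc _ _)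
  -- Up to isomorphism, the Beck-Chevalley map at `k` carries `overMap` of `w` to the restriction of
  -- `overMap` of `x` along the right adjoint `h k`. Both are couniversal, so it is invertible.
  have h₆ : (D.pull (toPoint (CostructuredArrow w k))).map
        ((D.compIso (fromPUnit_comp u k) ((D.star x).obj X)).hom ≫
          (D.pull (Functor.fromPUnit.{w} k)).map ((D.bcStar α).app X)) ≫
          D.overMap w k ((D.pull v).obj X) =
      ((D.compIso ep _).hom ≫ (D.pull (h k)).map (D.overMap x (u.obj k) X)) ≫
        (D.compIso (e k) X).inv ≫ (D.compIso ey X).hom := by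
    rw [Functor.map_comp, Category.assoc, h₅, Functor.map_comp, reassoc_of% h₁, h₄]
    simp only [Category.assoc, Iso.hom_inv_id_assoc]
    rw [compIso_hom_naturality]
  have h₇ : D.IsCouniversal _ (((D.compIso ep _).hom ≫ (D.pull (h k)).map
      (D.overMap x (u.obj k) X)) ≫ (D.compIso (e k) X).inv ≫ (D.compIso ey X).hom) :=
    (isCouniversal_comp_iso_iff _ _).2 h₃
  rw [← h₆, isCouniversal_map_comp_iff (D.isCouniversal_overMap w k _), isIso_comp_left_iff] at h₇
  exact h₇

end

end Prederivator

/-! ### Slices of the pullback square defining `3I`. -/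

namespace Three

variable {I : Type w} [SmallCategory I]

/-- The comparison functor between the slices of the pullback square defining `3I`. -/
def sliceFunctor (k : (Tw I)ᵒᵖ) :
    CostructuredArrow (toTwOp I) k ⥤ CostructuredArrow (Ext.p I I) ((Tw.q₂ I).obj k) where
  obj X := CostructuredArrow.mk (S := Ext.p I I) (Y := (toTwProd I).obj X.left)
    ((Tw.q₂ I).map X.hom)
  map φ := CostructuredArrow.homMk ((toTwProd I).map φ.left)
    (by rw [← CostructuredArrow.w φ, Functor.map_comp]; rfl)

/-- An object of the slice of `p` determines an object of `3I`. -/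
def ofSliceObj (k : (Tw I)ᵒᵖ) (Y : CostructuredArrow (Ext.p I I) ((Tw.q₂ I).obj k)) : Three I where
  x₂ := Y.left.2
  x₁ := Y.left.1.src
  x₀ := Y.left.1.tgt
  f := Y.hom.2 ≫ k.unop.arr ≫ Y.hom.1.unop
  g := Y.left.1.arr

/-- An object of the slice of `p` determines an object of the slice of `3I ⥤ (tw I)ᵒᵖ`. -/
def ofSlice (k : (Tw I)ᵒᵖ) (Y : CostructuredArrow (Ext.p I I) ((Tw.q₂ I).obj k)) :
    CostructuredArrow (toTwOp I) k :=
  CostructuredArrow.mk (S := toTwOp I) (Y := ofSliceObj k Y)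
    (Quiver.Hom.op (X := k.unop) (Y := ⟨(ofSliceObj k Y).f⟩) ⟨Y.hom.2, Y.hom.1.unop, rfl⟩)

theorem slice_comp_left {k : (Tw I)ᵒᵖ} {Y : CostructuredArrow (Ext.p I I) ((Tw.q₂ I).obj k)}
    {X : CostructuredArrow (toTwOp I) k} (ψ : Y ⟶ (sliceFunctor k).obj X) :
    ψ.left.2 ≫ X.hom.unop.left = Y.hom.2 :=
  congrArg (fun φ => φ.2) (CostructuredArrow.w ψ)

theorem slice_comp_right {k : (Tw I)ᵒᵖ} {Y : CostructuredArrow (Ext.p I I) ((Tw.q₂ I).obj k)}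
    {X : CostructuredArrow (toTwOp I) k} (ψ : Y ⟶ (sliceFunctor k).obj X) :
    X.hom.unop.right ≫ ψ.left.1.left = Y.hom.1.unop :=
  congrArg (fun φ => φ.1.unop) (CostructuredArrow.w ψ)

/-- The construction `ofSlice` is left adjoint to `sliceFunctor`. -/
def sliceHomEquiv (k : (Tw I)ᵒᵖ) (Y : CostructuredArrow (Ext.p I I) ((Tw.q₂ I).obj k))
    (X : CostructuredArrow (toTwOp I) k) :
    (ofSlice k Y ⟶ X) ≃ (Y ⟶ (sliceFunctor k).obj X) where
  toFun φ := CostructuredArrow.homMk ((toTwProd I).map φ.left) (by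
    have := congrArg (Tw.q₂ I).map (CostructuredArrow.w φ)
    rw [Functor.map_comp] at this
    exact this)
  invFun ψ := CostructuredArrow.homMk
    (show ofSliceObj k Y ⟶ X.left from
      ⟨ψ.left.2, ψ.left.1.left, ψ.left.1.right, by
        change ψ.left.2 ≫ X.left.f ≫ ψ.left.1.left = Y.hom.2 ≫ k.unop.arr ≫ Y.hom.1.unop
        have h : X.hom.unop.left ≫ k.unop.arr ≫ X.hom.unop.right = X.left.f := X.hom.unop.w
        rw [← slice_comp_left ψ, ← slice_comp_right ψ, ← h]
        exact (congrArg (_ ≫ ·) ((Category.assoc _ _ _).trans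
          (congrArg (_ ≫ ·) (Category.assoc _ _ _)))).trans (Category.assoc _ _ _).symm, ψ.left.1.w⟩)
    (Quiver.Hom.unop_inj (Tw.hom_ext (slice_comp_left ψ) (slice_comp_right ψ)))
  left_inv φ := rfl
  right_inv ψ := rfl

instance isRightAdjoint_sliceFunctor (k : (Tw I)ᵒᵖ) : (sliceFunctor k).IsRightAdjoint :=
  (Adjunction.adjunctionOfEquivLeft (sliceHomEquiv k) (fun _ _ _ _ _ => rfl)).isRightAdjoint

end Three

namespace Prederivator

variable {Dia : DiagramCategory.{w}} (D : Prederivator.{w, v, u} Dia) [D.IsDerivator]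
variable {I : Type w} [SmallCategory I] [InDia Dia I]

/-- Base change holds for the pullback square defining `3I`. -/
theorem isIso_bcStar_three (X : D.obj (Tw I × I)) :
    IsIso ((D.bcStar (w := Three.toTwOp I) (v := Three.toTwProd I) (u := Tw.q₂ I) (x := Ext.p I I)
      (𝟙 (Three.toTwProd I ⋙ Ext.p I I))).app X) := by
  refine D.isIso_bcStar_app _ Three.sliceFunctor (fun _ => rfl) (fun k => ?_) X
  apply NatTrans.ext
  funext Y
  rw [NatTrans.comp_app, NatTrans.comp_app, NatTrans.comp_app, eqToHom_app]
  exact (Category.id_comp _).trans ((Category.comp_id _).trans (Category.id_comp _).symm)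

instance isIso_ΘBaseChange [D.ClosedMonoidal] (A B : D.obj I) : IsIso (D.ΘBaseChange A B) := by
  have := D.isIso_bcStar_three
    ((ihom ((D.pull (Ext.q I I)).obj A)).obj ((D.pull (Ext.r I I)).obj B))
  exact @Functor.map_isIso _ _ _ _ _ _ (D.star (Tw.pq₂ I)) _ this

end Prederivator

/-! ### Fibres -/

section

variable {I : Type w} [SmallCategory I]

namespace Tw

/-- The arrow from an initial object `o` to `k`. -/
def ofIsInitial {o : I} (ho : Limits.IsInitial o) (k : I) : Tw I := ⟨ho.to k⟩

/-- If `o` is initial, then `k ↦ (o ⟶ k)` is right adjoint to the target functor. -/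
def targetHomEquiv {o : I} (ho : Limits.IsInitial o) (f : Tw I) (k : I) :
    ((target I).obj f ⟶ k) ≃ (f ⟶ ofIsInitial ho k) where
  toFun φ := ⟨ho.to f.src, φ, ho.hom_ext _ _⟩
  invFun ψ := ψ.right
  left_inv _ := rfl
  right_inv _ := hom_ext (ho.hom_ext _ _) rfl

/-- A morphism to `o ⟶ k` in `tw I` is determined by its right component: the left component and the
commutativity condition concern arrows out of the initial object `o`. -/
theorem isLeftAdjoint_target {o : I} (ho : Limits.IsInitial o) : (target I).IsLeftAdjoint :=
  (Adjunction.adjunctionOfEquivRight (targetHomEquiv ho)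
    (fun _ _ _ _ _ => hom_ext (ho.hom_ext _ _) rfl)).isLeftAdjoint

end Tw

namespace Three

/-- The functor from `tw (x \ I)` to the fibre of `t₂` over `x`. -/
def ofTw (x : I) : Tw (StructuredArrow x (𝟭 I)) ⥤ Three I where
  obj f := { x₂ := x, x₁ := f.src.right, x₀ := f.tgt.right, f := f.src.hom, g := f.arr.right }
  map {f g} φ :=
    { a₂ := 𝟙 x
      a₁ := φ.left.right
      a₀ := φ.right.right
      wf := (Category.id_comp _).trans (StructuredArrow.w φ.left)
      wg := congrArg (fun ψ => ψ.right) φ.w }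
  map_comp _ _ := hom_ext (Category.id_comp _).symm rfl rfl

/-- The functor `ofTw x` as a functor to `x \ 3I`. -/
def ofTwUnder (x : I) : Tw (StructuredArrow x (𝟭 I)) ⥤ StructuredArrow x (t₂ I) where
  obj f := StructuredArrow.mk (Y := (ofTw x).obj f) (𝟙 x)
  map φ := StructuredArrow.homMk ((ofTw x).map φ) (Category.id_comp _)
  map_comp _ _ := StructuredArrow.hom_ext _ _ ((ofTw x).map_comp _ _)

/-- The object `x ⟶ X₁ ⟶ X₀` of `tw (x \ I)` given by an object `x ⟶ X₂ ⟶ X₁ ⟶ X₀` of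
`x \ 3I`. -/
def toTwUnder (x : I) (X : StructuredArrow x (t₂ I)) : Tw (StructuredArrow x (𝟭 I)) where
  src := StructuredArrow.mk (T := 𝟭 I) (Y := X.right.x₁) (X.hom ≫ X.right.f)
  tgt := StructuredArrow.mk (T := 𝟭 I) (Y := X.right.x₀) ((X.hom ≫ X.right.f) ≫ X.right.g)
  arr := StructuredArrow.homMk X.right.g rfl

theorem ofTwUnder_hom {x : I} {f : Tw (StructuredArrow x (𝟭 I))} {X : StructuredArrow x (t₂ I)}
    (φ : (ofTwUnder x).obj f ⟶ X) : X.hom = φ.right.a₂ :=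
  (StructuredArrow.w φ).symm.trans (Category.id_comp _)

/-- Stated for free variables, so that all four equations can be eliminated by substitution. -/
theorem comp_aux {x a b c d e : I} {y a₂ : x ⟶ a} {f : a ⟶ b} {a₁ : b ⟶ c} {r : c ⟶ d} {a₀ : d ⟶ e}
    {s : x ⟶ c} {t : x ⟶ d} {g : b ⟶ e} (h₁ : y = a₂) (h₂ : a₂ ≫ f ≫ a₁ = s) (h₃ : s ≫ r = t)
    (h₄ : a₁ ≫ r ≫ a₀ = g) : t ≫ a₀ = (y ≫ f) ≫ g := by
  subst h₁ h₂ h₃ h₄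
  simp only [Category.assoc]

/-- The construction `toTwUnder` is right adjoint to `ofTwUnder`. -/
def ofTwUnderHomEquiv (x : I) (f : Tw (StructuredArrow x (𝟭 I))) (X : StructuredArrow x (t₂ I)) :
    ((ofTwUnder x).obj f ⟶ X) ≃ (f ⟶ toTwUnder x X) where
  toFun φ :=
    { left := StructuredArrow.homMk φ.right.a₁
        ((congrArg (fun a => (a ≫ X.right.f) ≫ φ.right.a₁) (ofTwUnder_hom φ)).trans
          ((Category.assoc _ _ _).trans φ.right.wf))
      right := StructuredArrow.homMk φ.right.a₀ (comp_aux (ofTwUnder_hom φ) φ.right.wf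
        (StructuredArrow.w f.arr) φ.right.wg)
      w := StructuredArrow.hom_ext _ _ φ.right.wg }
  invFun ψ := StructuredArrow.homMk
    (show (ofTw x).obj f ⟶ X.right from
      { a₂ := X.hom
        a₁ := ψ.left.right
        a₀ := ψ.right.right
        wf := by
          have h₁ : (X.hom ≫ X.right.f) ≫ ψ.left.right = f.src.hom := StructuredArrow.w ψ.left
          exact (Category.assoc _ _ _).symm.trans h₁
        wg := congrArg (fun ψ => ψ.right) ψ.w }) (Category.id_comp _)
  left_inv φ := StructuredArrow.hom_ext _ _ (hom_ext (ofTwUnder_hom φ) rfl rfl)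
  right_inv ψ := rfl

/-- The right adjoint replaces `X₂` by `x`, composing `x ⟶ X₂ ⟶ X₁`; consequently `t₂_#` at `x` can
be computed on `tw (x \ I)`. -/
theorem isLeftAdjoint_ofTwUnder (x : I) : (ofTwUnder x).IsLeftAdjoint :=
  (Adjunction.adjunctionOfEquivRight (ofTwUnderHomEquiv x) (fun _ _ _ _ _ => rfl)).isLeftAdjoint

/-- The object of `3I` over `y` given by an arrow `f`. -/
def ofHomObj (y : Tw I × I) (f : y.2 ⟶ y.1.src) : Three I := { f := f, g := y.1.arr }

/-- The fibre of `3I ⥤ tw I × I` over `y`. -/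
def ofHom (y : Tw I × I) : Discrete (y.2 ⟶ y.1.src) ⥤ Three I :=
  Discrete.functor (ofHomObj y)

theorem ofHom_comp_toTwProd (y : Tw I × I) :
    toPoint (Discrete (y.2 ⟶ y.1.src)) ⋙ Functor.fromPUnit.{w} y = ofHom y ⋙ toTwProd I := by
  refine CategoryTheory.Functor.ext (fun _ => rfl) ?_
  rintro ⟨f⟩ ⟨g⟩ φ
  obtain rfl := Discrete.eq_of_hom φ
  obtain rfl : φ = 𝟙 _ := Subsingleton.elim _ _
  rw [CategoryTheory.Functor.map_id, CategoryTheory.Functor.map_id]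
  exact ((Category.id_comp _).trans (Category.comp_id _)).symm

/-- The functor `ofHom y` as a functor to `y \ 3I`. -/
def ofHomUnder (y : Tw I × I) : Discrete (y.2 ⟶ y.1.src) ⥤ StructuredArrow y (toTwProd I) :=
  Discrete.functor fun f =>
    StructuredArrow.mk (T := toTwProd I) (Y := ofHomObj y f)
      (show y ⟶ (toTwProd I).obj (ofHomObj y f) from 𝟙 y)

theorem ofHom_eq (y : Tw I × I) :
    ofHom y = ofHomUnder y ⋙ StructuredArrow.proj y (toTwProd I) := by
  refine CategoryTheory.Functor.ext (fun _ => rfl) ?_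
  rintro ⟨f⟩ ⟨g⟩ φ
  obtain rfl := Discrete.eq_of_hom φ
  obtain rfl : φ = 𝟙 _ := Subsingleton.elim _ _
  rw [CategoryTheory.Functor.map_id, CategoryTheory.Functor.map_id]
  exact ((Category.id_comp _).trans (Category.comp_id _)).symm

/-- The arrow `y₂ ⟶ X₂ ⟶ X₁ ⟶ y₁` given by an object of `y \ 3I`. -/
def toHom (y : Tw I × I) (X : StructuredArrow y (toTwProd I)) : Discrete (y.2 ⟶ y.1.src) :=
  Discrete.mk (X.hom.2 ≫ X.right.f ≫ X.hom.1.left)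

theorem ofHomUnder_hom {y : Tw I × I} {f : Discrete (y.2 ⟶ y.1.src)}
    {X : StructuredArrow y (toTwProd I)} (φ : (ofHomUnder y).obj f ⟶ X) :
    X.hom = (toTwProd I).map φ.right :=
  (StructuredArrow.w φ).symm.trans (Category.id_comp _)

/-- The construction `toHom` is right adjoint to `ofHomUnder`. -/
def ofHomUnderHomEquiv (y : Tw I × I) (f : Discrete (y.2 ⟶ y.1.src))
    (X : StructuredArrow y (toTwProd I)) : ((ofHomUnder y).obj f ⟶ X) ≃ (f ⟶ toHom y X) where
  toFun φ := Discrete.eqToHom' (by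
    have h := ofHomUnder_hom φ
    exact φ.right.wf.symm.trans (congrArg (fun ψ => ψ.2 ≫ X.right.f ≫ ψ.1.left) h.symm))
  invFun ψ := StructuredArrow.homMk
    (show ofHomObj y f.as ⟶ X.right from
      { a₂ := X.hom.2
        a₁ := X.hom.1.left
        a₀ := X.hom.1.right
        wf := (Discrete.eq_of_hom ψ).symm
        wg := X.hom.1.w }) (Category.id_comp _)
  left_inv φ := StructuredArrow.hom_ext _ _ 
    (hom_ext (congrArg (fun ψ => ψ.2) (ofHomUnder_hom φ))
      (congrArg (fun ψ => ψ.1.left) (ofHomUnder_hom φ))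
      (congrArg (fun ψ => ψ.1.right) (ofHomUnder_hom φ)))
  right_inv ψ := Subsingleton.elim _ _

/-- An arrow from `y` to the image of `X` lifts uniquely to an arrow into `X`, since its source must
be the composite `y₂ ⟶ X₂ ⟶ X₁ ⟶ y₁`. Thus `toTwProd` is a discrete fibration. -/
theorem isLeftAdjoint_ofHomUnder (y : Tw I × I) : (ofHomUnder y).IsLeftAdjoint :=
  (Adjunction.adjunctionOfEquivRight (ofHomUnderHomEquiv y)
    (fun _ _ _ _ _ => Subsingleton.elim _ _)).isLeftAdjoint

/-- Closure under subcategories applies, because the fibre embeds into `3I`, which belongs to `Dia`.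
-/
instance inDia_discrete {Dia : DiagramCategory.{w}} [InDia Dia I] (y : Tw I × I) :
    InDia Dia (Discrete (y.2 ⟶ y.1.src)) := by
  have : (ofHom y).Faithful := ⟨fun _ => Subsingleton.elim _ _⟩
  refine InDia.of_subcategory (ofHom y) ?_
  rintro ⟨f⟩ ⟨g⟩ h
  obtain rfl : f = g := eq_of_heq (Three.mk.inj h).2.2.2.1
  rfl

end Three

end

namespace Prederivator

variable {Dia : DiagramCategory.{w}} (D : Prederivator.{w, v, u} Dia)

/-! ### Invertibility of the parts of `Θ` -/

section

variable {I : Type w} [SmallCategory I] [InDia Dia I]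

/-- The map `t^*A ⟶ p^* x^*A` for the category `x \ I`. -/
def initialMap (x : I) (A : D.obj I) : (D.pull (StructuredArrow.proj x (𝟭 I))).obj A ⟶
    (D.pull (toPoint (StructuredArrow x (𝟭 I)))).obj
      ((D.pull (Functor.fromPUnit.{w} x)).obj A) :=
  (D.pull₂ (underCell (𝟭 I) x)).app A ≫ (D.compIso rfl A).hom

theorem initialMap_naturality (x : I) {A B : D.obj I} (f : A ⟶ B) :
    (D.pull (StructuredArrow.proj x (𝟭 I))).map f ≫ D.initialMap x B = D.initialMap x A ≫
      (D.pull (toPoint (StructuredArrow x (𝟭 I)))).map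
        ((D.pull (Functor.fromPUnit.{w} x)).map f) := by
  have h := (D.pull₂ (underCell (𝟭 I) x)).naturality f
  rw [initialMap, initialMap, Category.assoc, ← compIso_hom_naturality]
  exact (reassoc_of% h) _

/-- Separating off the unit constraint `pullId` lets the pointwise formula for `𝟭_#` be read as a
statement about `x^*A`. -/
theorem pullSquare_underCell_id (x : I) (A : D.obj I) :
    (D.pullSquare (underCell (𝟭 I) x)).app A =
      (D.pull (StructuredArrow.proj x (𝟭 I))).map ((D.pullId I).hom.app A) ≫ D.initialMap x A := by
  have e : StructuredArrow.proj x (𝟭 I) = StructuredArrow.proj x (𝟭 I) ⋙ 𝟭 I := rfl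
  have h : (D.compIso e A).inv =
      (D.pull (StructuredArrow.proj x (𝟭 I))).map ((D.pullId I).hom.app A) := by
    rw [← cancel_epi (D.compIso e A).hom, Iso.hom_inv_id, D.compIso_hom_of_comp_id e,
      ← Functor.map_comp, Iso.inv_hom_id_app, CategoryTheory.Functor.map_id]
    rfl
  rw [pullSquare_app, ← h]
  rfl

end

section

variable [D.IsDerivator]
variable {I : Type w} [SmallCategory I] [InDia Dia I]

theorem isUniversal_fibreMap_t₂ (x : I) (h : toPoint (Tw (StructuredArrow x (𝟭 I))) ⋙
    Functor.fromPUnit.{w} x = Three.ofTw x ⋙ Three.t₂ I) (A : D.obj (Three I)) :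
    D.IsUniversal _ (D.fibreMap h A) := by
  have := Three.isLeftAdjoint_ofTwUnder x
  refine D.isUniversal_fibreMap h (Three.ofTwUnder x) rfl ?_ A
  apply NatTrans.ext
  funext f
  rw [NatTrans.comp_app, NatTrans.comp_app, eqToHom_app, eqToHom_app, eqToHom_app]
  exact ((Category.id_comp _).trans (Category.comp_id _)).symm

theorem isUniversal_fibreMap_toTwProd (y : Tw I × I) (A : D.obj (Three I)) :
    D.IsUniversal _ (D.fibreMap (Three.ofHom_comp_toTwProd y) A) := by
  have := Three.isLeftAdjoint_ofHomUnder y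
  refine D.isUniversal_fibreMap _ (Three.ofHomUnder y) (Three.ofHom_eq y) ?_ A
  apply NatTrans.ext
  funext f
  rw [NatTrans.comp_app, NatTrans.comp_app, eqToHom_app, eqToHom_app, eqToHom_app]
  exact ((Category.id_comp _).trans (Category.comp_id _)).symm

/-- The map `initialMap` is universal, as `x \ I` has an initial object. -/
theorem isUniversal_initialMap (x : I) (A : D.obj I) : D.IsUniversal _ (D.initialMap x A) := by
  -- Universality comes from the pointwise formula for `u = 𝟭`: as `𝟭^*` is an equivalence, the unit
  -- of `𝟭_# ⊣ 𝟭^*` is invertible, and `underMap` differs from `initialMap` by the isomorphism `e`.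
  have : (D.pull (𝟭 I)).IsEquivalence := Functor.isEquivalence_of_iso (D.pullId I).symm
  have h₁ : IsIso (D.sharpη (𝟭 I) A) :=
    inferInstanceAs (IsIso ((D.sharpAdj (𝟭 I)).unit.app A))
  let e : A ⟶ (D.sharp (𝟭 I)).obj A := D.sharpη (𝟭 I) A ≫ (D.pullId I).hom.app _
  have h₂ : IsIso e := IsIso.comp_isIso
  have h₃ : D.underMap (𝟭 I) x A = D.initialMap x A ≫
      (D.pull (toPoint (StructuredArrow x (𝟭 I)))).map
        ((D.pull (Functor.fromPUnit.{w} x)).map e) := by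
    rw [underMap, pullSquare_underCell_id, ← initialMap_naturality, Functor.map_comp,
      Category.assoc]
  have h₄ : D.initialMap x A = D.underMap (𝟭 I) x A ≫
      (D.pull (toPoint (StructuredArrow x (𝟭 I)))).map
        ((D.pull (Functor.fromPUnit.{w} x)).map (inv e)) := by
    rw [h₃, Category.assoc, ← Functor.map_comp, ← Functor.map_comp, IsIso.hom_inv_id,
      CategoryTheory.Functor.map_id, CategoryTheory.Functor.map_id, Category.comp_id]
  rw [h₄, isUniversal_comp_map_iff (D.isUniversal_underMap _ _ _)]
  infer_instance

/-- The map `t₂_# t₀^*A ⟶ A` induced by the transformation `t₂ ⟶ t₀`. -/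
def threeFromSharp (A : D.obj I) :
    (D.sharp (Three.t₂ I)).obj ((D.pull (Three.t₀ I)).obj A) ⟶ A :=
  D.fromSharp (Three.t₂ I) ((D.pull₂ (Three.τ I)).app A)

/-- On `tw (x \ I)` the component of `τ` at `x ⟶ x₁ ⟶ x₀` is the structure arrow `x ⟶ x₀`. Hence `τ`
restricts to the comma cell of `x \ I` pulled back along the target functor. -/
theorem fibreMap_comp_threeFromSharp (x : I) (h : toPoint (Tw (StructuredArrow x (𝟭 I))) ⋙
    Functor.fromPUnit.{w} x = Three.ofTw x ⋙ Three.t₂ I) (A : D.obj I)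
    (e₁ : Tw.target (StructuredArrow x (𝟭 I)) ⋙ StructuredArrow.proj x (𝟭 I) =
      Three.ofTw x ⋙ Three.t₀ I)
    (e₂ : toPoint (Tw (StructuredArrow x (𝟭 I))) =
      Tw.target (StructuredArrow x (𝟭 I)) ⋙ toPoint _) :
    D.fibreMap h ((D.pull (Three.t₀ I)).obj A) ≫ (D.pull (toPoint _)).map
        ((D.pull (Functor.fromPUnit.{w} x)).map (D.threeFromSharp A)) =
      ((D.compIso rfl A).inv ≫ (D.compIso e₁.symm A).hom) ≫
        (D.pull (Tw.target (StructuredArrow x (𝟭 I)))).map (D.initialMap x A) ≫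
          (D.compIso e₂ _).inv := by
  have h₁ : Three.ofTw x ⋙ Three.t₀ I = Three.ofTw x ⋙ Three.t₀ I := rfl
  have h₂ : Three.ofTw x ⋙ Three.t₂ I = Three.ofTw x ⋙ Three.t₂ I := rfl
  let θ : Three.ofTw x ⋙ Three.t₂ I ⟶ Three.ofTw x ⋙ Three.t₀ I :=
    Functor.whiskerLeft (Three.ofTw x) (Three.τ I)
  have h₃ := D.pull₂_app_comp_compIso_of_whiskerLeft h₂ h₁ (Three.τ I) θ
    (by rw [eqToHom_refl, eqToHom_refl, Category.id_comp, Category.comp_id]) A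
  have e₃ : toPoint (Tw (StructuredArrow x (𝟭 I))) ⋙ Functor.fromPUnit.{w} x =
    Tw.target (StructuredArrow x (𝟭 I)) ⋙ toPoint _ ⋙ Functor.fromPUnit.{w} x := rfl
  have h₄ := D.pull₂_app_comp_compIso_of_whiskerLeft e₃ e₁.symm (underCell (𝟭 I) x)
    (eqToHom h ≫ θ) (by
      apply NatTrans.ext
      funext f
      rw [NatTrans.comp_app, NatTrans.comp_app, NatTrans.comp_app, eqToHom_app, eqToHom_app,
        eqToHom_app]
      exact (Category.id_comp _).trans ((StructuredArrow.w f.arr).trans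
        ((Category.id_comp _).trans (Category.comp_id _)).symm)) A
  have h₅ := NatTrans.congr_app (D.pull₂_comp (eqToHom h) θ) A
  rw [NatTrans.comp_app] at h₅
  have h₆ := D.compIso_hom_comp_map_hom
    (rfl : toPoint (Tw (StructuredArrow x (𝟭 I))) ⋙ Functor.fromPUnit.{w} x = _) e₂ e₃ rfl A
  have h₇ : (D.pull (Three.ofTw x)).map ((D.pull₂ (Three.τ I)).app A) ≫ (D.compIso h₂ A).inv =
      (D.compIso h₁ A).inv ≫ (D.pull₂ θ).app A := by
    rw [Iso.comp_inv_eq, Category.assoc, h₃, Iso.inv_hom_id_assoc]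
  rw [fibreMap_comp, threeFromSharp, fromSharp_fac, pullSquare_app, initialMap, Functor.map_comp,
    Category.assoc, Category.assoc, ← reassoc_of% h₄, h₆, h₅, reassoc_of% h₇, Category.assoc]

/-- At `x` the map compares two universal arrows: the fibre map of `t₂`, and `initialMap` restricted
along the target functor, a left adjoint because `𝟙 x` is initial in `x \ I`. -/
instance isIso_threeFromSharp (A : D.obj I) : IsIso (D.threeFromSharp A) := by
  apply IsDerivator.conservative
  intro x
  have h : toPoint (Tw (StructuredArrow x (𝟭 I))) ⋙
    Functor.fromPUnit.{w} x = Three.ofTw x ⋙ Three.t₂ I := rfl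
  have e₁ : Tw.target (StructuredArrow x (𝟭 I)) ⋙ StructuredArrow.proj x (𝟭 I) =
      Three.ofTw x ⋙ Three.t₀ I := rfl
  have e₂ : toPoint (Tw (StructuredArrow x (𝟭 I))) =
      Tw.target (StructuredArrow x (𝟭 I)) ⋙ toPoint _ := rfl
  have : (Tw.target (StructuredArrow x (𝟭 I))).IsLeftAdjoint :=
    Tw.isLeftAdjoint_target (StructuredArrow.mkIdInitial (T := 𝟭 I) (Y := x))
  have h₁ := (D.isUniversal_initialMap x A).pull e₂
  rw [← isUniversal_iso_comp_iff _ ((D.compIso rfl A).inv ≫ (D.compIso e₁.symm A).hom),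
    ← D.fibreMap_comp_threeFromSharp x h A e₁ e₂,
    isUniversal_comp_map_iff (D.isUniversal_fibreMap_t₂ x h _)] at h₁
  exact h₁

end

/-! ### Projection formulas on `3I` and invertibility of the zigzag. -/

section

variable [D.ClosedMonoidal] [D.IsClosedMonoidalDerivator]
variable {I : Type w} [SmallCategory I] [InDia Dia I]

theorem isIso_projection_t₂ (A : D.obj I) (B : D.obj (Three I)) :
    IsIso (D.projection (Three.t₂ I) A B) :=
  D.isIso_projection_of_fibreMap A B fun x =>
    ⟨_, _, inferInstance, Three.ofTw x, rfl, D.isUniversal_fibreMap_t₂ x rfl⟩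

theorem isIso_projection_toTwProd (A : D.obj (Tw I × I)) (B : D.obj (Three I)) :
    IsIso (D.projection (Three.toTwProd I) A B) :=
  D.isIso_projection_of_fibreMap A B fun y =>
    ⟨_, _, inferInstance, Three.ofHom y, Three.ofHom_comp_toTwProd y,
      D.isUniversal_fibreMap_toTwProd y⟩

instance isIso_ΘComparison (A B : D.obj I) : IsIso (D.ΘComparison A B) := by
  have := D.isIso_pullIhom (Three.toTwProd I) ((D.pull (Ext.q I I)).obj A)
    ((D.pull (Ext.r I I)).obj B) (fun X => D.isIso_projection_toTwProd _ X)
  rw [ΘComparison]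
  infer_instance

instance isIso_ΘIdentification (A B : D.obj I) : IsIso (D.ΘIdentification A B) := by
  rw [ΘIdentification]
  infer_instance

instance isIso_ΘBackward (A B : D.obj I) : IsIso (D.ΘBackward A B) := by
  rw [ΘBackward]
  infer_instance

/-- The first two arrows combine, by contravariance of `[·, B]`, into the one induced by the
isomorphism `threeFromSharp`; the third is invertible by the projection formula for `t₂`. -/
instance isIso_ΘForward (A B : D.obj I) : IsIso (D.ΘForward A B) := by
  have h₁ := D.isIso_sharpIhom (Three.t₂ I) ((D.pull (Three.t₀ I)).obj A) B
    (fun X => D.isIso_projection_t₂ X _)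
  have h₂ : D.ΘForward A B = D.ihomMap (D.threeFromSharp A) (𝟙 B) ≫
      D.sharpIhom (Three.t₂ I) ((D.pull (Three.t₀ I)).obj A) B := by
    have h₃ : D.threeFromSharp A = (D.sharp (Three.t₂ I)).map ((D.pull₂ (Three.τ I)).app A) ≫
        (D.sharpAdj (Three.t₂ I)).counit.app A := Adjunction.homEquiv_counit _ _ _ _
    rw [h₃, ihomMap_id_right, MonoidalClosed.pre_map, ΘForward, NatTrans.comp_app, Category.assoc]
  rw [h₂]
  infer_instance

instance isIso_Θ (A B : D.obj I) : IsIso (D.Θ A B) := by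
  rw [Θ]
  infer_instance

end

end Prederivator

end

/-- For a closed monoidal derivator, the internal homs form a lax natural transformation, and so do
the objects `(pq)₂_* q₂^*⟦A, B⟧`; the arrows to be inverted in the definition of
`Θ : [A, B] ⟶ (pq)₂_* q₂^*⟦A, B⟧` are invertible; `Θ` itself is invertible, natural in `A` and `B`,
and compatible with restriction along functors. -/
theorem mainTheorem8 {Dia : DiagramCategory.{w}} (D : Prederivator.{w, v, u} Dia)
    [D.ClosedMonoidal] [D.IsClosedMonoidalDerivator] :
    D.IsLaxNatural D.source D.pullIhom ∧
    D.IsLaxNatural D.target D.pullTarget ∧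
    (∀ {I : Type w} [SmallCategory I] [InDia Dia I] (A B : D.obj I),
      IsIso (D.ΘBaseChange A B) ∧ IsIso (D.ΘComparison A B)) ∧
    ∃ _ : ∀ {I : Type w} [SmallCategory I] [InDia Dia I] (A B : D.obj I),
        IsIso (D.ΘBackward A B),
      (∀ {I : Type w} [SmallCategory I] [InDia Dia I] (A B : D.obj I), IsIso (D.Θ A B)) ∧
      D.IsModification (F := D.source) (G := D.target) D.pullIhom D.pullTarget (fun A B => D.Θ A B) := by
  have h := D.isModification_Θ (fun A B => D.isIso_ΘBackward A B)
  exact ⟨D.isLaxNatural_pullIhom,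
    -- The coherence laws of `pullTarget` are inherited from those of `pullIhom` through the
    -- invertible `Θ`.
    Prederivator.IsModification.isLaxNatural D h (fun A B => D.isIso_Θ A B) D.isLaxNatural_pullIhom,
    fun A B => ⟨D.isIso_ΘBaseChange A B, D.isIso_ΘComparison A B⟩,
    fun A B => D.isIso_ΘBackward A B, fun A B => D.isIso_Θ A B, h⟩
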